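/- Let $\mathbb{T}^1=\mathbb{R}/2\pi\mathbb{Z}$, $T=32\pi$, $R\in\mathbb{N}$, let $\omega\subset\mathbb{T}^1$ be a non-empty open set with indicator function $\chi_\omega$, and let $\Box=-\partial_t^2+\partial_x^2$. **(i) Observability.** For all smooth $b,c:\mathbb{T}^1\to\mathbb{R}^{R\times R}$ there is $C_0>0$ such that every weak solution $\varphi\in C([0,T];L^2(\mathbb{T}^1;\mathbb{R}^R))\cap C^1([0,T];H^{-1}(\mathbb{T}^1;\mathbb{R}^R))$ of $$\Box\varphi+b(x)\,\partial_x\varphi+c(x)\,\varphi=0\quad\text{on }[0,T]\times\mathbb{T}^1$$ satisfies $$\int_0^T\|\chi_\omega\varphi(t)\|_{L^2}^2\,dt\ \ge\ C_0\left(\|\varphi(0)\|_{L^2}^2+\|\varphi_t(0)\|_{H^{-1}}^2\right).$$ **(ii) Exact controllability.** For all smooth $B,C:\mathbb{T}^1\to\mathbb{R}^{R\times R}$ there is $S>0$ such that for every $(w_0,w_1)\in H^1(\mathbb{T}^1;\mathbb{R}^R)\times L^2(\mathbb{T}^1;\mathbb{R}^R)$ there is a control $\alpha\in C([0,T];L^2(\mathbb{T}^1;\mathbb{R}^R))$,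 supported in $\omega$, such that the system $$\Box w-B(x)\,\partial_xw-C(x)\,w=\chi_\omega\alpha,\qquad (w,w_t)(0)=(w_0,w_1)$$ has a unique weak solution $w\in C([0,T];H^1)\cap C^1([0,T];L^2)$, and this solution satisfies $(w,w_t)(T)=(0,0)$ and $$\|\alpha\|_{L^\infty(0,T;L^2)}+\|w\|_{\mathcal{W}_T}\le S\left(\|w_0\|_{H^1}^2+\|w_1\|_{L^2}^2\right)^{1/2}.$$ Here, with $u=t+x$, $v=t-x$ and $D_T=[0,T]\times\mathbb{T}^1$, $$\|w\|_{\mathcal{W}_T}=\|w_v\|_{L^2_vL^\infty_u\cap L^\infty_uL^2_v(D_T)}+\|w_u\|_{L^2_uL^\infty_v\cap L^\infty_vL^2_u(D_T)}+\|w\|_{C(D_T)}+\|(w_x,w_t)\|_{C([0,T];L^2)},$$ where the norm of an intersection is the sum of the two norms, and the mixed norms are taken over $u,v\in\mathbb{R}$ after $D_T$ has been identified with $[0,T]\times[0,2\pi)$ and the function has been extended by zero. -/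

import Mathlib

open MeasureTheory Set Topology
open scoped ENNReal InnerProductSpace

noncomputable section

namespace WaveControl

instance instFactTwoPiPos : Fact (0 < 2 * Real.pi) := ⟨Real.two_pi_pos⟩

/-- The circle `ℝ / 2πℤ`, with its Lebesgue measure `volume` of total mass `2π`. -/
abbrev Circ : Type := AddCircle (2 * Real.pi)

/-- The Euclidean space in which the unknowns take their values. -/
abbrev E (R : ℕ) : Type := EuclideanSpace ℝ (Fin R)

/-- `L²` of the circle with values in `ℝ^R`. -/
abbrev L2 (R : ℕ) : Type := Lp (E R) 2 (volume : Measure Circ)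

/-- A function on the circle is smooth if its `2π`-periodic lift to the line is. -/
def Smooth {F : Type*} [NormedAddCommGroup F] [NormedSpace ℝ F] (f : Circ → F) : Prop :=
  ContDiff ℝ (⊤ : ℕ∞) (fun s : ℝ => f (s : Circ))

/-- The derivative `∂ₓ f` of a function on the circle. -/
def dx {F : Type*} [NormedAddCommGroup F] [NormedSpace ℝ F] (f : Circ → F) (x : Circ) : F :=
  deriv (fun s : ℝ => f (x + (s : Circ))) 0

section Helpers

variable {F : Type*} [NormedAddCommGroup F] [NormedSpace ℝ F]

theorem dx_coe (f : Circ → F) (s : ℝ) :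
    dx f (s : Circ) = deriv (fun r : ℝ => f (r : Circ)) s := by
  have h : (fun r : ℝ => f ((s : Circ) + (r : Circ)))
      = fun r : ℝ => (fun q : ℝ => f (q : Circ)) (s + r) := by
    funext r
    simp
  rw [dx, h, deriv_comp_const_add (fun q : ℝ => f (q : Circ)) s 0, add_zero]

theorem Smooth.continuous {f : Circ → F} (hf : Smooth f) : Continuous f := by
  have h : Continuous (f ∘ (QuotientAddGroup.mk : ℝ → Circ)) := ContDiff.continuous hf
  exact (QuotientAddGroup.isQuotientMap_mk (N := AddSubgroup.zmultiples (2 * Real.pi))).continuous_iff.2 h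

theorem Smooth.dx {f : Circ → F} (hf : Smooth f) : Smooth (dx f) := by
  have h : (fun s : ℝ => WaveControl.dx f (s : Circ)) = deriv (fun r : ℝ => f (r : Circ)) :=
    funext (dx_coe f)
  unfold Smooth
  rw [h]
  exact ((contDiff_infty_iff_deriv (𝕜 := ℝ)).1 hf).2

theorem Smooth.memLp {f : Circ → F} (hf : Smooth f) : MemLp f 2 (volume : Measure Circ) :=
  hf.continuous.memLp_of_hasCompactSupport (HasCompactSupport.of_compactSpace f)

theorem integral_dx [CompleteSpace F] {f : Circ → F} (hf : Smooth f) :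
    ∫ x : Circ, WaveControl.dx f x = 0 := by
  rw [← AddCircle.intervalIntegral_preimage (2 * Real.pi) 0]
  have h : (fun s : ℝ => WaveControl.dx f (s : Circ)) = deriv (fun r : ℝ => f (r : Circ)) :=
    funext (dx_coe f)
  have hd : ContDiff ℝ (⊤ : ℕ∞) (fun r : ℝ => f (r : Circ)) := hf
  rw [show (∫ a in (0:ℝ)..(0 + 2 * Real.pi), WaveControl.dx f (a : Circ))
      = ∫ a in (0:ℝ)..(0 + 2 * Real.pi), deriv (fun r : ℝ => f (r : Circ)) a by rw [← h]]
  rw [intervalIntegral.integral_deriv_eq_sub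
    (fun x _ => (hd.differentiable (by simp)).differentiableAt)
    ((hd.continuous_deriv (by simp)).intervalIntegrable _ _)]
  rw [zero_add, AddCircle.coe_period, QuotientAddGroup.mk_zero, sub_self]

end Helpers

/-- The Sobolev space `H¹` of the circle with values in `ℝ^R`: the pairs `(f, g)` of `L²` functions
such that `g` is the weak derivative of `f`, with the norm `(‖f‖² + ‖g‖²)^{1/2}`. -/
def H1 (R : ℕ) : Submodule ℝ (WithLp 2 (L2 R × L2 R)) where
  carrier := {p | ∀ θ : Circ → E R, ∀ hθ : Smooth θ,
    ⟪p.fst, hθ.dx.memLp.toLp⟫_ℝ = -⟪p.snd, hθ.memLp.toLp⟫_ℝ}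
  add_mem' := by
    intro p q hp hq θ hθ
    simp only [WithLp.add_fst, WithLp.add_snd, inner_add_left, hp θ hθ, hq θ hθ]
    ring
  zero_mem' := by
    intro θ hθ
    simp
  smul_mem' := by
    intro r p hp θ hθ
    simp only [WithLp.smul_fst, WithLp.smul_snd, real_inner_smul_left, hp θ hθ]
    ring

/-- The underlying `L²` function of an element of `H¹`. -/
def valH {R : ℕ} (f : H1 R) : L2 R := (f : WithLp 2 (L2 R × L2 R)).fst

/-- The weak derivative of an element of `H¹`. -/
def derH {R : ℕ} (f : H1 R) : L2 R := (f : WithLp 2 (L2 R × L2 R)).snd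

/-- A smooth function, as an element of `H¹`. -/
def ofSmooth {R : ℕ} (f : Circ → E R) (hf : Smooth f) : H1 R :=
  ⟨WithLp.toLp 2 (hf.memLp.toLp, hf.dx.memLp.toLp), by
    intro θ hθ
    have key : ∫ x : Circ, dx (fun y => ⟪f y, θ y⟫_ℝ) x = 0 :=
      integral_dx (F := ℝ) (f := fun y => ⟪f y, θ y⟫_ℝ) (ContDiff.inner ℝ hf hθ)
    have hpt : ∀ x : Circ, dx (fun y => ⟪f y, θ y⟫_ℝ) x
        = ⟪f x, dx θ x⟫_ℝ + ⟪dx f x, θ x⟫_ℝ := by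
      intro x
      induction x using QuotientAddGroup.induction_on with
      | H s =>
        have h1 : ContDiff ℝ (⊤ : ℕ∞) (fun r : ℝ => f (r : Circ)) := hf
        have h2 : ContDiff ℝ (⊤ : ℕ∞) (fun r : ℝ => θ (r : Circ)) := hθ
        have e1 := dx_coe (fun y => ⟪f y, θ y⟫_ℝ) s
        have e2 := dx_coe f s
        have e3 := dx_coe θ s
        change dx (fun y => ⟪f y, θ y⟫_ℝ) (s : Circ)
          = ⟪f (s : Circ), dx θ (s : Circ)⟫_ℝ + ⟪dx f (s : Circ), θ (s : Circ)⟫_ℝ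
        rw [e1, e2, e3]
        exact deriv_inner_apply ℝ ((h1.differentiable (by simp)) s)
          ((h2.differentiable (by simp)) s)
    have i1 : Integrable (fun x : Circ => ⟪f x, dx θ x⟫_ℝ) :=
      (hf.continuous.inner hθ.dx.continuous).integrable_of_hasCompactSupport
        (HasCompactSupport.of_compactSpace _)
    have i2 : Integrable (fun x : Circ => ⟪dx f x, θ x⟫_ℝ) :=
      (hf.dx.continuous.inner hθ.continuous).integrable_of_hasCompactSupport
        (HasCompactSupport.of_compactSpace _)
    simp_rw [hpt] at key
    rw [integral_add i1 i2] at key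
    have j1 : ⟪hf.memLp.toLp, hθ.dx.memLp.toLp⟫_ℝ = ∫ x : Circ, ⟪f x, dx θ x⟫_ℝ := by
      rw [L2.inner_def]
      refine integral_congr_ae ?_
      filter_upwards [hf.memLp.coeFn_toLp, hθ.dx.memLp.coeFn_toLp] with x h1 h2
      rw [h1, h2]
    have j2 : ⟪hf.dx.memLp.toLp, hθ.memLp.toLp⟫_ℝ = ∫ x : Circ, ⟪dx f x, θ x⟫_ℝ := by
      rw [L2.inner_def]
      refine integral_congr_ae ?_
      filter_upwards [hf.dx.memLp.coeFn_toLp, hθ.memLp.coeFn_toLp] with x h1 h2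
      rw [h1, h2]
    change ⟪hf.memLp.toLp, hθ.dx.memLp.toLp⟫_ℝ = -⟪hf.dx.memLp.toLp, hθ.memLp.toLp⟫_ℝ
    rw [j1, j2]
    linarith⟩

/-- `H⁻¹` of the circle with values in `ℝ^R`, the dual of `H¹` with the dual norm. (Through Fourier
series this norm is the one of `⟨∂ₓ⟩⁻¹ f` in `L²`.) -/
abbrev HNeg1 (R : ℕ) : Type := H1 R →L[ℝ] ℝ

/-- The embedding of `L²` in `H⁻¹`: `f` acts on `θ` as `∫ f · θ`. -/
def toHNeg1 {R : ℕ} (f : L2 R) : HNeg1 R :=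
  ((innerSL ℝ f).comp (WithLp.fstL 2 ℝ (L2 R) (L2 R))).comp (H1 R).subtypeL

/-- The action of a matrix on a vector. -/
def act {R : ℕ} (A : Matrix (Fin R) (Fin R) ℝ) (v : E R) : E R :=
  WithLp.toLp 2 (A.mulVec v.ofLp)

/-- A matrix-valued function on the circle with smooth entries. -/
def SmoothMat {R : ℕ} (A : Circ → Matrix (Fin R) (Fin R) ℝ) : Prop :=
  ∀ i j, Smooth (fun x => A x i j)

/-- The product `χ_ω f` of an `L²` function with the indicator function of an open set `ω`. -/
def chi {R : ℕ} {ω : Set Circ} (hω : IsOpen ω) (f : L2 R) : L2 R :=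
  ((Lp.memLp f).indicator hω.measurableSet).toLp

/-- `(φ, ψ)` is a weak solution on `[0, T]`, of class `C(L²) ∩ C¹(H⁻¹)` and with `ψ = ∂ₜ φ`, of
`-φ_tt + φ_xx + b(x) φ_x + c(x) φ = 0`. The equation is tested against smooth functions `θ` of `x`,
all derivatives in `x` being put on `θ`. -/
structure IsWeakSolution {R : ℕ} (b c : Circ → Matrix (Fin R) (Fin R) ℝ) (T : ℝ)
    (φ : ℝ → L2 R) (ψ : ℝ → HNeg1 R) : Prop where
  continuousOn_fst : ContinuousOn φ (Icc 0 T)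
  continuousOn_snd : ContinuousOn ψ (Icc 0 T)
  hasDeriv : ∀ t ∈ Icc 0 T, HasDerivWithinAt (fun s => toHNeg1 (φ s)) (ψ t) (Icc 0 T) t
  equation : ∀ θ : Circ → E R, ∀ hθ : Smooth θ, ∀ t ∈ Icc 0 T,
    HasDerivWithinAt (fun s => ψ s (ofSmooth θ hθ))
      (∫ x : Circ, ⟪φ t x, dx (dx θ) x - dx (fun y => act (b y).transpose (θ y)) x
        + act (c x).transpose (θ x)⟫_ℝ)
      (Icc 0 T) t

/-- `(w, p)` is a weak solution on `[0, T]`, of class `C(H¹) ∩ C¹(L²)` and with `p = ∂ₜ w`, of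
`-w_tt + w_xx - B(x) w_x - C(x) w = f`. -/
structure IsEnergySolution {R : ℕ} (B C : Circ → Matrix (Fin R) (Fin R) ℝ) (T : ℝ)
    (f : ℝ → L2 R) (w : ℝ → H1 R) (p : ℝ → L2 R) : Prop where
  continuousOn_fst : ContinuousOn w (Icc 0 T)
  continuousOn_snd : ContinuousOn p (Icc 0 T)
  hasDeriv : ∀ t ∈ Icc 0 T, HasDerivWithinAt (fun s => valH (w s)) (p t) (Icc 0 T) t
  equation : ∀ θ : H1 R, ∀ t ∈ Icc 0 T,
    HasDerivWithinAt (fun s => ⟪p s, valH θ⟫_ℝ)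
      (-⟪derH (w t), derH θ⟫_ℝ
        - (∫ x : Circ, ⟪act (B x) (derH (w t) x) + act (C x) (valH (w t) x), valH θ x⟫_ℝ)
        - ⟪f t, valH θ⟫_ℝ)
      (Icc 0 T) t

/-- A function on `[0, T] × 𝕋` in the null coordinates `u = t + x`, `v = t - x`, with
`(t, x) ∈ [0, T] × [0, 2π)`, extended by zero. -/
def nullExt {R : ℕ} (T : ℝ) (G : ℝ → Circ → E R) (u v : ℝ) : E R :=
  ({q : ℝ × ℝ | q.1 ∈ Icc 0 T ∧ q.2 ∈ Ico 0 (2 * Real.pi)}.indicator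
    (fun q => G q.1 (q.2 : Circ))) ((u + v) / 2, (u - v) / 2)

/-- The mixed norm `L^p` in the first variable of the `L^q` norm in the second variable. -/
def mixedNorm {R : ℕ} (p q : ℝ≥0∞) (h : ℝ → ℝ → E R) : ℝ≥0∞ :=
  eLpNorm (fun a => eLpNorm (fun b => h a b) q volume) p volume

/-- `G` is a jointly measurable representative on `[0, T] × 𝕋` of the curve `g` in `L²`. -/
def IsRep {R : ℕ} (T : ℝ) (g : ℝ → L2 R) (G : ℝ → Circ → E R) : Prop :=
  StronglyMeasurable (Function.uncurry G) ∧
    ∀ᵐ t ∂(volume.restrict (Icc 0 T)), G t =ᵐ[volume] g t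

/-- The norm of `L²_u L^∞_v ∩ L^∞_v L²_u` over `[0, T] × 𝕋`. All the representatives give the same
value. -/
def normU {R : ℕ} (T : ℝ) (g : ℝ → L2 R) : ℝ≥0∞ :=
  ⨅ (G : ℝ → Circ → E R) (_ : IsRep T g G),
    mixedNorm 2 ∞ (fun u v => nullExt T G u v) + mixedNorm ∞ 2 (fun v u => nullExt T G u v)

/-- The norm of `L²_v L^∞_u ∩ L^∞_u L²_v` over `[0, T] × 𝕋`. -/
def normV {R : ℕ} (T : ℝ) (g : ℝ → L2 R) : ℝ≥0∞ :=
  ⨅ (G : ℝ → Circ → E R) (_ : IsRep T g G),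
    mixedNorm 2 ∞ (fun v u => nullExt T G u v) + mixedNorm ∞ 2 (fun u v => nullExt T G u v)

/-- The norm of `C([0, T] × 𝕋)`, which is `∞` if there is no continuous representative. -/
def normC {R : ℕ} (T : ℝ) (g : ℝ → L2 R) : ℝ≥0∞ :=
  ⨅ (G : ℝ → Circ → E R) (_ : ContinuousOn (Function.uncurry G) (Icc 0 T ×ˢ univ))
    (_ : ∀ t ∈ Icc 0 T, G t =ᵐ[volume] g t),
    ⨆ (t ∈ Icc 0 T) (x : Circ), ‖G t x‖ₑ

/-- The norm of the curve `w`, with time derivative `p`, in the space of the continuous functions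
on `[0, T] × 𝕋` with `(w_x, w_t) ∈ C([0, T]; L²)`, `w_v ∈ L²_v L^∞_u ∩ L^∞_u L²_v` and
`w_u ∈ L²_u L^∞_v ∩ L^∞_v L²_u`, where `w_u = (w_t + w_x) / 2` and `w_v = (w_t - w_x) / 2`. -/
def normW {R : ℕ} (T : ℝ) (w : ℝ → H1 R) (p : ℝ → L2 R) : ℝ≥0∞ :=
  normV T (fun t => (1 / 2 : ℝ) • (p t - derH (w t)))
    + normU T (fun t => (1 / 2 : ℝ) • (p t + derH (w t)))
    + normC T (fun t => valH (w t))
    + ⨆ t ∈ Icc 0 T, ENNReal.ofReal (Real.sqrt (‖derH (w t)‖ ^ 2 + ‖p t‖ ^ 2))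

end WaveControl

end

open WaveControl

/-!
Controllability is proved by construction, and observability follows from it by duality.

The one-dimensional wave equation keeps its form when `t` and `x` are exchanged, so it can also be
solved sidewise, with `x` as the evolution variable. In the coordinate `y` with `x = a + y`, the
Cauchy problem with the given periodic data is solved on the whole plane (`exists_charSol`). Its
trace on the line `y = 0` is multiplied by a cutoff in time, and the equation is solved again from
this line, over `0 ≤ y ≤ 4π` (`exists_steered_solution`). By finite speed of propagation
(`CharSol.eq_zero_of_base`), applied in the exchanged variables, the new solution still has the
given data at time `0`, because the cutoff is one on a long interval around `0`, and it is at rest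
at time `32π`, because the cutoff vanishes far before that time. So every state is steered to rest
on the window `[0, 4π]`, which covers the circle twice, but the result is not periodic.

Periodicity is restored by winding (`fold`): the wave is multiplied by a function `ζ` on `[0, 4π]`
with `ζ y + ζ (y + 2π) = 1`, and its values above the same point of the circle are added. The data
are periodic, so they are kept. The equation is violated only by the commutator of the wave operator
with `ζ`, which lives where `ζ` is not constant. If `(a, a + ε) ⊆ ω`, then `ζ` can be chosen locally
constant outside `(0, ε)` modulo `2π` (`FoldCutoff`), and the commutator is a control supported in
`ω` (`hasDerivAt_inner_time`, `LocalSteering.exists_steeredWave`).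

The mixed norms in the null coordinates come from majorants: integrating the first-order system
along characteristics bounds `|w_t + w_x|²` by an integrable function of `t + x` alone, and `|w_t -
w_x|²` by one of `t - x` alone (`CharSol.estimates`). Such bounds survive winding
(`exists_majorant`) and give `SteeredWave.normW_le`. The construction is carried out for smooth
data; arbitrary data are sums of normally convergent series of smooth data (`exists_smooth_series`),
and the corresponding series of steered waves converges together with its majorants
(`SteeredWave.tsum`). Uniqueness of energy solutions is the energy estimate for their averages over
short time intervals, which are regular enough to be used as multipliers
(`IsEnergySolution.unique`).

For observability, a weak solution of the equation with coefficients `b`, `c` is paired with the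
steered waves of the adjoint problem, whose coefficients are `bᵀ` and `∂ₓ(bᵀ) - cᵀ`. The final state
of a steered wave vanishes, so the pairing of `(φ(0), φ_t(0))` with its initial data is an integral
of `χ_ω φ` against the control (`IsWeakSolution.abs_pairing_le`). Letting the data vary and applying
the Cauchy-Schwarz inequality in time gives `exists_observability`.
-/


noncomputable section

namespace WaveControl

/-! ### A linear Volterra system on the plane -/

section Volterra

open BoundedContinuousFunction

variable {F : Type*} [NormedAddCommGroup F] [NormedSpace ℝ F]

/-- The weight makes integration from the line `t = 0` an operator of norm at most `1 / lam`. -/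
theorem abs_integral_exp_weight_le {lam : ℝ} (hl : 0 < lam) (t : ℝ) :
    |∫ σ in (0:ℝ)..t, Real.exp (-lam * (|t| - |σ|))| ≤ 1 / lam := by
  have key : ∀ t : ℝ, 0 ≤ t → |∫ σ in (0:ℝ)..t, Real.exp (-lam * (|t| - |σ|))| ≤ 1 / lam := by
    intro t ht
    have h1 : ∫ σ in (0:ℝ)..t, Real.exp (-lam * (|t| - |σ|))
        = ∫ σ in (0:ℝ)..t, Real.exp (-lam * t) * Real.exp (lam * σ) := by
      refine intervalIntegral.integral_congr fun σ hσ => ?_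
      rw [uIcc_of_le ht] at hσ
      rw [abs_of_nonneg ht, abs_of_nonneg hσ.1, ← Real.exp_add]
      congr 1
      ring
    have h2 : ∫ σ in (0:ℝ)..t, Real.exp (lam * σ) = (Real.exp (lam * t) - 1) / lam := by
      have := intervalIntegral.integral_comp_mul_left (a := 0) (b := t) (fun y => Real.exp y) hl.ne'
      rw [this, integral_exp]
      simp only [mul_zero, Real.exp_zero, smul_eq_mul]
      ring
    rw [h1, intervalIntegral.integral_const_mul, h2, ← mul_div_assoc, mul_sub, ← Real.exp_add]
    have h3 : -lam * t + lam * t = 0 := by ring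
    rw [h3, Real.exp_zero, mul_one]
    have h4 : Real.exp (-lam * t) ≤ 1 := Real.exp_le_one_iff.2 (by nlinarith)
    have h5 := Real.exp_pos (-lam * t)
    rw [abs_of_nonneg (div_nonneg (by linarith) hl.le)]
    gcongr
    linarith
  rcases le_total 0 t with ht | ht
  · exact key t ht
  · have h := intervalIntegral.integral_comp_neg (a := 0) (b := -t)
      (fun σ => Real.exp (-lam * (|t| - |σ|)))
    simp only [abs_neg, neg_neg, neg_zero] at h
    rw [intervalIntegral.integral_symm, ← h, abs_neg]
    have := key (-t) (by linarith)
    rwa [abs_neg] at this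

/-- The integral of `h` along the line of speed `c` from the base line `t = 0` to the given point,
with the weight `exp (-lam * |t|)` that makes it small as an operator when `lam` is large. -/
def weightedPrimitive (lam c : ℝ) (h : ℝ × ℝ →ᵇ F) (p : ℝ × ℝ) : F :=
  ∫ σ in (0:ℝ)..p.1, Real.exp (-lam * (|p.1| - |σ|)) • h (σ, p.2 + c * (p.1 - σ))

theorem continuous_weightedPrimitive (lam c : ℝ) (h : ℝ × ℝ →ᵇ F) :
    Continuous (weightedPrimitive lam c h) := by
  unfold weightedPrimitive
  refine intervalIntegral.continuous_parametric_intervalIntegral_of_continuous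
    (f := fun (p : ℝ × ℝ) σ => Real.exp (-lam * (|p.1| - |σ|)) • h (σ, p.2 + c * (p.1 - σ)))
    ?_ continuous_fst
  have := h.continuous
  simp only [Function.uncurry_def]
  fun_prop

theorem norm_weightedPrimitive_le {lam : ℝ} (hl : 0 < lam) (c : ℝ) (h : ℝ × ℝ →ᵇ F) (p : ℝ × ℝ) :
    ‖weightedPrimitive lam c h p‖ ≤ 1 / lam * ‖h‖ := by
  have h1 := intervalIntegral.norm_integral_le_abs_of_norm_le (a := 0) (b := p.1) (μ := volume)
    (f := fun σ => Real.exp (-lam * (|p.1| - |σ|)) • h (σ, p.2 + c * (p.1 - σ)))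
    (g := fun σ => Real.exp (-lam * (|p.1| - |σ|)) * ‖h‖) (Filter.Eventually.of_forall fun σ => by
      rw [norm_smul, Real.norm_eq_abs, abs_of_pos (Real.exp_pos _)]
      exact mul_le_mul_of_nonneg_left (h.norm_coe_le_norm _) (Real.exp_pos _).le)
    (Continuous.intervalIntegrable (by fun_prop) _ _)
  rw [intervalIntegral.integral_mul_const, abs_mul, abs_of_nonneg (norm_nonneg h)] at h1
  exact h1.trans (mul_le_mul_of_nonneg_right (abs_integral_exp_weight_le hl _) (norm_nonneg _))

/-- `weightedPrimitive` as a continuous linear map. -/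
def weightedPrimitiveL (lam c : ℝ) (hl : 0 < lam) : (ℝ × ℝ →ᵇ F) →L[ℝ] (ℝ × ℝ →ᵇ F) :=
  LinearMap.mkContinuous
    { toFun := fun h => ofNormedAddCommGroup (weightedPrimitive lam c h)
        (continuous_weightedPrimitive lam c h) (1 / lam * ‖h‖) (norm_weightedPrimitive_le hl c h)
      map_add' := by
        intro f g
        ext p
        have hf := f.continuous
        have hg := g.continuous
        simp only [coe_ofNormedAddCommGroup, BoundedContinuousFunction.coe_add, Pi.add_apply,
          weightedPrimitive, smul_add]
        exact intervalIntegral.integral_add (Continuous.intervalIntegrable (by fun_prop) _ _)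
          (Continuous.intervalIntegrable (by fun_prop) _ _)
      map_smul' := by
        intro r f
        ext p
        simp only [coe_ofNormedAddCommGroup, BoundedContinuousFunction.coe_smul,
          weightedPrimitive, RingHom.id_apply]
        rw [← intervalIntegral.integral_smul]
        congr 1
        funext σ
        rw [smul_comm] }
    (1 / lam) fun h => (norm_le (by positivity)).2 fun p => norm_weightedPrimitive_le hl c h p

theorem norm_weightedPrimitiveL_le (lam c : ℝ) (hl : 0 < lam) :
    ‖weightedPrimitiveL (F := F) lam c hl‖ ≤ 1 / lam :=
  LinearMap.mkContinuous_norm_le _ (by positivity) _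

/-- Multiplication by a bounded continuous family of operators. -/
def multiplierL (a : ℝ × ℝ → F →L[ℝ] F) (ha : Continuous a) (K : ℝ) (hK : ∀ p, ‖a p‖ ≤ K) :
    (ℝ × ℝ →ᵇ F) →L[ℝ] (ℝ × ℝ →ᵇ F) :=
  LinearMap.mkContinuous
    { toFun := fun h => ofNormedAddCommGroup (fun p => a p (h p)) (by
          have := h.continuous
          fun_prop) (K * ‖h‖) (fun p =>
          (a p).le_of_opNorm_le_of_le (hK p) (h.norm_coe_le_norm p))
      map_add' := by
        intro f g
        ext p
        simp
      map_smul' := by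
        intro r f
        ext p
        simp }
    K fun h => (norm_le (mul_nonneg ((norm_nonneg _).trans (hK 0)) (norm_nonneg _))).2 fun p =>
      (a p).le_of_opNorm_le_of_le (hK p) (h.norm_coe_le_norm p)

theorem norm_multiplierL_le (a : ℝ × ℝ → F →L[ℝ] F) (ha : Continuous a) (K : ℝ)
    (hK : ∀ p, ‖a p‖ ≤ K) : ‖multiplierL a ha K hK‖ ≤ K :=
  LinearMap.mkContinuous_norm_le _ ((norm_nonneg _).trans (hK 0)) _

/-- The weighted equation for `h` is the unweighted one for `exp (lam * |t|) • h`. -/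
theorem integral_exp_unweight {lam c : ℝ} {h k : ℝ × ℝ → F}
    (hk : ∀ p, k p = Real.exp (lam * |p.1|) • h p) (t x : ℝ) :
    Real.exp (lam * |t|) • (∫ σ in (0:ℝ)..t,
      Real.exp (-lam * (|t| - |σ|)) • h (σ, x + c * (t - σ)))
      = ∫ σ in (0:ℝ)..t, k (σ, x + c * (t - σ)) := by
  rw [← intervalIntegral.integral_smul]
  congr 1
  funext σ
  rw [hk, smul_smul, ← Real.exp_add]
  congr 2
  ring

theorem exists_eq_add_apply {X : Type*} [NormedAddCommGroup X] [NormedSpace ℝ X] [CompleteSpace X]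
    (T : X →L[ℝ] X) (hT : ‖T‖ < 1) (D : X) : ∃ U, U = D + T U := by
  obtain ⟨S, hS⟩ := isUnit_one_sub_of_norm_lt_one hT
  refine ⟨(↑S⁻¹ : X →L[ℝ] X) D, ?_⟩
  have h1 : (S : X →L[ℝ] X) ((↑S⁻¹ : X →L[ℝ] X) D) = D := by
    change ((S : X →L[ℝ] X) * (↑S⁻¹ : X →L[ℝ] X)) D = D
    rw [Units.mul_inv]
    rfl
  rw [hS, _root_.sub_apply, one_apply_eq_self] at h1
  exact sub_eq_iff_eq_add.1 h1

/-- The affine system behind the first-order form of the wave equation is solvable by the Neumann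
series when the integration operators `I₁`, `I₂`, `I₃` are small against the multipliers. -/
theorem exists_triple_eq_add_apply {Y : Type*} [NormedAddCommGroup Y] [NormedSpace ℝ Y]
    [CompleteSpace Y] (I₁ I₂ I₃ M₁ M₂ M₃ : Y →L[ℝ] Y) {δ K : ℝ} (hδ : 0 ≤ δ)
    (hδK : δ * (3 * K + 1) < 1)
    (hI₁ : ‖I₁‖ ≤ δ) (hI₂ : ‖I₂‖ ≤ δ) (hI₃ : ‖I₃‖ ≤ δ)
    (hM₁ : ‖M₁‖ ≤ K) (hM₂ : ‖M₂‖ ≤ K) (hM₃ : ‖M₃‖ ≤ K) (D₁ D₂ D₃ : Y) :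
    ∃ r s w : Y, r = D₁ + I₁ (M₁ r + M₂ s + M₃ w) ∧ s = D₂ + I₂ (M₁ r + M₂ s + M₃ w) ∧
      w = D₃ + I₃ ((1 / 2 : ℝ) • (r + s)) := by
  have hK : 0 ≤ K := (norm_nonneg _).trans hM₁
  let A : Y × Y × Y →L[ℝ] Y := M₁.coprod (M₂.coprod M₃)
  let B : Y × Y × Y →L[ℝ] Y := ((1 / 2 : ℝ) • ContinuousLinearMap.id ℝ Y).coprod
    (((1 / 2 : ℝ) • ContinuousLinearMap.id ℝ Y).coprod 0)
  let T : Y × Y × Y →L[ℝ] Y × Y × Y := (I₁.comp A).prod ((I₂.comp A).prod (I₃.comp B))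
  have hA : ∀ U, ‖A U‖ ≤ (3 * K + 1) * ‖U‖ := by
    rintro ⟨r, s, w⟩
    have e1 := M₁.le_of_opNorm_le_of_le hM₁ (norm_fst_le (r, s, w))
    have e2 := M₂.le_of_opNorm_le_of_le hM₂
      ((norm_fst_le (s, w)).trans (norm_snd_le (r, s, w)))
    have e3 := M₃.le_of_opNorm_le_of_le hM₃
      ((norm_snd_le (s, w)).trans (norm_snd_le (r, s, w)))
    have e4 := norm_add_le (M₁ r) (M₂ s + M₃ w)
    have e5 := norm_add_le (M₂ s) (M₃ w)
    have e6 := norm_nonneg (r, s, w)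
    change ‖M₁ r + (M₂ s + M₃ w)‖ ≤ _
    linarith
  have hB : ∀ U, ‖B U‖ ≤ (3 * K + 1) * ‖U‖ := by
    rintro ⟨r, s, w⟩
    have e1 : ‖r‖ ≤ _ := norm_fst_le (r, s, w)
    have e2 : ‖s‖ ≤ _ := (norm_fst_le (s, w)).trans (norm_snd_le (r, s, w))
    have e6 := norm_nonneg (r, s, w)
    have e5 := norm_add_le ((1 / 2 : ℝ) • r) ((1 / 2 : ℝ) • s)
    rw [norm_smul, norm_smul, Real.norm_eq_abs, abs_of_pos (by norm_num : (0:ℝ) < 1 / 2)] at e5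
    change ‖(1 / 2 : ℝ) • r + ((1 / 2 : ℝ) • s + 0)‖ ≤ _
    rw [add_zero]
    nlinarith [mul_nonneg hK e6]
  have q : ∀ (J : Y →L[ℝ] Y) (C : Y × Y × Y →L[ℝ] Y), ‖J‖ ≤ δ →
      (∀ U, ‖C U‖ ≤ (3 * K + 1) * ‖U‖) → ∀ U, ‖J (C U)‖ ≤ δ * (3 * K + 1) * ‖U‖ := by
    intro J C hJ hC U
    rw [mul_assoc]
    exact J.le_of_opNorm_le_of_le hJ (hC U)
  have hT : ‖T‖ < 1 := (T.opNorm_le_bound (by positivity) fun U =>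
    max_le (q I₁ A hI₁ hA U) (max_le (q I₂ A hI₂ hA U) (q I₃ B hI₃ hB U))).trans_lt hδK
  obtain ⟨⟨r, s, w⟩, hU⟩ := exists_eq_add_apply T hT (D₁, D₂, D₃)
  refine ⟨r, s, w, ?_, ?_, ?_⟩
  · rw [add_assoc]
    exact congrArg Prod.fst hU
  · rw [add_assoc]
    exact congrArg (fun V => V.2.1) hU
  · have := congrArg (fun V => V.2.2) hU
    change w = D₃ + I₃ ((1 / 2 : ℝ) • r + ((1 / 2 : ℝ) • s + 0)) at this
    rwa [add_zero, ← smul_add] at this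

/-- The solution of the integrated first-order system, by inverting `1 - 𝒯` for an operator `𝒯` of
norm less than one. -/
theorem exists_integral_system [CompleteSpace F] {a₁ a₂ a₃ : ℝ × ℝ → F →L[ℝ] F}
    (h₁ : Continuous a₁) (h₂ : Continuous a₂) (h₃ : Continuous a₃) {K : ℝ}
    (hK₁ : ∀ p, ‖a₁ p‖ ≤ K) (hK₂ : ∀ p, ‖a₂ p‖ ≤ K) (hK₃ : ∀ p, ‖a₃ p‖ ≤ K)
    (r₀ s₀ w₀ : ℝ →ᵇ F) :
    ∃ r s w g : ℝ × ℝ → F, Continuous r ∧ Continuous s ∧ Continuous w ∧ Continuous g ∧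
      (∀ p, g p = a₁ p (r p) + a₂ p (s p) + a₃ p (w p)) ∧
      (∀ t x, r (t, x) = r₀ (x + t) + ∫ σ in (0:ℝ)..t, g (σ, x + 1 * (t - σ))) ∧
      (∀ t x, s (t, x) = s₀ (x - t) + ∫ σ in (0:ℝ)..t, g (σ, x + (-1) * (t - σ))) ∧
      (∀ t x, w (t, x) = w₀ x
        + ∫ σ in (0:ℝ)..t, (1 / 2 : ℝ) • (r (σ, x + 0 * (t - σ)) + s (σ, x + 0 * (t - σ)))) := by
  have hK0 : 0 ≤ K := (norm_nonneg _).trans (hK₁ 0)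
  -- the operator of the system has norm at most `(3 * K + 1) / lam`, less than one for this weight
  obtain ⟨lam, hlam⟩ : ∃ lam : ℝ, lam = 3 * K + 2 := ⟨_, rfl⟩
  have hl : 0 < lam := by linarith
  let Y := ℝ × ℝ →ᵇ F
  let D : ℝ → (ℝ →ᵇ F) → Y := fun c f =>
    ofNormedAddCommGroup (fun p : ℝ × ℝ => Real.exp (-lam * |p.1|) • f (p.2 + c * p.1)) (by
      have := f.continuous
      fun_prop) ‖f‖ (fun p => by
        rw [norm_smul, Real.norm_eq_abs, abs_of_pos (Real.exp_pos _)]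
        have h1 : Real.exp (-lam * |p.1|) ≤ 1 :=
          Real.exp_le_one_iff.2 (by nlinarith [abs_nonneg p.1])
        calc _ ≤ 1 * ‖f‖ := mul_le_mul h1 (f.norm_coe_le_norm _) (norm_nonneg _) zero_le_one
          _ = ‖f‖ := one_mul _)
  obtain ⟨r, s, w, hr, hs, hw⟩ := exists_triple_eq_add_apply
    (weightedPrimitiveL (F := F) lam 1 hl) (weightedPrimitiveL lam (-1) hl)
    (weightedPrimitiveL lam 0 hl) (multiplierL a₁ h₁ K hK₁) (multiplierL a₂ h₂ K hK₂)
    (multiplierL a₃ h₃ K hK₃) (δ := 1 / lam) (K := K) (by positivity) (by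
      rw [one_div_mul_eq_div, div_lt_one hl]
      linarith) (norm_weightedPrimitiveL_le _ _ _) (norm_weightedPrimitiveL_le _ _ _)
    (norm_weightedPrimitiveL_le _ _ _) (norm_multiplierL_le _ _ _ _) (norm_multiplierL_le _ _ _ _)
    (norm_multiplierL_le _ _ _ _) (D 1 r₀) (D (-1) s₀) (D 0 w₀)
  obtain ⟨g, hg⟩ : ∃ g : Y, g = multiplierL a₁ h₁ K hK₁ r + multiplierL a₂ h₂ K hK₂ s
    + multiplierL a₃ h₃ K hK₃ w := ⟨_, rfl⟩
  rw [← hg] at hr hs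
  have hgp : ∀ p, g p = a₁ p (r p) + a₂ p (s p) + a₃ p (w p) := fun p => by
    rw [hg]
    rfl
  have cr := r.continuous
  have cs := s.continuous
  have cw := w.continuous
  have cg := g.continuous
  have cexp : Continuous fun p : ℝ × ℝ => Real.exp (lam * |p.1|) := by fun_prop
  have hu : ∀ t : ℝ, Real.exp (lam * |t|) * Real.exp (-lam * |t|) = 1 := by
    intro t
    rw [← Real.exp_add]
    simp
  -- the weighted unknowns are bounded, the solution itself may grow like `exp (lam * |t|)`
  refine ⟨fun p => Real.exp (lam * |p.1|) • r p, fun p => Real.exp (lam * |p.1|) • s p,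
    fun p => Real.exp (lam * |p.1|) • w p, fun p => Real.exp (lam * |p.1|) • g p,
    cexp.smul cr, cexp.smul cs, cexp.smul cw, cexp.smul cg, ?_, ?_, ?_, ?_⟩
  · intro p
    simp only [map_smul, ← smul_add, hgp]
  · intro t x
    have h : r (t, x) = Real.exp (-lam * |t|) • r₀ (x + 1 * t) + weightedPrimitive lam 1 g (t, x) :=
      DFunLike.congr_fun hr (t, x)
    simp only
    rw [h, smul_add, smul_smul, hu, one_smul, one_mul]
    congr 1
    exact integral_exp_unweight (fun p => rfl) t x
  · intro t x
    have h : s (t, x) = Real.exp (-lam * |t|) • s₀ (x + (-1) * t)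
      + weightedPrimitive lam (-1) g (t, x) := DFunLike.congr_fun hs (t, x)
    simp only
    rw [h, smul_add, smul_smul, hu, one_smul, neg_one_mul, ← sub_eq_add_neg]
    congr 1
    exact integral_exp_unweight (fun p => rfl) t x
  · intro t x
    have h : w (t, x) = Real.exp (-lam * |t|) • w₀ (x + 0 * t)
      + weightedPrimitive lam 0 ((1 / 2 : ℝ) • (r + s)) (t, x) := DFunLike.congr_fun hw (t, x)
    simp only
    rw [h, smul_add, smul_smul, hu, one_smul, zero_mul, add_zero]
    congr 1
    refine integral_exp_unweight (h := fun p => (1 / 2 : ℝ) • (r p + s p))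
      (k := fun p => (1 / 2 : ℝ) • (Real.exp (lam * |p.1|) • r p
        + Real.exp (lam * |p.1|) • s p)) (fun p => ?_) t x
    rw [← smul_add, smul_comm]

end Volterra

/-! ### Waves with continuous characteristic derivatives -/

section CharSol

variable {F : Type*} [NormedAddCommGroup F] [NormedSpace ℝ F]

/-- `w` solves `w_tt - w_xx = a₁ r + a₂ s + a₃ w` on the plane, where `r = w_t + w_x` and
`s = w_t - w_x` are only continuous, and differentiable along their characteristic lines: the
equation reads `r_t - r_x = s_t + s_x = a₁ r + a₂ s + a₃ w`. The notion is symmetric in `t` and `x`,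
up to signs. -/
structure CharSol (a₁ a₂ a₃ : ℝ → ℝ → F →L[ℝ] F) (r s w : ℝ → ℝ → F) : Prop where
  cont_r : Continuous fun p : ℝ × ℝ => r p.1 p.2
  cont_s : Continuous fun p : ℝ × ℝ => s p.1 p.2
  cont_w : Continuous fun p : ℝ × ℝ => w p.1 p.2
  deriv_r : ∀ t x, HasDerivAt (fun σ => r (t + σ) (x - σ))
    (a₁ t x (r t x) + a₂ t x (s t x) + a₃ t x (w t x)) 0
  deriv_s : ∀ t x, HasDerivAt (fun σ => s (t + σ) (x + σ))
    (a₁ t x (r t x) + a₂ t x (s t x) + a₃ t x (w t x)) 0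
  deriv_t : ∀ t x, HasDerivAt (fun τ => w τ x) ((1 / 2 : ℝ) • (r t x + s t x)) t
  deriv_x : ∀ t x, HasDerivAt (fun y => w t y) ((1 / 2 : ℝ) • (r t x - s t x)) x

theorem hasDerivAt_comp_neg_of_hasDerivAt {f : ℝ → F} {f' : F} {x : ℝ}
    (h : HasDerivAt f f' (-x)) : HasDerivAt (fun σ => f (-σ)) (-f') x := by
  refine (h.scomp x (hasDerivAt_neg x)).congr_deriv ?_
  rw [neg_smul, one_smul]

theorem eq_of_hasDerivAt_eq {f g f' : ℝ → F} (hf : ∀ x, HasDerivAt f (f' x) x)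
    (hg : ∀ x, HasDerivAt g (f' x) x) {a : ℝ} (ha : f a = g a) : f = g := by
  funext x
  have h := is_const_of_deriv_eq_zero (f := fun x => f x - g x)
    (fun x => ((hf x).sub (hg x)).differentiableAt)
    (fun x => by exact (((hf x).sub (hg x)).congr_deriv (sub_self _)).deriv) x a
  simp only [ha, sub_self] at h
  exact sub_eq_zero.1 h

theorem integral_swap_of_continuous {f : ℝ → ℝ → F} (hf : Continuous fun p : ℝ × ℝ => f p.1 p.2)
    (a b c d : ℝ) :
    ∫ x in a..b, ∫ y in c..d, f x y = ∫ y in c..d, ∫ x in a..b, f x y := by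
  refine intervalIntegral_intervalIntegral_swap ?_
  refine (hf.continuousOn.integrableOn_compact (μ := volume)
    (isCompact_uIcc.prod isCompact_uIcc : IsCompact (uIcc a b ×ˢ uIcc c d))).mono_set ?_
  exact prod_mono uIoc_subset_uIcc uIoc_subset_uIcc

/-- The derivative of `r` at every point of a characteristic line of speed `-1`, from its
derivatives at the base points. -/
theorem hasDerivAt_char_r {r g : ℝ → ℝ → F}
    (hr : ∀ t x, HasDerivAt (fun σ => r (t + σ) (x - σ)) (g t x) 0) (t x τ : ℝ) :
    HasDerivAt (fun σ => r (t + σ) (x - σ)) (g (t + τ) (x - τ)) τ := by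
  have h := hr (t + τ) (x - τ)
  rw [show (0 : ℝ) = τ - τ by ring] at h
  have h2 := HasDerivAt.comp_sub_const τ τ h
  refine h2.congr_of_eventuallyEq (Filter.Eventually.of_forall fun σ => ?_)
  simp

/-- The derivative of `s` at every point of a characteristic line of speed `1`, from its derivatives
at the base points. -/
theorem hasDerivAt_char_s {s g : ℝ → ℝ → F}
    (hs : ∀ t x, HasDerivAt (fun σ => s (t + σ) (x + σ)) (g t x) 0) (t x τ : ℝ) :
    HasDerivAt (fun σ => s (t + σ) (x + σ)) (g (t + τ) (x + τ)) τ := by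
  have h := hs (t + τ) (x + τ)
  rw [show (0 : ℝ) = τ - τ by ring] at h
  have h2 := HasDerivAt.comp_sub_const τ τ h
  refine h2.congr_of_eventuallyEq (Filter.Eventually.of_forall fun σ => ?_)
  simp

/-- The closed form `½ (r du + s dv)` on the plane is exact. -/
theorem exists_potential [CompleteSpace F] {r s g : ℝ → ℝ → F}
    (cr : Continuous fun p : ℝ × ℝ => r p.1 p.2) (cs : Continuous fun p : ℝ × ℝ => s p.1 p.2)
    (cg : Continuous fun p : ℝ × ℝ => g p.1 p.2)
    (hr : ∀ t x, HasDerivAt (fun σ => r (t + σ) (x - σ)) (g t x) 0)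
    (hs : ∀ t x, HasDerivAt (fun σ => s (t + σ) (x + σ)) (g t x) 0) (c : F) :
    ∃ w : ℝ → ℝ → F, w 0 0 = c ∧
      (∀ t x, HasDerivAt (fun τ => w τ x) ((1 / 2 : ℝ) • (r t x + s t x)) t) ∧
      (∀ t x, HasDerivAt (fun y => w t y) ((1 / 2 : ℝ) • (r t x - s t x)) x) := by
  -- everything is written in the null coordinates `u = t + x` and `v = t - x`
  let A : ℝ → ℝ → F := fun u v => (1 / 2 : ℝ) • r ((u + v) / 2) ((u - v) / 2)
  let B : ℝ → ℝ → F := fun u v => (1 / 2 : ℝ) • s ((u + v) / 2) ((u - v) / 2)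
  let H : ℝ → ℝ → F := fun u v => (1 / 2 : ℝ) • (1 / 2 : ℝ) • g ((u + v) / 2) ((u - v) / 2)
  have cA : Continuous fun p : ℝ × ℝ => A p.1 p.2 :=
    (cr.comp (by fun_prop : Continuous fun p : ℝ × ℝ =>
        ((p.1 + p.2) / 2, (p.1 - p.2) / 2))).const_smul _
  have cB : Continuous fun p : ℝ × ℝ => B p.1 p.2 :=
    (cs.comp (by fun_prop : Continuous fun p : ℝ × ℝ =>
        ((p.1 + p.2) / 2, (p.1 - p.2) / 2))).const_smul _
  have cH : Continuous fun p : ℝ × ℝ => H p.1 p.2 :=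
    ((cg.comp (by fun_prop : Continuous fun p : ℝ × ℝ =>
      ((p.1 + p.2) / 2, (p.1 - p.2) / 2))).const_smul _).const_smul _
  have dA : ∀ u v, HasDerivAt (fun v => A u v) (H u v) v := by
    intro u v
    have h := hasDerivAt_char_r hr (u / 2) (u / 2) (v / 2)
    have h2 := h.scomp v ((hasDerivAt_id v).div_const 2)
    refine ((h2.const_smul (1 / 2 : ℝ)).congr_of_eventuallyEq
      (Filter.Eventually.of_forall fun z => ?_)).congr_deriv ?_
    · simp [A, add_div, sub_div]
    · simp [H, add_div, sub_div]
  have dB : ∀ u v, HasDerivAt (fun u => B u v) (H u v) u := by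
    intro u v
    have h := hasDerivAt_char_s hs (v / 2) (-(v / 2)) (u / 2)
    have h2 := h.scomp u ((hasDerivAt_id u).div_const 2)
    refine ((h2.const_smul (1 / 2 : ℝ)).congr_of_eventuallyEq
      (Filter.Eventually.of_forall fun z => ?_)).congr_deriv ?_
    · simp only [B, Pi.smul_apply, Function.comp_apply, id]
      congr 2 <;> ring
    · simp only [H]
      congr 3 <;> ring
  have cAu : ∀ v, Continuous fun u => A u v := fun v =>
      cA.comp (by fun_prop : Continuous fun u => (u, v))
  have cBv : ∀ u, Continuous fun v => B u v := fun u =>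
      cB.comp (by fun_prop : Continuous fun v => (u, v))
  have cHu : ∀ v, Continuous fun u => H u v := fun v =>
      cH.comp (by fun_prop : Continuous fun u => (u, v))
  have cHv : ∀ u, Continuous fun v => H u v := fun u =>
      cH.comp (by fun_prop : Continuous fun v => (u, v))
  let W : ℝ → ℝ → F := fun u v => c + (∫ a in (0:ℝ)..u, A a 0) + ∫ b in (0:ℝ)..v, B u b
  have hW : ∀ u v, W u v = c + (∫ b in (0:ℝ)..v, B 0 b) + ∫ a in (0:ℝ)..u, A a v := by
    intro u v
    have e1 : ∀ b, B u b = B 0 b + ∫ a in (0:ℝ)..u, H a b := fun b => by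
      rw [intervalIntegral.integral_eq_sub_of_hasDerivAt (fun x _ => dB x b)
        ((cHu b).intervalIntegrable _ _)]
      abel
    have e2 : ∀ a, A a v = A a 0 + ∫ b in (0:ℝ)..v, H a b := fun a => by
      rw [intervalIntegral.integral_eq_sub_of_hasDerivAt (fun x _ => dA a x)
        ((cHv a).intervalIntegrable _ _)]
      abel
    have e3 : ∫ b in (0:ℝ)..v, ∫ a in (0:ℝ)..u, H a b
        = ∫ a in (0:ℝ)..u, ∫ b in (0:ℝ)..v, H a b := by
      exact integral_swap_of_continuous (f := fun b a => H a b) (cH.comp continuous_swap) _ _ _ _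
    simp only [W]
    simp_rw [e1, e2]
    rw [intervalIntegral.integral_add, intervalIntegral.integral_add, e3]
    · abel
    · exact (cAu 0).intervalIntegrable _ _
    · refine Continuous.intervalIntegrable ?_ _ _
      exact intervalIntegral.continuous_parametric_intervalIntegral_of_continuous' cH 0 v
    · exact (cBv 0).intervalIntegrable _ _
    · refine Continuous.intervalIntegrable ?_ _ _
      exact intervalIntegral.continuous_parametric_intervalIntegral_of_continuous'
        (f := fun b a => H a b) (cH.comp continuous_swap) 0 u
  have dWv : ∀ u v, HasDerivAt (fun v => W u v) (B u v) v := fun u v =>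
    ((cBv u).integral_hasStrictDerivAt 0 v).hasDerivAt.const_add _
  have dWu : ∀ u v, HasDerivAt (fun u => W u v) (A u v) u := fun u v => by
    simp_rw [hW]
    exact ((cAu v).integral_hasStrictDerivAt 0 u).hasDerivAt.const_add _
  have dW : ∀ u v, HasFDerivAt (Function.uncurry W)
      ((ContinuousLinearMap.toSpanSingleton ℝ (A u v)).coprod
        (ContinuousLinearMap.toSpanSingleton ℝ (B u v))) (u, v) := by
    intro u v
    have cl : Continuous fun y : F => ContinuousLinearMap.toSpanSingleton ℝ y :=
      (ContinuousLinearMap.toSpanSingletonCLE (𝕜 := ℝ) (E := F)).continuous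
    exact (hasStrictFDerivAt_uncurry_coprod (𝕜 := ℝ) (u := (u, v)) (f := W)
      (f₁ := fun u v => ContinuousLinearMap.toSpanSingleton ℝ (A u v))
      (f₂ := fun u v => ContinuousLinearMap.toSpanSingleton ℝ (B u v))
      (Filter.Eventually.of_forall fun p => (dWu p.1 p.2).hasFDerivAt)
      (Filter.Eventually.of_forall fun p => (dWv p.1 p.2).hasFDerivAt)
      (cl.comp cA).continuousAt (cl.comp cB).continuousAt).hasFDerivAt
  have eA : ∀ t x, A (t + x) (t - x) = (1 / 2 : ℝ) • r t x := fun t x => by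
    simp only [A]
    congr 2 <;> ring
  have eB : ∀ t x, B (t + x) (t - x) = (1 / 2 : ℝ) • s t x := fun t x => by
    simp only [B]
    congr 2 <;> ring
  refine ⟨fun t x => W (t + x) (t - x), by simp [W], fun t x => ?_, fun t x => ?_⟩
  · have h1 : HasDerivAt (fun τ : ℝ => (τ + x, τ - x)) ((1 : ℝ), (1 : ℝ)) t :=
      ((hasDerivAt_id t).add_const x).prodMk ((hasDerivAt_id t).sub_const x)
    refine ((dW (t + x) (t - x)).comp_hasDerivAt t h1).congr_deriv ?_
    simp [eA, eB, smul_add]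
  · have h1 : HasDerivAt (fun y : ℝ => (t + y, t - y)) ((1 : ℝ), (-1 : ℝ)) x :=
      ((hasDerivAt_id x).const_add t).prodMk ((hasDerivAt_id x).const_sub t)
    refine ((dW (t + x) (t - x)).comp_hasDerivAt x h1).congr_deriv ?_
    simp only [ContinuousLinearMap.coprod_apply, ContinuousLinearMap.toSpanSingleton_apply, eA, eB,
      one_smul, neg_smul, smul_sub, ← sub_eq_add_neg]

/-- The Cauchy problem with bounded continuous data on the line `t = 0`. -/
theorem exists_charSol [CompleteSpace F] {a₁ a₂ a₃ : ℝ → ℝ → F →L[ℝ] F}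
    (h₁ : Continuous fun p : ℝ × ℝ => a₁ p.1 p.2) (h₂ : Continuous fun p : ℝ × ℝ => a₂ p.1 p.2)
    (h₃ : Continuous fun p : ℝ × ℝ => a₃ p.1 p.2) {K : ℝ}
    (hK₁ : ∀ t x, ‖a₁ t x‖ ≤ K) (hK₂ : ∀ t x, ‖a₂ t x‖ ≤ K) (hK₃ : ∀ t x, ‖a₃ t x‖ ≤ K)
    {r₀ s₀ w₀ : ℝ → F} (cr₀ : Continuous r₀) (cs₀ : Continuous s₀) {M : ℝ}
    (br₀ : ∀ x, ‖r₀ x‖ ≤ M) (bs₀ : ∀ x, ‖s₀ x‖ ≤ M) (bw₀ : ∀ x, ‖w₀ x‖ ≤ M)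
    (dw₀ : ∀ x, HasDerivAt w₀ ((1 / 2 : ℝ) • (r₀ x - s₀ x)) x) :
    ∃ r s w, CharSol a₁ a₂ a₃ r s w ∧ r 0 = r₀ ∧ s 0 = s₀ ∧ w 0 = w₀ := by
  have cw₀ : Continuous w₀ := continuous_iff_continuousAt.2 fun x => (dw₀ x).continuousAt
  obtain ⟨r, s, w, g, cr, cs, cw, cg, hg, er, es, ew⟩ := exists_integral_system h₁ h₂ h₃
    (fun p => hK₁ p.1 p.2) (fun p => hK₂ p.1 p.2) (fun p => hK₃ p.1 p.2)
    (BoundedContinuousFunction.ofNormedAddCommGroup r₀ cr₀ M br₀)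
    (BoundedContinuousFunction.ofNormedAddCommGroup s₀ cs₀ M bs₀)
    (BoundedContinuousFunction.ofNormedAddCommGroup w₀ cw₀ M bw₀)
  simp only [BoundedContinuousFunction.coe_ofNormedAddCommGroup, zero_mul, add_zero] at er es ew
  have dr : ∀ t x, HasDerivAt (fun σ => r (t + σ, x - σ)) (g (t, x)) 0 := by
    intro t x
    have cg' : Continuous fun τ => g (τ, x + t - τ) := by fun_prop
    have h := ((cg'.integral_hasStrictDerivAt 0 (t + 0)).hasDerivAt.comp_const_add t 0).const_add
      (r₀ (x + t))
    rw [add_zero, add_sub_cancel_right] at h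
    refine h.congr_of_eventuallyEq (Filter.Eventually.of_forall fun σ => ?_)
    simp only [er]
    rw [show x - σ + (t + σ) = x + t by ring]
    congr 2
    funext τ
    congr 2
    ring
  have ds : ∀ t x, HasDerivAt (fun σ => s (t + σ, x + σ)) (g (t, x)) 0 := by
    intro t x
    have cg' : Continuous fun τ => g (τ, x - t + τ) := by fun_prop
    have h := ((cg'.integral_hasStrictDerivAt 0 (t + 0)).hasDerivAt.comp_const_add t 0).const_add
      (s₀ (x - t))
    rw [add_zero, sub_add_cancel] at h
    refine h.congr_of_eventuallyEq (Filter.Eventually.of_forall fun σ => ?_)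
    simp only [es]
    rw [show x + σ - (t + σ) = x - t by ring]
    congr 2
    funext τ
    congr 2
    ring
  have dt : ∀ t x, HasDerivAt (fun τ => w (τ, x)) ((1 / 2 : ℝ) • (r (t, x) + s (t, x))) t := by
    intro t x
    have cg' : Continuous fun τ => (1 / 2 : ℝ) • (r (τ, x) + s (τ, x)) := by fun_prop
    have h := (cg'.integral_hasStrictDerivAt 0 t).hasDerivAt.const_add (w₀ x)
    exact h.congr_of_eventuallyEq (Filter.Eventually.of_forall fun σ => ew σ x)
  have er0 : ∀ x, r (0, x) = r₀ x := fun x => by simp [er]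
  have es0 : ∀ x, s (0, x) = s₀ x := fun x => by simp [es]
  have ew0 : ∀ x, w (0, x) = w₀ x := fun x => by simp [ew]
  obtain ⟨v, v0, vt, vx⟩ := exists_potential (r := fun t x => r (t, x)) (s := fun t x => s (t, x))
    (g := fun t x => g (t, x)) cr cs cg dr ds (w₀ 0)
  have hv0 : v 0 = w₀ := eq_of_hasDerivAt_eq (a := 0) (vx 0)
    (fun x => (dw₀ x).congr_deriv (by rw [er0, es0])) v0
  have hv : ∀ x, (fun t => w (t, x)) = fun t => v t x := fun x =>
    eq_of_hasDerivAt_eq (a := 0) (fun t => dt t x) (fun t => vt t x) (by rw [ew0, hv0])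
  refine ⟨fun t x => r (t, x), fun t x => s (t, x), fun t x => w (t, x),
    ⟨cr, cs, cw, ?_, ?_, dt, ?_⟩, funext er0, funext es0, funext ew0⟩
  · intro t x
    rw [← hg (t, x)]
    exact dr t x
  · intro t x
    rw [← hg (t, x)]
    exact ds t x
  · intro t x
    have h : (fun y => w (t, y)) = v t := funext fun y => congrFun (hv y) t
    rw [h]
    exact vx t x

variable {a₁ a₂ a₃ : ℝ → ℝ → F →L[ℝ] F} {r s w r' s' w' : ℝ → ℝ → F}

/-- Exchange of the roles of `t` and `x`. -/
theorem CharSol.swap (h : CharSol a₁ a₂ a₃ r s w) :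
    CharSol (fun x t => -a₁ t x) (fun x t => a₂ t x) (fun x t => -a₃ t x)
      (fun x t => r t x) (fun x t => -s t x) (fun x t => w t x) where
  cont_r := h.cont_r.comp continuous_swap
  cont_s := (h.cont_s.comp continuous_swap).neg
  cont_w := h.cont_w.comp continuous_swap
  deriv_r x t := by
    have h1 := hasDerivAt_comp_neg_of_hasDerivAt (x := 0) (by simpa using h.deriv_r t x)
    refine (h1.congr_of_eventuallyEq (Filter.Eventually.of_forall fun σ => ?_)).congr_deriv ?_
    · simp [sub_eq_add_neg]
    · simp only [neg_apply, map_neg]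
      abel
  deriv_s x t := by
    refine (h.deriv_s t x).neg.congr_deriv ?_
    simp only [neg_apply, map_neg]
    abel
  deriv_t x t := by
    simpa only [sub_eq_add_neg] using h.deriv_x t x
  deriv_x x t := by
    simpa only [sub_neg_eq_add] using h.deriv_t t x

/-- Time reversal. -/
theorem CharSol.reflect (h : CharSol a₁ a₂ a₃ r s w) :
    CharSol (fun t x => -a₂ (-t) x) (fun t x => -a₁ (-t) x) (fun t x => a₃ (-t) x)
      (fun t x => -s (-t) x) (fun t x => -r (-t) x) (fun t x => w (-t) x) where
  cont_r := (h.cont_s.comp (by fun_prop : Continuous fun p : ℝ × ℝ => (-p.1, p.2))).neg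
  cont_s := (h.cont_r.comp (by fun_prop : Continuous fun p : ℝ × ℝ => (-p.1, p.2))).neg
  cont_w := h.cont_w.comp (by fun_prop : Continuous fun p : ℝ × ℝ => (-p.1, p.2))
  deriv_r t x := by
    have h1 := hasDerivAt_comp_neg_of_hasDerivAt (x := 0) (by simpa using h.deriv_s (-t) x)
    refine (h1.neg.congr_of_eventuallyEq (Filter.Eventually.of_forall fun σ => ?_)).congr_deriv ?_
    · simp [sub_eq_add_neg, add_comm]
    · simp only [neg_apply, map_neg]
      abel
  deriv_s t x := by
    have h1 := hasDerivAt_comp_neg_of_hasDerivAt (x := 0) (by simpa using h.deriv_r (-t) x)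
    refine (h1.neg.congr_of_eventuallyEq (Filter.Eventually.of_forall fun σ => ?_)).congr_deriv ?_
    · simp [add_comm]
    · simp only [neg_apply, map_neg]
      abel
  deriv_t t x := by
    have h1 := hasDerivAt_comp_neg_of_hasDerivAt (h.deriv_t (-t) x)
    refine h1.congr_deriv ?_
    rw [← smul_neg]
    congr 1
    abel
  deriv_x t x := by
    refine (h.deriv_x (-t) x).congr_deriv ?_
    congr 1
    abel

theorem CharSol.sub (h : CharSol a₁ a₂ a₃ r s w) (h' : CharSol a₁ a₂ a₃ r' s' w') :
    CharSol a₁ a₂ a₃ (fun t x => r t x - r' t x) (fun t x => s t x - s' t x)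
      (fun t x => w t x - w' t x) where
  cont_r := h.cont_r.sub h'.cont_r
  cont_s := h.cont_s.sub h'.cont_s
  cont_w := h.cont_w.sub h'.cont_w
  deriv_r t x := by
    refine ((h.deriv_r t x).sub (h'.deriv_r t x)).congr_deriv ?_
    simp only [map_sub]
    abel
  deriv_s t x := by
    refine ((h.deriv_s t x).sub (h'.deriv_s t x)).congr_deriv ?_
    simp only [map_sub]
    abel
  deriv_t t x := by
    refine ((h.deriv_t t x).sub (h'.deriv_t t x)).congr_deriv ?_
    rw [← smul_sub]
    congr 1
    abel
  deriv_x t x := by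
    refine ((h.deriv_x t x).sub (h'.deriv_x t x)).congr_deriv ?_
    rw [← smul_sub]
    congr 1
    abel

end CharSol

/-! ### Energy estimates in light cones -/

section Estimates

/-- Gronwall's inequality in integral form. -/
theorem le_exp_of_le_integral {φ : ℝ → ℝ} (cφ : Continuous φ) {A B L : ℝ} (hB : 0 ≤ B)
    (h : ∀ t ∈ Icc 0 L, φ t ≤ A + B * ∫ σ in (0:ℝ)..t, φ σ) :
    ∀ t ∈ Icc 0 L, φ t ≤ A * Real.exp (B * t) := by
  intro t ht
  let k : ℝ → ℝ := fun t => (A + B * ∫ σ in (0:ℝ)..t, φ σ) * Real.exp (-(B * t))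
  have dk : ∀ t, HasDerivAt k ((B * φ t) * Real.exp (-(B * t))
      + (A + B * ∫ σ in (0:ℝ)..t, φ σ) * (Real.exp (-(B * t)) * (-(B * 1)))) t := fun t =>
    (((cφ.integral_hasStrictDerivAt 0 t).hasDerivAt.const_mul B).const_add A).mul
      (((hasDerivAt_id t).const_mul B).neg.exp)
  have hanti : AntitoneOn k (Icc 0 L) := by
    refine antitoneOn_of_deriv_nonpos (convex_Icc 0 L)
      (fun x _ => (dk x).continuousAt.continuousWithinAt)
      (fun x _ => (dk x).differentiableAt.differentiableWithinAt) fun x hx => ?_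
    rw [(dk x).deriv]
    rw [interior_Icc] at hx
    have h1 := h x ⟨hx.1.le, hx.2.le⟩
    have h2 := mul_nonneg hB (Real.exp_pos (-(B * x))).le
    nlinarith
  have h1 := hanti ⟨le_rfl, ht.1.trans ht.2⟩ ht ht.1
  simp only [k, intervalIntegral.integral_same, mul_zero, add_zero, neg_zero, Real.exp_zero,
    mul_one] at h1
  have h2 := h t ht
  have h3 : Real.exp (-(B * t)) * Real.exp (B * t) = 1 := by
    rw [← Real.exp_add]
    simp
  calc φ t ≤ (A + B * ∫ σ in (0:ℝ)..t, φ σ) * (Real.exp (-(B * t)) * Real.exp (B * t)) := by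
        rw [h3, mul_one]
        exact h2
    _ = ((A + B * ∫ σ in (0:ℝ)..t, φ σ) * Real.exp (-(B * t))) * Real.exp (B * t) := by ring
    _ ≤ A * Real.exp (B * t) := by gcongr

theorem integral_le_of_subinterval {f : ℝ → ℝ} (cf : Continuous f) (h0 : ∀ x, 0 ≤ f x)
    {a b c d : ℝ} (hca : c ≤ a) (hab : a ≤ b) (hbd : b ≤ d) :
    ∫ x in a..b, f x ≤ ∫ x in c..d, f x :=
  intervalIntegral.integral_mono_interval hca hab hbd (Filter.Eventually.of_forall h0)
    (cf.intervalIntegrable _ _)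

theorem continuous_integral_moving {e : ℝ → ℝ → ℝ} (ce : Continuous fun p : ℝ × ℝ => e p.1 p.2)
    {α β : ℝ → ℝ} (hα : Continuous α) (hβ : Continuous β) :
    Continuous fun t => ∫ x in (α t)..(β t), e t x := by
  have ce' : ∀ t, Continuous fun x => e t x := fun t =>
    ce.comp (by fun_prop : Continuous fun x : ℝ => (t, x))
  have h : (fun t => ∫ x in (α t)..(β t), e t x)
      = fun t => (∫ x in (0:ℝ)..(β t), e t x) - ∫ x in (0:ℝ)..(α t), e t x := by
    funext t
    exact (intervalIntegral.integral_interval_sub_left ((ce' t).intervalIntegrable _ _)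
      ((ce' t).intervalIntegrable _ _)).symm
  rw [h]
  exact (intervalIntegral.continuous_parametric_intervalIntegral_of_continuous ce hβ).sub
    (intervalIntegral.continuous_parametric_intervalIntegral_of_continuous ce hα)

theorem integral_add_of_continuous {G : Type*} [NormedAddCommGroup G] [NormedSpace ℝ G]
    {f g : ℝ → G} (cf : Continuous f) (cg : Continuous g) (a b : ℝ) :
    ∫ x in a..b, (f x + g x) = (∫ x in a..b, f x) + ∫ x in a..b, g x :=
  intervalIntegral.integral_add (cf.intervalIntegrable _ _) (cg.intervalIntegrable _ _)

/-- Transport with speed `c ∈ [-1, 1]` does not leave the backward light cone. -/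
theorem integral_cone_le {Q e : ℝ → ℝ → ℝ} (cQ : Continuous fun p : ℝ × ℝ => Q p.1 p.2)
    (ce : Continuous fun p : ℝ × ℝ => e p.1 p.2) (hQ : ∀ t x, 0 ≤ Q t x) (he : ∀ t x, 0 ≤ e t x)
    {c C : ℝ} (hc : |c| ≤ 1) (hC : 0 ≤ C)
    (h : ∀ t, 0 ≤ t → ∀ x, Q t x ≤ Q 0 (x + c * t)
      + C * ∫ σ in (0:ℝ)..t, e σ (x + c * (t - σ)))
    {x₀ P t : ℝ} (ht : 0 ≤ t) (htP : t ≤ P) :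
    ∫ x in (x₀ - P + t)..(x₀ + P - t), Q t x ≤ (∫ x in (x₀ - P)..(x₀ + P), Q 0 x)
      + C * ∫ σ in (0:ℝ)..t, ∫ x in (x₀ - P + σ)..(x₀ + P - σ), e σ x := by
  have cQ' : ∀ t, Continuous fun x => Q t x := fun t =>
    cQ.comp (by fun_prop : Continuous fun x : ℝ => (t, x))
  have ce' : ∀ t, Continuous fun x => e t x := fun t =>
    ce.comp (by fun_prop : Continuous fun x : ℝ => (t, x))
  have cI : Continuous fun p : ℝ × ℝ => e p.2 (p.1 + c * (t - p.2)) :=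
    ce.comp (by fun_prop : Continuous fun p : ℝ × ℝ => (p.2, p.1 + c * (t - p.2)))
  have cI2 : Continuous fun x => ∫ σ in (0:ℝ)..t, e σ (x + c * (t - σ)) :=
    intervalIntegral.continuous_parametric_intervalIntegral_of_continuous'
      (f := fun x σ => e σ (x + c * (t - σ))) cI 0 t
  have hc' := abs_le.1 hc
  have hle : x₀ - P + t ≤ x₀ + P - t := by linarith
  have h1 : ∫ x in (x₀ - P + t)..(x₀ + P - t), Q t x
      ≤ ∫ x in (x₀ - P + t)..(x₀ + P - t), (Q 0 (x + c * t)
        + C * ∫ σ in (0:ℝ)..t, e σ (x + c * (t - σ))) := by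
    refine intervalIntegral.integral_mono_on hle ((cQ' t).intervalIntegrable _ _) ?_
      fun x _ => h t ht x
    exact ((((cQ' 0).comp (continuous_add_const (c * t)))).add
      (continuous_const.mul cI2)).intervalIntegrable _ _
  refine h1.trans ?_
  rw [integral_add_of_continuous (f := fun x => Q 0 (x + c * t))
    (g := fun x => C * ∫ σ in (0:ℝ)..t, e σ (x + c * (t - σ)))
    ((cQ' 0).comp (continuous_add_const (c * t))) (continuous_const.mul cI2),
        intervalIntegral.integral_const_mul,
    integral_swap_of_continuous cI]
  gcongr
  · rw [intervalIntegral.integral_comp_add_right (fun x => Q 0 x)]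
    exact integral_le_of_subinterval (cQ' 0) (hQ 0) (by nlinarith) (by linarith) (by nlinarith)
  · refine intervalIntegral.integral_mono_on ht ?_ ?_ fun σ hσ => ?_
    · exact (intervalIntegral.continuous_parametric_intervalIntegral_of_continuous'
        (f := fun σ x => e σ (x + c * (t - σ))) (cI.comp continuous_swap) _ _).intervalIntegrable
          _ _
    · exact (continuous_integral_moving ce (by fun_prop) (by fun_prop)).intervalIntegrable _ _
    · rw [intervalIntegral.integral_comp_add_right (fun x => e σ x)]
      have := hσ.1
      have := hσ.2
      exact integral_le_of_subinterval (ce' σ) (he σ) (by nlinarith) (by linarith) (by nlinarith)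

variable {F : Type*} [NormedAddCommGroup F] [InnerProductSpace ℝ F]

/-- The energy density of `CharSol`. -/
def energyDensity (r s w : ℝ → ℝ → F) (t x : ℝ) : ℝ := ‖r t x‖ ^ 2 + ‖s t x‖ ^ 2 + ‖w t x‖ ^ 2

omit [InnerProductSpace ℝ F] in
theorem energyDensity_nonneg (r s w : ℝ → ℝ → F) (t x : ℝ) : 0 ≤ energyDensity r s w t x := by
  unfold energyDensity
  positivity

variable {a₁ a₂ a₃ : ℝ → ℝ → F →L[ℝ] F} {r s w : ℝ → ℝ → F}

theorem CharSol.continuous_energyDensity (h : CharSol a₁ a₂ a₃ r s w) :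
    Continuous fun p : ℝ × ℝ => energyDensity r s w p.1 p.2 :=
  ((h.cont_r.norm.pow 2).add (h.cont_s.norm.pow 2)).add (h.cont_w.norm.pow 2)

/-- A quantity transported with speed `c`, whose derivative along the transport is controlled. -/
theorem norm_sq_le_of_transport {q g : ℝ → F} {e : ℝ → ℝ} {C t : ℝ} (ht : 0 ≤ t)
    (dq : ∀ σ, HasDerivAt q (g σ) σ) (cg : Continuous g) (ce : Continuous e)
    (hb : ∀ σ, 2 * ⟪q σ, g σ⟫_ℝ ≤ C * e σ) :
    ‖q t‖ ^ 2 ≤ ‖q 0‖ ^ 2 + C * ∫ σ in (0:ℝ)..t, e σ := by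
  have cq : Continuous q := continuous_iff_continuousAt.2 fun x => (dq x).continuousAt
  have h1 := intervalIntegral.integral_eq_sub_of_hasDerivAt (a := 0) (b := t)
    (fun σ _ => (dq σ).norm_sq) ((continuous_const.mul (cq.inner cg)).intervalIntegrable _ _)
  have h2 : ∫ σ in (0:ℝ)..t, 2 * ⟪q σ, g σ⟫_ℝ ≤ ∫ σ in (0:ℝ)..t, C * e σ :=
    intervalIntegral.integral_mono_on ht
      ((continuous_const.mul (cq.inner cg)).intervalIntegrable _ _)
      ((continuous_const.mul ce).intervalIntegrable _ _) fun σ _ => hb σ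
  rw [h1, intervalIntegral.integral_const_mul] at h2
  linarith

theorem two_inner_rhs_le {K : ℝ} {A₁ A₂ A₃ : F →L[ℝ] F} (h₁ : ‖A₁‖ ≤ K) (h₂ : ‖A₂‖ ≤ K)
    (h₃ : ‖A₃‖ ≤ K) (q x y z : F) :
    2 * ⟪q, A₁ x + A₂ y + A₃ z⟫_ℝ
      ≤ ‖q‖ ^ 2 + 3 * K ^ 2 * (‖x‖ ^ 2 + ‖y‖ ^ 2 + ‖z‖ ^ 2) := by
  have hK : 0 ≤ K := (norm_nonneg _).trans h₁
  have e1 := A₁.le_of_opNorm_le_of_le h₁ (le_refl ‖x‖)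
  have e2 := A₂.le_of_opNorm_le_of_le h₂ (le_refl ‖y‖)
  have e3 := A₃.le_of_opNorm_le_of_le h₃ (le_refl ‖z‖)
  have e4 := norm_add₃_le (a := A₁ x) (b := A₂ y) (c := A₃ z)
  have e5 : ‖A₁ x + A₂ y + A₃ z‖ ≤ K * (‖x‖ + ‖y‖ + ‖z‖) := by linarith
  have e6 := real_inner_le_norm q (A₁ x + A₂ y + A₃ z)
  have e7 : ‖A₁ x + A₂ y + A₃ z‖ ^ 2 ≤ (K * (‖x‖ + ‖y‖ + ‖z‖)) ^ 2 :=
    pow_le_pow_left₀ (norm_nonneg _) e5 2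
  have e8 : (K * (‖x‖ + ‖y‖ + ‖z‖)) ^ 2 ≤ 3 * K ^ 2 * (‖x‖ ^ 2 + ‖y‖ ^ 2 + ‖z‖ ^ 2) := by
    have : (‖x‖ + ‖y‖ + ‖z‖) ^ 2 ≤ 3 * (‖x‖ ^ 2 + ‖y‖ ^ 2 + ‖z‖ ^ 2) := by
      nlinarith [sq_nonneg (‖x‖ - ‖y‖), sq_nonneg (‖y‖ - ‖z‖), sq_nonneg (‖x‖ - ‖z‖)]
    rw [mul_pow]
    nlinarith [sq_nonneg K]
  nlinarith [sq_nonneg (‖q‖ - ‖A₁ x + A₂ y + A₃ z‖)]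

/-- The three components of a solution, at a time `t ≥ 0`, in terms of the data and of the energy
density along the lines of speed `1`, `-1` and `0`. -/
theorem CharSol.norm_sq_le (h : CharSol a₁ a₂ a₃ r s w)
    (h₁ : Continuous fun p : ℝ × ℝ => a₁ p.1 p.2) (h₂ : Continuous fun p : ℝ × ℝ => a₂ p.1 p.2)
    (h₃ : Continuous fun p : ℝ × ℝ => a₃ p.1 p.2) {K : ℝ}
    (hK₁ : ∀ t x, ‖a₁ t x‖ ≤ K) (hK₂ : ∀ t x, ‖a₂ t x‖ ≤ K) (hK₃ : ∀ t x, ‖a₃ t x‖ ≤ K)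
    {t : ℝ} (ht : 0 ≤ t) (x : ℝ) :
    ‖r t x‖ ^ 2 ≤ ‖r 0 (x + 1 * t)‖ ^ 2
        + (1 + 3 * K ^ 2) * ∫ σ in (0:ℝ)..t, energyDensity r s w σ (x + 1 * (t - σ)) ∧
    ‖s t x‖ ^ 2 ≤ ‖s 0 (x + (-1) * t)‖ ^ 2
        + (1 + 3 * K ^ 2) * ∫ σ in (0:ℝ)..t, energyDensity r s w σ (x + (-1) * (t - σ)) ∧
    ‖w t x‖ ^ 2 ≤ ‖w 0 (x + 0 * t)‖ ^ 2
        + (1 + 3 * K ^ 2) * ∫ σ in (0:ℝ)..t, energyDensity r s w σ (x + 0 * (t - σ)) := by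
  have ce := h.continuous_energyDensity
  have cr := h.cont_r
  have cs := h.cont_s
  have cw := h.cont_w
  have cg : Continuous fun p : ℝ × ℝ =>
      a₁ p.1 p.2 (r p.1 p.2) + a₂ p.1 p.2 (s p.1 p.2) + a₃ p.1 p.2 (w p.1 p.2) :=
    ((h₁.clm_apply cr).add (h₂.clm_apply cs)).add (h₃.clm_apply cw)
  refine ⟨?_, ?_, ?_⟩
  · have key := norm_sq_le_of_transport (q := fun σ => r (0 + σ) (x + t - σ))
      (e := fun σ => energyDensity r s w (0 + σ) (x + t - σ)) (C := 1 + 3 * K ^ 2) ht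
      (fun σ => hasDerivAt_char_r h.deriv_r 0 (x + t) σ)
      (cg.comp (by fun_prop : Continuous fun σ : ℝ => (0 + σ, x + t - σ)))
      (ce.comp (by fun_prop : Continuous fun σ : ℝ => (0 + σ, x + t - σ))) (fun σ => by
        have := two_inner_rhs_le (hK₁ (0 + σ) (x + t - σ)) (hK₂ (0 + σ) (x + t - σ))
          (hK₃ (0 + σ) (x + t - σ)) (r (0 + σ) (x + t - σ)) (r (0 + σ) (x + t - σ))
          (s (0 + σ) (x + t - σ)) (w (0 + σ) (x + t - σ))
        simp only [energyDensity]
        nlinarith [sq_nonneg ‖s (0 + σ) (x + t - σ)‖, sq_nonneg ‖w (0 + σ) (x + t - σ)‖])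
    simpa only [zero_add, add_sub_cancel_right, sub_zero, one_mul, add_sub_assoc] using key
  · have key := norm_sq_le_of_transport (q := fun σ => s (0 + σ) (x - t + σ))
      (e := fun σ => energyDensity r s w (0 + σ) (x - t + σ)) (C := 1 + 3 * K ^ 2) ht
      (fun σ => hasDerivAt_char_s h.deriv_s 0 (x - t) σ)
      (cg.comp (by fun_prop : Continuous fun σ : ℝ => (0 + σ, x - t + σ)))
      (ce.comp (by fun_prop : Continuous fun σ : ℝ => (0 + σ, x - t + σ))) (fun σ => by
        have := two_inner_rhs_le (hK₁ (0 + σ) (x - t + σ)) (hK₂ (0 + σ) (x - t + σ))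
          (hK₃ (0 + σ) (x - t + σ)) (s (0 + σ) (x - t + σ)) (r (0 + σ) (x - t + σ))
          (s (0 + σ) (x - t + σ)) (w (0 + σ) (x - t + σ))
        simp only [energyDensity]
        nlinarith [sq_nonneg ‖r (0 + σ) (x - t + σ)‖, sq_nonneg ‖w (0 + σ) (x - t + σ)‖])
    have e : ∀ σ, x - t + σ = x + (-1) * (t - σ) := fun σ => by ring
    simp only [zero_add, sub_add_cancel, add_zero] at key
    rw [show x + -1 * t = x - t by ring]
    simpa only [e, neg_one_mul, sub_self, neg_zero, add_zero] using key
  · have key := norm_sq_le_of_transport (q := fun σ => w σ x)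
      (e := fun σ => energyDensity r s w σ x) (C := 1 + 3 * K ^ 2) ht
      (fun σ => h.deriv_t σ x)
      (((cr.add cs).const_smul (1 / 2 : ℝ)).comp (by fun_prop : Continuous fun σ : ℝ => (σ, x)))
      (ce.comp (by fun_prop : Continuous fun σ : ℝ => (σ, x))) (fun σ => by
        simp only [energyDensity]
        have e1 := real_inner_le_norm (w σ x) ((1 / 2 : ℝ) • (r σ x + s σ x))
        rw [norm_smul, Real.norm_eq_abs, abs_of_pos (by norm_num : (0:ℝ) < 1 / 2)] at e1
        have e2 := norm_add_le (r σ x) (s σ x)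
        have e3 := mul_le_mul_of_nonneg_left e2 (norm_nonneg (w σ x))
        have e4 : 2 * ⟪w σ x, (1 / 2 : ℝ) • (r σ x + s σ x)⟫_ℝ
            ≤ ‖r σ x‖ ^ 2 + ‖s σ x‖ ^ 2 + ‖w σ x‖ ^ 2 := by
          nlinarith [sq_nonneg (‖w σ x‖ - ‖r σ x‖), sq_nonneg (‖w σ x‖ - ‖s σ x‖),
            sq_nonneg ‖r σ x‖, sq_nonneg ‖s σ x‖]
        nlinarith [sq_nonneg K, sq_nonneg ‖r σ x‖, sq_nonneg ‖s σ x‖, sq_nonneg ‖w σ x‖,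
          mul_nonneg (sq_nonneg K)
            (add_nonneg (add_nonneg (sq_nonneg ‖r σ x‖) (sq_nonneg ‖s σ x‖)) (sq_nonneg ‖w σ x‖))])
    simpa only [zero_mul, add_zero] using key

/-- The energy estimate in light cones, and the majorants of `r` and `s` that are constant along
their characteristic lines. -/
theorem CharSol.estimates {K L : ℝ} (hL : 0 ≤ L) : ∃ C : ℝ, 0 ≤ C ∧
    ∀ (a₁ a₂ a₃ : ℝ → ℝ → F →L[ℝ] F) (r s w : ℝ → ℝ → F),
    (Continuous fun p : ℝ × ℝ => a₁ p.1 p.2) → (Continuous fun p : ℝ × ℝ => a₂ p.1 p.2) →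
    (Continuous fun p : ℝ × ℝ => a₃ p.1 p.2) →
    (∀ t x, ‖a₁ t x‖ ≤ K) → (∀ t x, ‖a₂ t x‖ ≤ K) → (∀ t x, ‖a₃ t x‖ ≤ K) →
    CharSol a₁ a₂ a₃ r s w → ∀ x₀ ρ : ℝ, 0 ≤ ρ →
    (∀ t ∈ Icc 0 L, ∫ x in (x₀ - ρ)..(x₀ + ρ), energyDensity r s w t x
      ≤ C * ∫ x in (x₀ - ρ - 2 * L)..(x₀ + ρ + 2 * L), energyDensity r s w 0 x) ∧
    ∃ mr ms : ℝ → ℝ, Continuous mr ∧ Continuous ms ∧ (∀ u, 0 ≤ mr u) ∧ (∀ u, 0 ≤ ms u) ∧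
      (∀ t ∈ Icc 0 L, ∀ x, ‖r t x‖ ^ 2 ≤ mr (x + t)) ∧
      (∀ t ∈ Icc 0 L, ∀ x, ‖s t x‖ ^ 2 ≤ ms (x - t)) ∧
      (∫ u in (x₀ - ρ)..(x₀ + ρ), mr u
        ≤ C * ∫ x in (x₀ - ρ - 2 * L)..(x₀ + ρ + 2 * L), energyDensity r s w 0 x) ∧
      (∫ u in (x₀ - ρ)..(x₀ + ρ), ms u
        ≤ C * ∫ x in (x₀ - ρ - 2 * L)..(x₀ + ρ + 2 * L), energyDensity r s w 0 x) := by
  obtain ⟨C₀, hC₀⟩ : ∃ C₀ : ℝ, C₀ = 1 + 3 * K ^ 2 := ⟨_, rfl⟩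
  have hC₀p : 0 ≤ C₀ := by rw [hC₀]; positivity
  obtain ⟨G, hG⟩ : ∃ G : ℝ, G = Real.exp (3 * C₀ * L) := ⟨_, rfl⟩
  have hGp : 0 ≤ G := by rw [hG]; positivity
  refine ⟨1 + G + C₀ * L * G, by positivity, ?_⟩
  intro a₁ a₂ a₃ r s w h₁ h₂ h₃ hK₁ hK₂ hK₃ h x₀ ρ hρ
  have ce := h.continuous_energyDensity
  have he := energyDensity_nonneg r s w
  have hb := fun (t : ℝ) (ht : 0 ≤ t) (x : ℝ) => h.norm_sq_le h₁ h₂ h₃ hK₁ hK₂ hK₃ ht x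
  rw [← hC₀] at hb
  have ce' : ∀ t, Continuous fun x => energyDensity r s w t x := fun t =>
    ce.comp (by fun_prop : Continuous fun x : ℝ => (t, x))
  have cr' : ∀ t, Continuous fun x => ‖r t x‖ ^ 2 := fun t =>
    (h.cont_r.norm.pow 2).comp (by fun_prop : Continuous fun x : ℝ => (t, x))
  have cs' : ∀ t, Continuous fun x => ‖s t x‖ ^ 2 := fun t =>
    (h.cont_s.norm.pow 2).comp (by fun_prop : Continuous fun x : ℝ => (t, x))
  have cw' : ∀ t, Continuous fun x => ‖w t x‖ ^ 2 := fun t =>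
    (h.cont_w.norm.pow 2).comp (by fun_prop : Continuous fun x : ℝ => (t, x))
  -- the energy at time `t` in the window of half-width `ρ' ≤ ρ + L`
  have main : ∀ ρ', 0 ≤ ρ' → ρ' ≤ ρ + L → ∀ t ∈ Icc 0 L,
      ∫ x in (x₀ - ρ')..(x₀ + ρ'), energyDensity r s w t x
      ≤ G * ∫ x in (x₀ - ρ - 2 * L)..(x₀ + ρ + 2 * L), energyDensity r s w 0 x := by
    intro ρ' hρ' hρL t ht
    obtain ⟨P, hP⟩ : ∃ P : ℝ, P = ρ + 2 * L := ⟨_, rfl⟩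
    let φ : ℝ → ℝ := fun t => ∫ x in (x₀ - P + t)..(x₀ + P - t), energyDensity r s w t x
    have cφ : Continuous φ := continuous_integral_moving ce (by fun_prop) (by fun_prop)
    have hφ : ∀ t ∈ Icc 0 L, φ t ≤ (∫ x in (x₀ - P)..(x₀ + P), energyDensity r s w 0 x)
        + (3 * C₀) * ∫ σ in (0:ℝ)..t, φ σ := by
      intro t ht
      have htP : t ≤ P := by linarith [ht.2]
      have q1 := integral_cone_le (h.cont_r.norm.pow 2) ce (fun _ _ => sq_nonneg _) he
        (c := 1) (by norm_num) hC₀p (fun t ht x => (hb t ht x).1) (x₀ := x₀) ht.1 htP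
      have q2 := integral_cone_le (h.cont_s.norm.pow 2) ce (fun _ _ => sq_nonneg _) he
        (c := -1) (by norm_num) hC₀p (fun t ht x => (hb t ht x).2.1) (x₀ := x₀) ht.1 htP
      have q3 := integral_cone_le (h.cont_w.norm.pow 2) ce (fun _ _ => sq_nonneg _) he
        (c := 0) (by norm_num) hC₀p (fun t ht x => (hb t ht x).2.2) (x₀ := x₀) ht.1 htP
      have split : ∀ t a b, ∫ x in a..b, energyDensity r s w t x = (∫ x in a..b, ‖r t x‖ ^ 2)
          + (∫ x in a..b, ‖s t x‖ ^ 2) + ∫ x in a..b, ‖w t x‖ ^ 2 := by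
        intro t a b
        rw [← integral_add_of_continuous (cr' t) (cs' t),
          ← integral_add_of_continuous (f := fun x => ‖r t x‖ ^ 2 + ‖s t x‖ ^ 2)
            ((cr' t).add (cs' t)) (cw' t)]
        rfl
      have e1 := split t (x₀ - P + t) (x₀ + P - t)
      have e2 := split 0 (x₀ - P) (x₀ + P)
      simp only [φ]
      linarith
    have h1 := le_exp_of_le_integral cφ (by positivity) hφ t ht
    have h2 : ∫ x in (x₀ - ρ')..(x₀ + ρ'), energyDensity r s w t x ≤ φ t :=
      integral_le_of_subinterval (ce' t) (he t) (by linarith [ht.2]) (by linarith)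
        (by linarith [ht.2])
    have h3 : Real.exp (3 * C₀ * t) ≤ G := by
      rw [hG]
      exact Real.exp_le_exp.2 (by nlinarith [ht.2])
    have h4 : 0 ≤ ∫ x in (x₀ - P)..(x₀ + P), energyDensity r s w 0 x :=
      intervalIntegral.integral_nonneg (by linarith) fun x _ => he 0 x
    have h5 : x₀ - ρ - 2 * L = x₀ - P := by rw [hP]; ring
    have h6 : x₀ + ρ + 2 * L = x₀ + P := by rw [hP]; ring
    rw [h5, h6]
    nlinarith
  have hN : 0 ≤ ∫ x in (x₀ - ρ - 2 * L)..(x₀ + ρ + 2 * L), energyDensity r s w 0 x :=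
    intervalIntegral.integral_nonneg (by linarith) fun x _ => he 0 x
  refine ⟨fun t ht => (main ρ hρ (by linarith) t ht).trans ?_, ?_⟩
  · refine mul_le_mul_of_nonneg_right ?_ hN
    have : 0 ≤ C₀ * L * G := by positivity
    linarith
  -- the majorant of a component transported with speed `c`
  have maj : ∀ (Q : ℝ → ℝ → ℝ) (c : ℝ), |c| ≤ 1 → (Continuous fun x => Q 0 x) →
      (∀ x, 0 ≤ Q 0 x) → (∀ x, Q 0 x ≤ energyDensity r s w 0 x) →
      (∀ t, 0 ≤ t → ∀ x, Q t x ≤ Q 0 (x + c * t)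
        + C₀ * ∫ σ in (0:ℝ)..t, energyDensity r s w σ (x + c * (t - σ))) →
      ∃ m : ℝ → ℝ, Continuous m ∧ (∀ u, 0 ≤ m u) ∧ (∀ t ∈ Icc 0 L, ∀ x, Q t x ≤ m (x + c * t)) ∧
        ∫ u in (x₀ - ρ)..(x₀ + ρ), m u ≤ (1 + G + C₀ * L * G)
          * ∫ x in (x₀ - ρ - 2 * L)..(x₀ + ρ + 2 * L), energyDensity r s w 0 x := by
    intro Q c hc cQ hQ hQe hQb
    have hc' := abs_le.1 hc
    have cI : Continuous fun p : ℝ × ℝ => energyDensity r s w p.2 (p.1 - c * p.2) :=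
      ce.comp (by fun_prop : Continuous fun p : ℝ × ℝ => (p.2, p.1 - c * p.2))
    have cI2 : Continuous fun u => ∫ σ in (0:ℝ)..L, energyDensity r s w σ (u - c * σ) :=
      intervalIntegral.continuous_parametric_intervalIntegral_of_continuous'
        (f := fun u σ => energyDensity r s w σ (u - c * σ)) cI 0 L
    refine ⟨fun u => Q 0 u + C₀ * ∫ σ in (0:ℝ)..L, energyDensity r s w σ (u - c * σ),
      cQ.add (continuous_const.mul cI2), fun u => ?_, fun t ht x => ?_, ?_⟩
    · exact add_nonneg (hQ u) (mul_nonneg hC₀p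
        (intervalIntegral.integral_nonneg hL fun σ _ => he _ _))
    · refine (hQb t ht.1 x).trans ?_
      refine add_le_add le_rfl (mul_le_mul_of_nonneg_left ?_ hC₀p)
      have e1 : ∀ σ, x + c * (t - σ) = x + c * t - c * σ := fun σ => by ring
      simp_rw [e1]
      exact integral_le_of_subinterval
        (cI.comp (by fun_prop : Continuous fun σ : ℝ => (x + c * t, σ))) (fun _ => he _ _)
        le_rfl ht.1 ht.2
    · rw [integral_add_of_continuous (f := fun u => Q 0 u)
        (g := fun u => C₀ * ∫ σ in (0:ℝ)..L, energyDensity r s w σ (u - c * σ)) cQ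
        (continuous_const.mul cI2),
        intervalIntegral.integral_const_mul,
        integral_swap_of_continuous cI]
      have g1 : ∫ u in (x₀ - ρ)..(x₀ + ρ), Q 0 u
          ≤ ∫ x in (x₀ - ρ - 2 * L)..(x₀ + ρ + 2 * L), energyDensity r s w 0 x :=
        (intervalIntegral.integral_mono_on (by linarith) (cQ.intervalIntegrable _ _)
          ((ce' 0).intervalIntegrable _ _) fun x _ => hQe x).trans
        (integral_le_of_subinterval (ce' 0) (he 0) (by linarith) (by linarith) (by linarith))
      have g2 : ∫ σ in (0:ℝ)..L, ∫ u in (x₀ - ρ)..(x₀ + ρ), energyDensity r s w σ (u - c * σ)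
          ≤ ∫ σ in (0:ℝ)..L,
            G * ∫ x in (x₀ - ρ - 2 * L)..(x₀ + ρ + 2 * L), energyDensity r s w 0 x := by
        refine intervalIntegral.integral_mono_on hL ?_ (continuous_const.intervalIntegrable _ _)
          fun σ hσ => ?_
        · exact (intervalIntegral.continuous_parametric_intervalIntegral_of_continuous'
            (f := fun σ u => energyDensity r s w σ (u - c * σ))
            (cI.comp continuous_swap) _ _).intervalIntegrable _ _
        · have hσ1 := hσ.1
          have hσ2 := hσ.2
          rw [intervalIntegral.integral_comp_sub_right (fun x => energyDensity r s w σ x)]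
          exact (integral_le_of_subinterval (ce' σ) (he σ) (by nlinarith) (by linarith)
            (by nlinarith)).trans (main (ρ + L) (by linarith) le_rfl σ hσ)
      rw [intervalIntegral.integral_const, smul_eq_mul, sub_zero] at g2
      nlinarith [mul_le_mul_of_nonneg_left g2 hC₀p, mul_nonneg hGp hN]
  obtain ⟨mr, c1, p1, b1, i1⟩ := maj (fun t x => ‖r t x‖ ^ 2) 1 (by norm_num) (cr' 0)
    (fun x => sq_nonneg _) (fun x => by
      simp only [energyDensity]
      nlinarith [sq_nonneg ‖s 0 x‖, sq_nonneg ‖w 0 x‖]) (fun t ht x => (hb t ht x).1)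
  obtain ⟨ms, c2, p2, b2, i2⟩ := maj (fun t x => ‖s t x‖ ^ 2) (-1) (by norm_num) (cs' 0)
    (fun x => sq_nonneg _) (fun x => by
      simp only [energyDensity]
      nlinarith [sq_nonneg ‖r 0 x‖, sq_nonneg ‖w 0 x‖]) (fun t ht x => (hb t ht x).2.1)
  refine ⟨mr, ms, c1, c2, p1, p2, fun t ht x => ?_, fun t ht x => ?_, i1, i2⟩
  · simpa only [one_mul] using b1 t ht x
  · simpa only [neg_one_mul, ← sub_eq_add_neg] using b2 t ht x

end Estimates

/-! ### Finite speed of propagation and traces on vertical lines -/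

section Sidewise

variable {F : Type*} [NormedAddCommGroup F] [InnerProductSpace ℝ F]

/-- The one-dimensional Sobolev inequality. -/
theorem norm_sq_le_integral {f f' : ℝ → F} (df : ∀ x, HasDerivAt f (f' x) x) (cf' : Continuous f')
    {α β x : ℝ} (hαβ : α < β) (hx : x ∈ Icc α β) :
    ‖f x‖ ^ 2 ≤ (1 / (β - α) + 1) * ∫ y in α..β, (‖f y‖ ^ 2 + ‖f' y‖ ^ 2) := by
  have cf : Continuous f := continuous_iff_continuousAt.2 fun x => (df x).continuousAt
  have ci : Continuous fun y => ‖f y‖ ^ 2 + ‖f' y‖ ^ 2 := (cf.norm.pow 2).add (cf'.norm.pow 2)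
  obtain ⟨I, hI⟩ : ∃ I, I = ∫ y in α..β, (‖f y‖ ^ 2 + ‖f' y‖ ^ 2) := ⟨_, rfl⟩
  have key : ∀ y ∈ Icc α β, ‖f x‖ ^ 2 ≤ ‖f y‖ ^ 2 + I := by
    intro y hy
    have h1 := intervalIntegral.integral_eq_sub_of_hasDerivAt (a := y) (b := x)
      (fun σ _ => (df σ).norm_sq) ((continuous_const.mul (cf.inner cf')).intervalIntegrable _ _)
    have hb : ∀ z, ‖2 * ⟪f z, f' z⟫_ℝ‖ ≤ ‖f z‖ ^ 2 + ‖f' z‖ ^ 2 := fun z => by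
      have := abs_real_inner_le_norm (f z) (f' z)
      rw [Real.norm_eq_abs, abs_mul, abs_of_pos (by norm_num : (0:ℝ) < 2)]
      nlinarith [sq_nonneg (‖f z‖ - ‖f' z‖)]
    have h2 : ‖∫ z in y..x, 2 * ⟪f z, f' z⟫_ℝ‖ ≤ I := by
      refine (intervalIntegral.norm_integral_le_abs_of_norm_le
        (Filter.Eventually.of_forall fun z => hb z) (ci.intervalIntegrable _ _)).trans ?_
      have hab : ∀ a b, a ∈ Icc α β → b ∈ Icc α β → a ≤ b →
          |∫ z in a..b, (‖f z‖ ^ 2 + ‖f' z‖ ^ 2)| ≤ I := fun a b ha hb hab => by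
        rw [abs_of_nonneg (intervalIntegral.integral_nonneg hab fun _ _ => by positivity), hI]
        exact integral_le_of_subinterval ci (fun _ => by positivity) ha.1 hab hb.2
      rcases le_total y x with h | h
      · exact hab y x hy hx h
      · rw [intervalIntegral.integral_symm, abs_neg]
        exact hab x y hx hy h
    have h3 := (le_abs_self _).trans h2
    linarith
  have h1 : ∫ _ in α..β, ‖f x‖ ^ 2 ≤ ∫ y in α..β, (‖f y‖ ^ 2 + I) :=
    intervalIntegral.integral_mono_on hαβ.le (continuous_const.intervalIntegrable _ _)
      (((cf.norm.pow 2).add continuous_const).intervalIntegrable _ _) key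
  rw [integral_add_of_continuous (f := fun y => ‖f y‖ ^ 2) (cf.norm.pow 2) continuous_const,
    intervalIntegral.integral_const, intervalIntegral.integral_const, smul_eq_mul, smul_eq_mul]
    at h1
  have h2 : ∫ y in α..β, ‖f y‖ ^ 2 ≤ I := by
    rw [hI]
    exact intervalIntegral.integral_mono_on hαβ.le ((cf.norm.pow 2).intervalIntegrable _ _)
      (ci.intervalIntegrable _ _) fun y _ => by
        simp only [le_add_iff_nonneg_right]
        positivity
  have hpos : 0 < β - α := sub_pos.2 hαβ
  rw [← hI, div_add_one hpos.ne', div_mul_eq_mul_div, le_div_iff₀ hpos]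
  linarith

theorem eq_zero_of_integral_le_zero {f : ℝ → ℝ} (cf : Continuous f) (hf : ∀ x, 0 ≤ f x) {a b x : ℝ}
    (hab : a < b) (h : ∫ y in a..b, f y ≤ 0) (hx : x ∈ Icc a b) : f x = 0 := by
  by_contra hne
  exact absurd (intervalIntegral.integral_pos hab cf.continuousOn (fun y _ => hf y)
    ⟨x, hx, lt_of_le_of_ne (hf x) (Ne.symm hne)⟩) (not_lt.2 h)

variable {a₁ a₂ a₃ : ℝ → ℝ → F →L[ℝ] F} {r s w : ℝ → ℝ → F}

/-- The solution itself is bounded pointwise by its energy, as `w_x = (r - s) / 2`. -/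
theorem CharSol.norm_sq_le_energy (h : CharSol a₁ a₂ a₃ r s w) {x₀ ρ t x : ℝ} (hρ : 0 < ρ)
    (hx : x ∈ Icc (x₀ - ρ) (x₀ + ρ)) :
    ‖w t x‖ ^ 2
      ≤ (1 / (2 * ρ) + 1) * ∫ y in (x₀ - ρ)..(x₀ + ρ), energyDensity r s w t y := by
  have c : Continuous fun y : ℝ => (t, y) := by fun_prop
  have cd : Continuous fun y => (1 / 2 : ℝ) • (r t y - s t y) :=
    ((h.cont_r.sub h.cont_s).const_smul _).comp c
  refine (norm_sq_le_integral (h.deriv_x t) cd (by linarith) hx).trans ?_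
  rw [show x₀ + ρ - (x₀ - ρ) = 2 * ρ by ring]
  refine mul_le_mul_of_nonneg_left ?_ (by positivity)
  refine intervalIntegral.integral_mono_on (by linarith)
    ((((h.cont_w.norm.pow 2).comp c).add (cd.norm.pow 2)).intervalIntegrable _ _)
    ((h.continuous_energyDensity.comp c).intervalIntegrable _ _) fun y _ => ?_
  have h1 := norm_sub_le (r t y) (s t y)
  have h2 : ‖(1 / 2 : ℝ) • (r t y - s t y)‖ ^ 2 = (1 / 4) * ‖r t y - s t y‖ ^ 2 := by
    rw [norm_smul, mul_pow]
    norm_num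
  have h3 : ‖r t y - s t y‖ ^ 2 ≤ (‖r t y‖ + ‖s t y‖) ^ 2 := pow_le_pow_left₀ (norm_nonneg _) h1 2
  rw [h2]
  simp only [energyDensity]
  nlinarith [sq_nonneg (‖r t y‖ - ‖s t y‖), sq_nonneg ‖r t y‖, sq_nonneg ‖s t y‖]

/-- A coefficient family that is continuous and bounded by `K`. -/
structure IsCoeff (K : ℝ) (a : ℝ → ℝ → F →L[ℝ] F) : Prop where
  cont : Continuous fun p : ℝ × ℝ => a p.1 p.2
  bound : ∀ t x, ‖a t x‖ ≤ K

theorem IsCoeff.comp {K : ℝ} {a : ℝ → ℝ → F →L[ℝ] F} (h : IsCoeff K a) {f : ℝ × ℝ → ℝ × ℝ}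
    (hf : Continuous f) : IsCoeff K fun t x => a (f (t, x)).1 (f (t, x)).2 :=
  ⟨h.cont.comp hf, fun _ _ => h.bound _ _⟩

theorem IsCoeff.neg {K : ℝ} {a : ℝ → ℝ → F →L[ℝ] F} (h : IsCoeff K a) :
    IsCoeff K fun t x => -a t x :=
  ⟨h.cont.neg, fun _ _ => by rw [norm_neg]; exact h.bound _ _⟩

/-- Finite speed of propagation. -/
theorem CharSol.eq_zero_of_base {K L : ℝ} (hL : 0 ≤ L) (h : CharSol a₁ a₂ a₃ r s w)
    (h₁ : IsCoeff K a₁) (h₂ : IsCoeff K a₂) (h₃ : IsCoeff K a₃) {x₀ ρ : ℝ} (hρ : 0 < ρ)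
    (hr : ∀ x ∈ Icc (x₀ - ρ - 2 * L) (x₀ + ρ + 2 * L), r 0 x = 0)
    (hs : ∀ x ∈ Icc (x₀ - ρ - 2 * L) (x₀ + ρ + 2 * L), s 0 x = 0)
    (hw : ∀ x ∈ Icc (x₀ - ρ - 2 * L) (x₀ + ρ + 2 * L), w 0 x = 0) {t : ℝ} (ht : t ∈ Icc 0 L) :
    r t x₀ = 0 ∧ s t x₀ = 0 ∧ w t x₀ = 0 := by
  obtain ⟨C, hC, H⟩ := CharSol.estimates (F := F) (K := K) hL
  have h0 := (H a₁ a₂ a₃ r s w h₁.cont h₂.cont h₃.cont h₁.bound h₂.bound h₃.bound h x₀ ρ hρ.le).1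
    t ht
  have h1 : ∫ x in (x₀ - ρ - 2 * L)..(x₀ + ρ + 2 * L), energyDensity r s w 0 x = 0 := by
    rw [← intervalIntegral.integral_zero (a := x₀ - ρ - 2 * L) (b := x₀ + ρ + 2 * L) (E := ℝ)
      (μ := volume)]
    refine intervalIntegral.integral_congr fun x hx => ?_
    rw [uIcc_of_le (by linarith)] at hx
    simp [energyDensity, hr x hx, hs x hx, hw x hx]
  rw [h1, mul_zero] at h0
  have h2 : energyDensity r s w t x₀ = 0 := eq_zero_of_integral_le_zero
    (h.continuous_energyDensity.comp (by fun_prop : Continuous fun y : ℝ => (t, y)))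
    (fun y => energyDensity_nonneg r s w t y) (by linarith) h0 (x := x₀)
    ⟨by linarith, by linarith⟩
  simp only [energyDensity] at h2
  have e1 := sq_nonneg ‖r t x₀‖
  have e2 := sq_nonneg ‖s t x₀‖
  have e3 := sq_nonneg ‖w t x₀‖
  refine ⟨?_, ?_, ?_⟩ <;> rw [← norm_eq_zero, ← sq_eq_zero_iff] <;> linarith

/-- The trace on the line `x = 0` over a positive time. -/
theorem CharSol.trace_pos {K L : ℝ} (hL : 0 < L) : ∃ C : ℝ, 0 ≤ C ∧
    ∀ (a₁ a₂ a₃ : ℝ → ℝ → F →L[ℝ] F) (r s w : ℝ → ℝ → F),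
    IsCoeff K a₁ → IsCoeff K a₂ → IsCoeff K a₃ → CharSol a₁ a₂ a₃ r s w →
    ∫ t in (0:ℝ)..L, energyDensity r s w t 0
      ≤ C * ∫ x in (-(3 * L))..(3 * L), energyDensity r s w 0 x := by
  obtain ⟨C, hC, H⟩ := CharSol.estimates (F := F) (K := K) hL.le
  refine ⟨2 * C + L * ((1 / (2 * L) + 1) * C), by positivity, ?_⟩
  intro a₁ a₂ a₃ r s w h₁ h₂ h₃ h
  obtain ⟨he, mr, ms, cr, cs, pr, ps, br, bs, ir, is⟩ := H a₁ a₂ a₃ r s w h₁.cont h₂.cont h₃.cont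
    h₁.bound h₂.bound h₃.bound h 0 L hL.le
  rw [show (0:ℝ) - L - 2 * L = -(3 * L) by ring, show (0:ℝ) + L + 2 * L = 3 * L by ring] at he ir is
  obtain ⟨N, hN⟩ : ∃ N, N = ∫ x in (-(3 * L))..(3 * L), energyDensity r s w 0 x := ⟨_, rfl⟩
  have hN' : 0 ≤ N := by
    rw [hN]
    exact intervalIntegral.integral_nonneg (by linarith) fun _ _ => energyDensity_nonneg r s w _ _
  rw [← hN] at he ir is ⊢
  have hb : ∀ t ∈ Icc 0 L, energyDensity r s w t 0
      ≤ (mr t + ms (-t)) + (1 / (2 * L) + 1) * (C * N) := by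
    intro t ht
    have e1 := br t ht 0
    have e2 := bs t ht 0
    have e3 := (h.norm_sq_le_energy (t := t) (x₀ := 0) (x := 0) hL
      ⟨by linarith, by linarith⟩).trans
      (mul_le_mul_of_nonneg_left (he t ht) (by positivity))
    rw [zero_add] at e1
    rw [zero_sub] at e2
    simp only [energyDensity]
    linarith
  have c0 : Continuous fun t : ℝ => (t, (0:ℝ)) := by fun_prop
  have cms : Continuous fun t => ms (-t) := cs.comp continuous_neg
  have h1 : ∫ t in (0:ℝ)..L, energyDensity r s w t 0
      ≤ ∫ t in (0:ℝ)..L, ((mr t + ms (-t)) + (1 / (2 * L) + 1) * (C * N)) :=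
    intervalIntegral.integral_mono_on hL.le
      ((h.continuous_energyDensity.comp c0).intervalIntegrable _ _)
      (((cr.add cms).add continuous_const).intervalIntegrable _ _) hb
  rw [integral_add_of_continuous (f := fun t => mr t + ms (-t)) (cr.add cms) continuous_const,
    integral_add_of_continuous cr cms, intervalIntegral.integral_const, smul_eq_mul,
    intervalIntegral.integral_comp_neg (fun t => ms t), sub_zero, neg_zero] at h1
  have h2 : ∫ t in (0:ℝ)..L, mr t ≤ C * N :=
    (integral_le_of_subinterval cr pr (by linarith) hL.le (by linarith)).trans ir
  have h3 : ∫ t in (-L)..0, ms t ≤ C * N :=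
    (integral_le_of_subinterval cs ps (by linarith) (by linarith) (by linarith)).trans is
  linarith

omit [InnerProductSpace ℝ F] in
theorem energyDensity_reflect (r s w : ℝ → ℝ → F) (t x : ℝ) :
    energyDensity (fun t x => -s (-t) x) (fun t x => -r (-t) x) (fun t x => w (-t) x) t x
      = energyDensity r s w (-t) x := by
  simp only [energyDensity, norm_neg]
  ring

/-- The trace on the line `x = 0`, over positive and negative times. -/
theorem CharSol.trace {K L : ℝ} (hL : 0 < L) : ∃ C : ℝ, 0 ≤ C ∧
    ∀ (a₁ a₂ a₃ : ℝ → ℝ → F →L[ℝ] F) (r s w : ℝ → ℝ → F),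
    IsCoeff K a₁ → IsCoeff K a₂ → IsCoeff K a₃ → CharSol a₁ a₂ a₃ r s w →
    ∫ t in (-L)..L, energyDensity r s w t 0
      ≤ C * ∫ x in (-(3 * L))..(3 * L), energyDensity r s w 0 x := by
  obtain ⟨C, hC, H⟩ := CharSol.trace_pos (F := F) (K := K) hL
  refine ⟨2 * C, by positivity, ?_⟩
  intro a₁ a₂ a₃ r s w h₁ h₂ h₃ h
  have hr : Continuous fun p : ℝ × ℝ => (-p.1, p.2) := by fun_prop
  have e1 := H _ _ _ _ _ _ h₁ h₂ h₃ h
  have e2 := H _ _ _ _ _ _ (h₂.comp hr).neg (h₁.comp hr).neg (h₃.comp hr) h.reflect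
  simp only [energyDensity_reflect, neg_zero] at e2
  rw [intervalIntegral.integral_comp_neg (fun t => energyDensity r s w t 0), neg_zero] at e2
  have c0 : Continuous fun t => energyDensity r s w t 0 :=
    h.continuous_energyDensity.comp (by fun_prop : Continuous fun t : ℝ => (t, (0:ℝ)))
  rw [← intervalIntegral.integral_add_adjacent_intervals (b := 0) (c0.intervalIntegrable _ _)
    (c0.intervalIntegrable _ _)]
  linarith

end Sidewise

/-! ### Steering to rest by sidewise evolution -/

section Steering

open Real in
/-- A cutoff in time, equal to one near `[-17π/2, 17π/2]` and to zero outside `[-10π, 10π]`. -/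
theorem exists_time_cutoff : ∃ (η η' : ℝ → ℝ) (D : ℝ), Continuous η ∧ Continuous η' ∧
    (∀ t, HasDerivAt η (η' t) t) ∧ (∀ t, |η t| ≤ 1) ∧ (∀ t, |η' t| ≤ D) ∧
    (∀ t ∈ Icc (-(17 / 2 * π)) (17 / 2 * π), η t = 1 ∧ η' t = 0) ∧
    (∀ t, 10 * π ≤ |t| → η t = 0 ∧ η' t = 0) := by
  have hpi := pi_pos
  let b : ContDiffBump (0 : ℝ) := ⟨9 * π, 19 / 2 * π, by positivity, by linarith⟩
  have hb : ContDiff ℝ 1 b := b.contDiff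
  have cd : Continuous (deriv b) := hb.continuous_deriv le_rfl
  have hd : ∀ t, HasDerivAt b (deriv b t) t := fun t =>
    ((hb.differentiable (by norm_num)) t).hasDerivAt
  obtain ⟨D, hD⟩ := cd.bounded_above_of_compact_support b.hasCompactSupport.deriv
  refine ⟨b, deriv b, D, b.continuous, cd, hd, fun t => ?_, hD, fun t ht => ?_, fun t ht => ?_⟩
  · rw [abs_of_nonneg b.nonneg]
    exact b.le_one
  · have ht' : |t| ≤ 17 / 2 * π := abs_le.2 ⟨by linarith [ht.1], ht.2⟩
    refine ⟨b.one_of_mem_closedBall ?_, ?_⟩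
    · rw [Metric.mem_closedBall, dist_zero_right, Real.norm_eq_abs]
      change |t| ≤ 9 * π
      linarith
    · have : b =ᶠ[𝓝 t] fun _ => (1:ℝ) := b.eventuallyEq_one_of_mem_ball (by
        rw [Metric.mem_ball, dist_zero_right, Real.norm_eq_abs]
        change |t| < 9 * π
        linarith)
      rw [this.deriv_eq, deriv_const]
  · refine ⟨b.zero_of_le_dist ?_, ?_⟩
    · rw [dist_zero_right, Real.norm_eq_abs]
      change 19 / 2 * π ≤ |t|
      linarith
    · have : b =ᶠ[𝓝 t] fun _ => (0:ℝ) := by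
        have h1 : ∀ᶠ s in 𝓝 t, 19 / 2 * π < |s| :=
          continuous_abs.continuousAt.eventually (lt_mem_nhds (by linarith))
        filter_upwards [h1] with s hs
        exact b.zero_of_le_dist (by
          rw [dist_zero_right, Real.norm_eq_abs]
          exact hs.le)
      rw [this.deriv_eq, deriv_const]

theorem exists_bound_of_periodic {F : Type*} [NormedAddCommGroup F] {f : ℝ → F} {T : ℝ} (hT : T ≠ 0)
    (cf : Continuous f) (hf : Function.Periodic f T) : ∃ M, ∀ x, ‖f x‖ ≤ M := by
  obtain ⟨M, hM⟩ := (hf.isBounded_of_continuous hT cf).exists_norm_le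
  exact ⟨M, fun x => hM _ (mem_range_self x)⟩

/-- The integral over `n` periods on each side of the origin. -/
theorem integral_period_window {f : ℝ → ℝ} {T : ℝ} (hf : Function.Periodic f T)
    (cf : Continuous f) (n : ℕ) :
    ∫ x in (-(n * T))..(n * T), f x = 2 * n * ∫ x in (0:ℝ)..T, f x := by
  have h := hf.intervalIntegral_add_zsmul_eq (2 * n) (-(n * T))
  rw [show -(n * T) + ((2 * n : ℤ)) • T = n * T by
    rw [zsmul_eq_mul]
    push_cast
    ring] at h
  rw [h fun _ _ => cf.intervalIntegrable _ _, hf.intervalIntegral_add_eq _ 0, zsmul_eq_mul,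
      zero_add]
  push_cast
  ring

theorem integral_eq_of_zero_outside {f : ℝ → ℝ} (cf : Continuous f) {c a b : ℝ}
    (hf : ∀ x, c ≤ |x| → f x = 0) (hc : 0 ≤ c) (ha : a ≤ -c) (hb : c ≤ b) :
    ∫ x in a..b, f x = ∫ x in (-c)..c, f x := by
  rw [← intervalIntegral.integral_add_adjacent_intervals (b := -c) (cf.intervalIntegrable _ _)
    (cf.intervalIntegrable _ _), ← intervalIntegral.integral_add_adjacent_intervals (a := -c)
    (b := c) (c := b) (cf.intervalIntegrable _ _) (cf.intervalIntegrable _ _)]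
  have h1 : ∫ x in a..(-c), f x = ∫ x in a..(-c), (0:ℝ) :=
    intervalIntegral.integral_congr fun x hx => by
      rw [uIcc_of_le ha] at hx
      exact hf x (by rw [abs_of_nonpos (by linarith [hx.2])]; linarith [hx.2])
  have h2 : ∫ x in c..b, f x = ∫ x in c..b, (0:ℝ) :=
    intervalIntegral.integral_congr fun x hx => by
      rw [uIcc_of_le hb] at hx
      exact hf x (by rw [abs_of_nonneg (by linarith [hx.1])]; exact hx.1)
  rw [h1, h2]
  simp

variable {F : Type*} [NormedAddCommGroup F] [InnerProductSpace ℝ F] [CompleteSpace F]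

open Real in
/-- Steering to rest by sidewise evolution. The Cauchy problem with the given periodic data is
solved on the plane, its trace on the line `x = 0` is cut off in time, and the equation is then
solved again with this trace as initial data, `x` being the evolution variable. -/
theorem exists_steered_solution {β γ : ℝ → F →L[ℝ] F} (cβ : Continuous β) (cγ : Continuous γ)
    {K : ℝ} (hβ : ∀ x, ‖β x‖ ≤ K) (hγ : ∀ x, ‖γ x‖ ≤ K) :
    ∃ C : ℝ, 0 ≤ C ∧ ∀ w₀ w₀' w₁ : ℝ → F, (∀ x, HasDerivAt w₀ (w₀' x) x) → Continuous w₀' →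
      Continuous w₁ → Function.Periodic w₀ (2 * π) → Function.Periodic w₀' (2 * π) →
      Function.Periodic w₁ (2 * π) → ∀ N : ℝ,
      N = ∫ x in (0:ℝ)..(2 * π), (‖w₀ x‖ ^ 2 + ‖w₀' x‖ ^ 2 + ‖w₁ x‖ ^ 2) →
      ∃ r s w : ℝ → ℝ → F, CharSol (fun _ x => -((1 / 2 : ℝ) • β x)) (fun _ x => (1 / 2 : ℝ) • β x)
        (fun _ x => -γ x) r s w ∧
      (∀ x ∈ Icc 0 (4 * π), r 0 x = w₁ x + w₀' x ∧ s 0 x = w₁ x - w₀' x ∧ w 0 x = w₀ x) ∧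
      (∀ x ∈ Icc 0 (4 * π), r (32 * π) x = 0 ∧ s (32 * π) x = 0 ∧ w (32 * π) x = 0) ∧
      (∀ t ∈ Icc 0 (32 * π), ∀ x ∈ Icc 0 (4 * π), ‖w t x‖ ^ 2 ≤ C * N) ∧
      ∃ mr ms : ℝ → ℝ, Continuous mr ∧ Continuous ms ∧ (∀ u, 0 ≤ mr u) ∧ (∀ u, 0 ≤ ms u) ∧
        (∀ t, ∀ x ∈ Icc 0 (4 * π), ‖r t x‖ ^ 2 ≤ mr (t + x)) ∧
        (∀ t, ∀ x ∈ Icc 0 (4 * π), ‖s t x‖ ^ 2 ≤ ms (t - x)) ∧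
        (∫ u in (-(4 * π))..(36 * π), mr u ≤ C * N) ∧
        (∫ u in (-(4 * π))..(36 * π), ms u ≤ C * N) := by
  have hpi := pi_pos
  obtain ⟨η, η', D, cη, cη', dη, hη1, hηD, hηin, hηout⟩ := exists_time_cutoff
  -- The values over `[0, 4π]` depend on data `8π` further out on either side. The cutoff `η` is one
  -- on `[-17π/2, 17π/2]`, which is `[-π/2, π/2]` enlarged by `8π`, and `32π - π/2 - 8π ≥ 10π` lies
  -- beyond the support of `η`.
  obtain ⟨C₁, hC₁, trace⟩ := CharSol.trace (F := F) (K := K) (L := 10 * π) (by positivity)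
  obtain ⟨C₂, hC₂, est⟩ := CharSol.estimates (F := F) (K := K) (L := 4 * π) (by positivity)
  have hK0 : 0 ≤ K := (norm_nonneg _).trans (hβ 0)
  have k1 : IsCoeff K (fun (_ : ℝ) x => -((1 / 2 : ℝ) • β x)) := by
    refine ⟨((cβ.const_smul (1 / 2 : ℝ)).neg).comp continuous_snd, fun t x => ?_⟩
    rw [norm_neg, norm_smul, Real.norm_eq_abs, abs_of_pos (by norm_num : (0:ℝ) < 1 / 2)]
    linarith [hβ x]
  have k2 : IsCoeff K (fun (_ : ℝ) x => (1 / 2 : ℝ) • β x) := by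
    refine ⟨(cβ.const_smul (1 / 2 : ℝ)).comp continuous_snd, fun t x => ?_⟩
    rw [norm_smul, Real.norm_eq_abs, abs_of_pos (by norm_num : (0:ℝ) < 1 / 2)]
    linarith [hβ x]
  have k3 : IsCoeff K (fun (_ : ℝ) x => -γ x) := by
    refine ⟨cγ.neg.comp continuous_snd, fun t x => ?_⟩
    rw [norm_neg]
    exact hγ x
  have hsw : Continuous fun p : ℝ × ℝ => (p.2, p.1) := by fun_prop
  -- `D'` is the cost of the cutoff; `60` comes from the `30` periods in `[-30π, 30π]` and from the
  -- factor two in `|r|² + |s|² = 2 (|w_t|² + |w_x|²)`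
  obtain ⟨D', hD'⟩ : ∃ D' : ℝ, D' = 3 + 4 * D ^ 2 := ⟨_, rfl⟩
  have hD'0 : 0 ≤ D' := by rw [hD']; positivity
  obtain ⟨C₃, hC₃⟩ : ∃ C₃ : ℝ, C₃ = D' * (C₁ * (60 * 1)) := ⟨_, rfl⟩
  have hC₃0 : 0 ≤ C₃ := by rw [hC₃]; positivity
  refine ⟨(1 / (2 * (20 * π)) + 1) * (C₂ * C₃) + C₂ * C₃, by positivity, ?_⟩
  intro w₀ w₀' w₁ dw₀ cw₀' cw₁ pw₀ pw₀' pw₁ N hN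
  have cw₀ : Continuous w₀ := continuous_iff_continuousAt.2 fun x => (dw₀ x).continuousAt
  obtain ⟨M₀, hM₀⟩ := exists_bound_of_periodic (by positivity) cw₀ pw₀
  obtain ⟨M₁, hM₁⟩ := exists_bound_of_periodic (by positivity) cw₀' pw₀'
  obtain ⟨M₂, hM₂⟩ := exists_bound_of_periodic (by positivity) cw₁ pw₁
  have hM₀' := (norm_nonneg _).trans (hM₀ 0)
  have hM₁' := (norm_nonneg _).trans (hM₁ 0)
  have hM₂' := (norm_nonneg _).trans (hM₂ 0)
  obtain ⟨r, s, w, sol, er, es, ew⟩ := exists_charSol k1.cont k2.cont k3.cont k1.bound k2.bound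
    k3.bound (r₀ := fun x => w₁ x + w₀' x) (s₀ := fun x => w₁ x - w₀' x) (w₀ := w₀)
    (M := M₀ + M₁ + M₂) (cw₁.add cw₀') (cw₁.sub cw₀')
    (fun x => (norm_add_le _ _).trans (by linarith [hM₁ x, hM₂ x]))
    (fun x => (norm_sub_le _ _).trans (by linarith [hM₁ x, hM₂ x]))
    (fun x => by linarith [hM₀ x])
    (fun x => (dw₀ x).congr_deriv (by
      rw [show w₁ x + w₀' x - (w₁ x - w₀' x) = (2 : ℝ) • w₀' x by rw [two_smul]; abel, smul_smul]
      norm_num))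
  -- the trace on the line `x = 0`
  have hN0 : 0 ≤ N := by
    rw [hN]
    exact intervalIntegral.integral_nonneg (by positivity) fun _ _ => by positivity
  have cdat : Continuous fun x => ‖w₀ x‖ ^ 2 + ‖w₀' x‖ ^ 2 + ‖w₁ x‖ ^ 2 :=
    ((cw₀.norm.pow 2).add (cw₀'.norm.pow 2)).add (cw₁.norm.pow 2)
  have htr : ∫ t in (-(10 * π))..(10 * π), energyDensity r s w t 0 ≤ C₁ * (60 * N) := by
    refine (trace _ _ _ r s w k1 k2 k3 sol).trans (mul_le_mul_of_nonneg_left ?_ hC₁)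
    have h1 : ∫ x in (-(3 * (10 * π)))..(3 * (10 * π)), energyDensity r s w 0 x
        ≤ ∫ x in (-(3 * (10 * π)))..(3 * (10 * π)),
          2 * (‖w₀ x‖ ^ 2 + ‖w₀' x‖ ^ 2 + ‖w₁ x‖ ^ 2) := by
      refine intervalIntegral.integral_mono_on (by linarith)
        ((sol.continuous_energyDensity.comp
          (by fun_prop : Continuous fun x : ℝ => ((0:ℝ), x))).intervalIntegrable _ _)
        ((continuous_const.mul cdat).intervalIntegrable _ _) fun x _ => ?_
      simp only [energyDensity, er, es, ew]
      have := parallelogram_law_with_norm ℝ (w₁ x) (w₀' x)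
      nlinarith [sq_nonneg ‖w₀ x‖]
    have h2 := integral_period_window (f := fun x => ‖w₀ x‖ ^ 2 + ‖w₀' x‖ ^ 2 + ‖w₁ x‖ ^ 2)
      (T := 2 * π) (fun x => by simp only [pw₀ x, pw₀' x, pw₁ x]) cdat 15
    rw [intervalIntegral.integral_const_mul, show 3 * (10 * π) = (15 : ℕ) * (2 * π) by
      push_cast; ring, h2, ← hN] at h1
    rw [show 3 * (10 * π) = (15 : ℕ) * (2 * π) by push_cast; ring]
    refine h1.trans (le_of_eq ?_)
    push_cast
    ring
  -- the data of the sidewise problem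
  have c0 : Continuous fun t : ℝ => (t, (0:ℝ)) := by fun_prop
  have cr0 : Continuous fun t => r t 0 := sol.cont_r.comp c0
  have cs0 : Continuous fun t => s t 0 := sol.cont_s.comp c0
  have cw0 : Continuous fun t => w t 0 := sol.cont_w.comp c0
  let ρ₀ : ℝ → F := fun t => η t • r t 0 + η' t • w t 0
  let σ₀ : ℝ → F := fun t => -(η t • s t 0 + η' t • w t 0)
  let ν₀ : ℝ → F := fun t => η t • w t 0
  have cρ₀ : Continuous ρ₀ := (cη.smul cr0).add (cη'.smul cw0)
  have cσ₀ : Continuous σ₀ := ((cη.smul cs0).add (cη'.smul cw0)).neg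
  have cν₀ : Continuous ν₀ := cη.smul cw0
  have bdd : ∀ f : ℝ → F, Continuous f → (∀ t, 10 * π ≤ |t| → f t = 0) → ∃ M, ∀ t, ‖f t‖ ≤ M := by
    intro f cf hf
    refine cf.bounded_above_of_compact_support (HasCompactSupport.intro
      (isCompact_Icc (a := -(10 * π)) (b := 10 * π)) fun t ht => hf t ?_)
    by_contra hlt
    exact ht (abs_le.1 (not_le.1 hlt).le)
  have zρ₀ : ∀ t, 10 * π ≤ |t| → ρ₀ t = 0 := fun t ht => by simp [ρ₀, hηout t ht]
  have zσ₀ : ∀ t, 10 * π ≤ |t| → σ₀ t = 0 := fun t ht => by simp [σ₀, hηout t ht]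
  have zν₀ : ∀ t, 10 * π ≤ |t| → ν₀ t = 0 := fun t ht => by simp [ν₀, hηout t ht]
  obtain ⟨B₁, hB₁⟩ := bdd ρ₀ cρ₀ zρ₀
  obtain ⟨B₂, hB₂⟩ := bdd σ₀ cσ₀ zσ₀
  obtain ⟨B₃, hB₃⟩ := bdd ν₀ cν₀ zν₀
  have hB₁' := (norm_nonneg _).trans (hB₁ 0)
  have hB₂' := (norm_nonneg _).trans (hB₂ 0)
  have hB₃' := (norm_nonneg _).trans (hB₃ 0)
  have q1 := (k1.comp hsw).neg
  have q2 := k2.comp hsw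
  have q3 := (k3.comp hsw).neg
  obtain ⟨ρ, σ, ν, sol', eρ, eσ, eν⟩ := exists_charSol q1.cont q2.cont q3.cont q1.bound q2.bound
    q3.bound (r₀ := ρ₀) (s₀ := σ₀) (w₀ := ν₀) (M := B₁ + B₂ + B₃) cρ₀ cσ₀
    (fun x => by linarith [hB₁ x]) (fun x => by linarith [hB₂ x]) (fun x => by linarith [hB₃ x])
    (fun t => by
      refine ((dη t).smul (sol.deriv_t t 0)).congr_deriv ?_
      simp only [ρ₀, σ₀, smul_add, sub_neg_eq_add]
      rw [smul_comm (η t), smul_comm (η t)]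
      have : η' t • w t 0 = (1 / 2 : ℝ) • η' t • w t 0 + (1 / 2 : ℝ) • η' t • w t 0 := by
        rw [← add_smul]
        norm_num
      nth_rewrite 1 [this]
      abel)
  have back := sol'.swap
  simp only [neg_neg] at back
  -- the initial values are those of the first solution
  have ini : ∀ x ∈ Icc 0 (4 * π), ρ x 0 = r 0 x ∧ σ x 0 = -s 0 x ∧ ν x 0 = w 0 x := by
    intro x hx
    have hin : ∀ t ∈ Icc (0 - π / 2 - 2 * (4 * π)) (0 + π / 2 + 2 * (4 * π)), η t = 1 ∧ η' t = 0 :=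
      fun t ht => hηin t ⟨by linarith [ht.1], by linarith [ht.2]⟩
    have := (sol'.sub sol.swap).eq_zero_of_base (x₀ := 0) (ρ := π / 2) (L := 4 * π) (by positivity)
      q1 q2 q3 (by positivity) (fun t ht => by simp [eρ, ρ₀, hin t ht])
      (fun t ht => by simp [eσ, σ₀, hin t ht]) (fun t ht => by simp [eν, ν₀, hin t ht]) hx
    exact ⟨sub_eq_zero.1 this.1, sub_eq_zero.1 this.2.1, sub_eq_zero.1 this.2.2⟩
  -- at the final time the sidewise solution has not seen the support of its data
  have fin : ∀ x ∈ Icc 0 (4 * π), ρ x (32 * π) = 0 ∧ σ x (32 * π) = 0 ∧ ν x (32 * π) = 0 := by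
    intro x hx
    have hout : ∀ t ∈ Icc (32 * π - π / 2 - 2 * (4 * π)) (32 * π + π / 2 + 2 * (4 * π)),
        10 * π ≤ |t| := fun t ht => le_abs.2 (Or.inl (by linarith [ht.1]))
    exact sol'.eq_zero_of_base (x₀ := 32 * π) (ρ := π / 2) (L := 4 * π) (by positivity)
      q1 q2 q3 (by positivity) (fun t ht => by rw [eρ, zρ₀ t (hout t ht)])
      (fun t ht => by rw [eσ, zσ₀ t (hout t ht)]) (fun t ht => by rw [eν, zν₀ t (hout t ht)]) hx
  obtain ⟨he, mr, ms, cmr, cms, pr, ps, br, bs, ir, is⟩ := est _ _ _ ρ σ ν q1.cont q2.cont q3.cont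
    q1.bound q2.bound q3.bound sol' (16 * π) (20 * π) (by positivity)
  rw [show 16 * π - 20 * π - 2 * (4 * π) = -(12 * π) by ring,
    show 16 * π + 20 * π + 2 * (4 * π) = 44 * π by ring,
    show 16 * π - 20 * π = -(4 * π) by ring, show 16 * π + 20 * π = 36 * π by ring] at he ir is
  have ce0 : Continuous fun t => energyDensity ρ σ ν 0 t :=
    sol'.continuous_energyDensity.comp (by fun_prop : Continuous fun t : ℝ => ((0:ℝ), t))
  have cer : Continuous fun t => energyDensity r s w t 0 := sol.continuous_energyDensity.comp c0
  have hbase : ∫ t in (-(12 * π))..(44 * π), energyDensity ρ σ ν 0 t ≤ C₃ * N := by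
    rw [integral_eq_of_zero_outside (c := 10 * π) ce0 (fun t ht => by
      simp [energyDensity, eρ, eσ, eν, zρ₀ t ht, zσ₀ t ht, zν₀ t ht]) (by positivity)
      (by linarith) (by linarith)]
    have h1 : ∫ t in (-(10 * π))..(10 * π), energyDensity ρ σ ν 0 t
        ≤ ∫ t in (-(10 * π))..(10 * π), D' * energyDensity r s w t 0 := by
      refine intervalIntegral.integral_mono_on (by linarith) (ce0.intervalIntegrable _ _)
        ((continuous_const.mul cer).intervalIntegrable _ _) fun t _ => ?_
      have sq : ∀ y : F, ‖η t • y + η' t • w t 0‖ ^ 2 ≤ 2 * ‖y‖ ^ 2 + 2 * D ^ 2 * ‖w t 0‖ ^ 2 := by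
        intro y
        have h1 : ‖η t • y + η' t • w t 0‖ ≤ ‖y‖ + D * ‖w t 0‖ := by
          refine (norm_add_le _ _).trans ?_
          rw [norm_smul, norm_smul, Real.norm_eq_abs, Real.norm_eq_abs]
          have := hη1 t
          have := hηD t
          have := norm_nonneg y
          have := norm_nonneg (w t 0)
          nlinarith
        have h2 := pow_le_pow_left₀ (norm_nonneg _) h1 2
        nlinarith [sq_nonneg (‖y‖ - D * ‖w t 0‖)]
      have g1 := sq (r t 0)
      have g2 := sq (s t 0)
      have g3 : ‖η t • w t 0‖ ^ 2 ≤ ‖w t 0‖ ^ 2 := by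
        refine pow_le_pow_left₀ (norm_nonneg _) ?_ 2
        rw [norm_smul, Real.norm_eq_abs]
        nlinarith [hη1 t, norm_nonneg (w t 0)]
      simp only [energyDensity, eρ, eσ, eν, ρ₀, σ₀, ν₀, norm_neg]
      rw [hD']
      nlinarith [sq_nonneg ‖r t 0‖, sq_nonneg ‖s t 0‖, sq_nonneg ‖w t 0‖,
        mul_nonneg (sq_nonneg D) (sq_nonneg ‖r t 0‖), mul_nonneg (sq_nonneg D) (sq_nonneg ‖s t 0‖)]
    rw [intervalIntegral.integral_const_mul] at h1
    refine h1.trans ?_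
    rw [hC₃]
    have := mul_le_mul_of_nonneg_left htr hD'0
    linarith
  have hCN : C₂ * ∫ t in (-(12 * π))..(44 * π), energyDensity ρ σ ν 0 t ≤ C₂ * C₃ * N := by
    have := mul_le_mul_of_nonneg_left hbase hC₂
    linarith
  have hCN0 : 0 ≤ (1 / (2 * (20 * π)) + 1) * (C₂ * C₃) * N := by positivity
  have hCN1 : 0 ≤ C₂ * C₃ * N := by positivity
  refine ⟨fun t x => ρ x t, fun t x => -σ x t, fun t x => ν x t, back, fun x hx => ?_,
    fun x hx => ?_, fun t ht x hx => ?_, mr, ms, cmr, cms, pr, ps, fun t x hx => br x hx t,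
    fun t x hx => ?_, ?_, ?_⟩
  · obtain ⟨g1, g2, g3⟩ := ini x hx
    exact ⟨by simp only [g1, er], by simp only [g2, es, neg_neg], by simp only [g3, ew]⟩
  · obtain ⟨g1, g2, g3⟩ := fin x hx
    exact ⟨g1, by simp only [g2, neg_zero], g3⟩
  · have h1 := sol'.norm_sq_le_energy (t := x) (x := t) (x₀ := 16 * π) (ρ := 20 * π) (by positivity)
      ⟨by linarith [ht.1], by linarith [ht.2]⟩
    rw [show 16 * π - 20 * π = -(4 * π) by ring, show 16 * π + 20 * π = 36 * π by ring] at h1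
    have h2 := mul_le_mul_of_nonneg_left ((he x hx).trans hCN)
      (by positivity : 0 ≤ 1 / (2 * (20 * π)) + 1)
    linarith
  · rw [norm_neg]
    exact bs x hx t
  · linarith
  · linarith

end Steering

/-! ### Smooth and square-integrable functions on the circle -/

section SmoothCircle

variable {F : Type*} [NormedAddCommGroup F] [NormedSpace ℝ F]

theorem smooth_const (c : F) : Smooth (fun _ : Circ => c) := contDiff_const

theorem Smooth.add {f g : Circ → F} (hf : Smooth f) (hg : Smooth g) : Smooth (fun x => f x + g x) :=
  ContDiff.add hf hg

theorem Smooth.sub {f g : Circ → F} (hf : Smooth f) (hg : Smooth g) : Smooth (fun x => f x - g x) :=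
  ContDiff.sub hf hg

theorem Smooth.hasDerivAt {f : Circ → F} (hf : Smooth f) (s : ℝ) :
    HasDerivAt (fun r : ℝ => f (r : Circ)) (WaveControl.dx f (s : Circ)) s := by
  have h : ContDiff ℝ (⊤ : ℕ∞) (fun r : ℝ => f (r : Circ)) := hf
  rw [dx_coe]
  exact ((h.differentiable (by simp)) s).hasDerivAt

theorem dx_eq_of_hasDerivAt {f f' : Circ → F}
    (h : ∀ s : ℝ, HasDerivAt (fun r : ℝ => f (r : Circ)) (f' (s : Circ)) s) :
    WaveControl.dx f = f' := by
  funext x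
  induction x using QuotientAddGroup.induction_on with
  | H s => exact (dx_coe f s).trans (h s).deriv

theorem dx_add {f g : Circ → F} (hf : Smooth f) (hg : Smooth g) :
    WaveControl.dx (fun x => f x + g x) = fun x => WaveControl.dx f x + WaveControl.dx g x :=
  dx_eq_of_hasDerivAt fun s => (hf.hasDerivAt s).add (hg.hasDerivAt s)

theorem dx_const (c : F) : WaveControl.dx (fun _ : Circ => c) = fun _ => 0 :=
  dx_eq_of_hasDerivAt fun s => hasDerivAt_const s c

end SmoothCircle

section ToL2

variable {R : ℕ}

theorem memLp_of_continuous {f : Circ → E R} (hf : Continuous f) :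
    MemLp f 2 (volume : Measure Circ) :=
  hf.memLp_of_hasCompactSupport (HasCompactSupport.of_compactSpace f)

/-- A continuous function on the circle, as an element of `L²`. -/
abbrev toL2 {f : Circ → E R} (hf : Continuous f) : L2 R := (memLp_of_continuous hf).toLp f

theorem inner_toL2 (u : L2 R) {g : Circ → E R} (hg : Continuous g) :
    ⟪u, toL2 hg⟫_ℝ = ∫ x : Circ, ⟪u x, g x⟫_ℝ := by
  rw [L2.inner_def]
  refine integral_congr_ae ?_
  filter_upwards [(memLp_of_continuous hg).coeFn_toLp] with x h1
  rw [h1]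

theorem inner_toL2_toL2 {f g : Circ → E R} (hf : Continuous f) (hg : Continuous g) (a : ℝ) :
    ⟪toL2 hf, toL2 hg⟫_ℝ = ∫ s in a..(a + 2 * Real.pi), ⟪f (s : Circ), g (s : Circ)⟫_ℝ := by
  rw [AddCircle.intervalIntegral_preimage (2 * Real.pi) a (fun x : Circ => ⟪f x, g x⟫_ℝ),
      inner_toL2]
  refine integral_congr_ae ?_
  filter_upwards [(memLp_of_continuous hf).coeFn_toLp] with x h1
  rw [h1]

theorem norm_toL2_sq {f : Circ → E R} (hf : Continuous f) (a : ℝ) :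
    ‖toL2 hf‖ ^ 2 = ∫ s in a..(a + 2 * Real.pi), ‖f (s : Circ)‖ ^ 2 := by
  rw [← real_inner_self_eq_norm_sq, inner_toL2_toL2 hf hf a]
  simp_rw [real_inner_self_eq_norm_sq]

/-- The real trigonometric modes are smooth eigenfunctions of the second derivative. -/
theorem smooth_mode (c : ℂ) (n : ℤ) (v : E R) :
    Smooth (fun x : Circ => (c * fourier n x).re • v) ∧
      dx (dx (fun x : Circ => (c * fourier n x).re • v))
        = fun x => -((n : ℝ) ^ 2) • ((c * fourier n x).re • v) := by
  have hF : ∀ (c : ℂ) (s : ℝ), HasDerivAt (fun r : ℝ => (c * fourier n (r : Circ)).re • v)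
      (((c * (Complex.I * n)) * fourier n (s : Circ)).re • v) s := by
    intro c s
    have h := hasDerivAt_fourier (2 * Real.pi) n s
    have h2 : HasDerivAt (fun r : ℝ => c * fourier n (r : Circ))
        ((c * (Complex.I * n)) * fourier n (s : Circ)) s := by
      refine (h.const_mul c).congr_deriv ?_
      have : (Real.pi : ℂ) ≠ 0 := by exact_mod_cast Real.pi_ne_zero
      push_cast
      field_simp
    exact HasDerivAt.smul_const (Complex.reCLM.hasFDerivAt.comp_hasDerivAt s h2) v
  have h1 : ∀ c : ℂ, dx (fun x : Circ => (c * fourier n x).re • v)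
      = fun x : Circ => ((c * (Complex.I * n)) * fourier n x).re • v :=
    fun c => dx_eq_of_hasDerivAt (hF c)
  refine ⟨?_, ?_⟩
  · have e : (fun s : ℝ => (c * fourier n (s : Circ)).re • v)
        = fun s : ℝ => Complex.reCLM (c * Complex.exp ((Complex.I * n) * Complex.ofRealCLM s))
          • v := by
      funext s
      rw [fourier_coe_apply, Complex.reCLM_apply]
      congr 4
      have : (Real.pi : ℂ) ≠ 0 := by exact_mod_cast Real.pi_ne_zero
      push_cast
      rw [Complex.ofRealCLM_apply]
      field_simp
    unfold Smooth
    rw [e]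
    fun_prop
  · rw [h1, h1]
    funext x
    rw [smul_smul]
    congr 1
    have : c * (Complex.I * n) * (Complex.I * n) * fourier n x
        = ((-((n : ℝ) ^ 2) : ℝ) : ℂ) * (c * fourier n x) := by
      push_cast
      linear_combination (c * n ^ 2 * fourier n x) * Complex.I_sq
    rw [this, Complex.re_ofReal_mul]

/-- The eigenfunctions of the second derivative are total in `L²`. -/
theorem eq_zero_of_inner_eigenfunction (u : L2 R)
    (h : ∀ (θ : Circ → E R) (hθ : Smooth θ) (n : ℝ), (dx (dx θ) = fun x => -(n ^ 2) • θ x) →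
      ⟪u, toL2 hθ.continuous⟫_ℝ = 0) : u = 0 := by
  -- the real linear functional `p ↦ ⟪u, Re (c p) v⟫` on complex continuous functions
  let g : ℂ → E R → (ℂ →L[ℝ] E R) := fun c v =>
    (Complex.reCLM.comp (ContinuousLinearMap.mul ℝ ℂ c)).smulRight v
  let Λ : ℂ → E R → (C(Circ, ℂ) →L[ℝ] ℝ) := fun c v =>
    (innerSL ℝ u).comp ((ContinuousMap.toLp 2 (volume : Measure Circ) ℝ).comp
      ((g c v).compLeftContinuous ℝ Circ))
  have hspan : ∀ p ∈ Submodule.span ℂ (range (fourier (T := 2 * Real.pi))),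
      ∀ (c : ℂ) (v : E R), Λ c v p = 0 := by
    intro p hp
    induction hp using Submodule.span_induction with
    | mem p hp =>
      obtain ⟨n, rfl⟩ := hp
      intro c v
      exact h _ (smooth_mode c n v).1 n (smooth_mode c n v).2
    | zero => intro c v; exact map_zero _
    | add p q _ _ hp hq => intro c v; rw [map_add, hp, hq, add_zero]
    | smul z p _ hp =>
      intro c v
      have e : (g c v).compLeftContinuous ℝ Circ (z • p)
          = (g (c * z) v).compLeftContinuous ℝ Circ p := by
        ext1 x
        change (c * (z * p x)).re • v = (c * z * p x).re • v
        rw [mul_assoc]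
      have : Λ c v (z • p) = Λ (c * z) v p := by
        simp only [Λ, ContinuousLinearMap.comp_apply, e]
      rw [this, hp]
  have hall : ∀ (p : C(Circ, ℂ)) (c : ℂ) (v : E R), Λ c v p = 0 := by
    intro p c v
    have hp : p ∈ closure
        (Submodule.span ℂ (range (fourier (T := 2 * Real.pi))) : Set C(Circ, ℂ)) := by
      rw [← Submodule.topologicalClosure_coe, span_fourier_closure_eq_top]
      trivial
    exact closure_minimal (fun q hq => hspan q hq c v)
      (isClosed_singleton.preimage (Λ c v).continuous) hp
  have hcont : ∀ F : C(Circ, E R), ⟪u, ContinuousMap.toLp 2 (volume : Measure Circ) ℝ F⟫_ℝ = 0 := by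
    intro F
    let P : Fin R → C(Circ, ℂ) := fun i => ⟨fun x => ((F x i : ℝ) : ℂ), by fun_prop⟩
    have e : F = ∑ i, (g 1 (EuclideanSpace.single i (1 : ℝ))).compLeftContinuous ℝ Circ (P i) := by
      ext x j
      rw [ContinuousMap.sum_apply]
      have : ∀ i, ((g 1 (EuclideanSpace.single i (1 : ℝ))).compLeftContinuous ℝ Circ (P i)) x
          = F x i • EuclideanSpace.single i (1 : ℝ) := by
        intro i
        change (1 * ((F x i : ℝ) : ℂ)).re • EuclideanSpace.single i (1 : ℝ) = _
        rw [one_mul, Complex.ofReal_re]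
      simp_rw [this]
      simp [Finset.sum_apply, Pi.single_apply]
    rw [e, map_sum, inner_sum]
    exact Finset.sum_eq_zero fun i _ => hall (P i) 1 _
  have hd := ContinuousMap.toLp_denseRange (E R) (volume : Measure Circ) ℝ
    (p := 2) (by norm_num : (2 : ℝ≥0∞) ≠ ∞)
  have hz : ∀ y : L2 R, ⟪u, y⟫_ℝ = 0 := fun y => by
    refine closure_minimal (s := range (ContinuousMap.toLp 2 (volume : Measure Circ) ℝ))
      (t := {y : L2 R | ⟪u, y⟫_ℝ = 0}) ?_ ?_ (hd y)
    · rintro _ ⟨F, rfl⟩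
      exact hcont F
    · exact isClosed_eq (by fun_prop) continuous_const
  exact inner_self_eq_zero.1 (hz u)

end ToL2

/-! ### The space `H¹` -/

section Sobolev

variable {R : ℕ}

/-- The inclusion of `H¹` in `L²`, as a continuous linear map. -/
def valL (R : ℕ) : H1 R →L[ℝ] L2 R := (WithLp.fstL 2 ℝ (L2 R) (L2 R)).comp (H1 R).subtypeL

/-- The weak derivative, as a continuous linear map from `H¹` to `L²`. -/
def derL (R : ℕ) : H1 R →L[ℝ] L2 R := (WithLp.sndL 2 ℝ (L2 R) (L2 R)).comp (H1 R).subtypeL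

@[simp] theorem valL_apply (f : H1 R) : valL R f = valH f := rfl

@[simp] theorem derL_apply (f : H1 R) : derL R f = derH f := rfl

theorem inner_H1 (f g : H1 R) : ⟪f, g⟫_ℝ = ⟪valH f, valH g⟫_ℝ + ⟪derH f, derH g⟫_ℝ :=
  WithLp.prod_inner_apply _ _

theorem norm_sq_H1 (f : H1 R) : ‖f‖ ^ 2 = ‖valH f‖ ^ 2 + ‖derH f‖ ^ 2 := by
  simp only [← real_inner_self_eq_norm_sq, inner_H1]

theorem norm_valH_le (f : H1 R) : ‖valH f‖ ≤ ‖f‖ :=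
  abs_le_of_sq_le_sq' (by nlinarith [norm_sq_H1 f, sq_nonneg ‖derH f‖]) (norm_nonneg _) |>.2

theorem norm_derH_le (f : H1 R) : ‖derH f‖ ≤ ‖f‖ :=
  abs_le_of_sq_le_sq' (by nlinarith [norm_sq_H1 f, sq_nonneg ‖valH f‖]) (norm_nonneg _) |>.2

theorem H1_ext {f g : H1 R} (h : valH f = valH g) (h' : derH f = derH g) : f = g :=
  Subtype.ext (WithLp.ofLp_injective 2 (Prod.ext h h'))

theorem valH_ofSmooth {f : Circ → E R} (hf : Smooth f) :
    valH (ofSmooth f hf) = toL2 hf.continuous := rfl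

theorem derH_ofSmooth {f : Circ → E R} (hf : Smooth f) :
    derH (ofSmooth f hf) = toL2 hf.dx.continuous := rfl

theorem inner_valH_dx (f : H1 R) {θ : Circ → E R} (hθ : Smooth θ) :
    ⟪valH f, toL2 hθ.dx.continuous⟫_ℝ = -⟪derH f, toL2 hθ.continuous⟫_ℝ := f.2 θ hθ

/-- An element of `H¹` from a function of `L²` and its weak derivative. -/
def mkH1 (f g : L2 R) (h : ∀ (θ : Circ → E R) (hθ : Smooth θ),
    ⟪f, toL2 hθ.dx.continuous⟫_ℝ = -⟪g, toL2 hθ.continuous⟫_ℝ) : H1 R :=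
  ⟨WithLp.toLp 2 (f, g), h⟩

@[simp] theorem derH_mkH1 (f g : L2 R) (h) : derH (mkH1 f g h) = g := rfl

/-- `H¹` is defined inside `L² × L²` by the conditions that test functions impose, each of which is
closed. -/
theorem isClosed_H1 (R : ℕ) : IsClosed (H1 R : Set (WithLp 2 (L2 R × L2 R))) := by
  have : (H1 R : Set (WithLp 2 (L2 R × L2 R))) = ⋂ (θ : Circ → E R) (hθ : Smooth θ),
      {p | ⟪p.fst, toL2 hθ.dx.continuous⟫_ℝ = -⟪p.snd, toL2 hθ.continuous⟫_ℝ} := by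
    ext p
    simp only [mem_iInter, mem_ofPred_eq]
    rfl
  rw [this]
  refine isClosed_iInter fun θ => isClosed_iInter fun hθ => isClosed_eq ?_ ?_
  · exact (WithLp.fstL 2 ℝ (L2 R) (L2 R)).continuous.inner continuous_const
  · exact ((WithLp.sndL 2 ℝ (L2 R) (L2 R)).continuous.inner continuous_const).neg

instance instCompleteSpaceH1 : CompleteSpace (H1 R) := (isClosed_H1 R).completeSpace_coe

/-- A subspace `S` of a closed subspace `M` of a Hilbert space is dense in it if no nonzero vector
of `M` is orthogonal to `S`. -/
theorem subset_closure_of_inner_eq_zero {X : Type*} [NormedAddCommGroup X] [InnerProductSpace ℝ X]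
    [CompleteSpace X] {S M : Submodule ℝ X} (hM : IsClosed (M : Set X)) (hSM : S ≤ M)
    (h : ∀ m ∈ M, (∀ s ∈ S, ⟪m, s⟫_ℝ = 0) → m = 0) : (M : Set X) ⊆ closure S := by
  intro m hm
  have hK : S.topologicalClosure ≤ M := S.topologicalClosure_minimal hSM hM
  have : CompleteSpace S.topologicalClosure := S.isClosed_topologicalClosure.completeSpace_coe
  have hp := S.topologicalClosure.starProjection_apply_mem m
  have h0 := h (m - S.topologicalClosure.starProjection m) (M.sub_mem hm (hK hp)) fun s hs =>
    Submodule.starProjection_inner_eq_zero (K := S.topologicalClosure) m s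
        (S.le_topologicalClosure hs)
  rw [← Submodule.topologicalClosure_coe, sub_eq_zero.1 h0]
  exact hp

theorem Smooth.const_smul {f : Circ → E R} (hf : Smooth f) (c : ℝ) : Smooth fun x => c • f x :=
  ContDiff.const_smul c hf

theorem dx_const_smul {f : Circ → E R} (hf : Smooth f) (c : ℝ) :
    dx (fun x => c • f x) = fun x => c • dx f x :=
  dx_eq_of_hasDerivAt fun s => (hf.hasDerivAt s).const_smul c

theorem toL2_add {f g : Circ → E R} (hf : Continuous f) (hg : Continuous g) :
    toL2 (hf.add hg) = toL2 hf + toL2 hg := rfl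

theorem toL2_const_smul {f : Circ → E R} (hf : Continuous f) (c : ℝ) :
    toL2 (hf.const_smul c) = c • toL2 hf := rfl

theorem toL2_congr {f g : Circ → E R} (hf : Continuous f) (hg : Continuous g) (h : f = g) :
    toL2 hf = toL2 hg := by
  subst h; rfl

theorem ofSmooth_add {f g : Circ → E R} (hf : Smooth f) (hg : Smooth g) :
    ofSmooth _ (hf.add hg) = ofSmooth f hf + ofSmooth g hg := by
  refine H1_ext (toL2_add hf.continuous hg.continuous) ?_
  exact toL2_congr (hf.add hg).dx.continuous (hf.dx.continuous.add hg.dx.continuous) (dx_add hf hg)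

theorem ofSmooth_const_smul {f : Circ → E R} (hf : Smooth f) (c : ℝ) :
    ofSmooth _ (hf.const_smul c) = c • ofSmooth f hf := by
  refine H1_ext (toL2_const_smul hf.continuous c) ?_
  exact toL2_congr (hf.const_smul c).dx.continuous (hf.dx.continuous.const_smul c)
    (dx_const_smul hf c)

theorem ofSmooth_congr {f g : Circ → E R} (hf : Smooth f) (hg : Smooth g) (h : f = g) :
    ofSmooth f hf = ofSmooth g hg := by
  subst h; rfl

theorem inner_dx_dx_eigenfunction (u : L2 R) {θ : Circ → E R} (hθ : Smooth θ) {n : ℝ}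
    (h : dx (dx θ) = fun x => -(n ^ 2) • θ x) :
    ⟪u, toL2 hθ.dx.dx.continuous⟫_ℝ = -(n ^ 2) * ⟪u, toL2 hθ.continuous⟫_ℝ := by
  rw [toL2_congr hθ.dx.dx.continuous (hθ.continuous.const_smul (-(n ^ 2))) h, toL2_const_smul,
    real_inner_smul_right]

/-- The weak derivative is determined by the function. -/
theorem eq_zero_of_valH_eq_zero {f : H1 R} (h : valH f = 0) : f = 0 := by
  refine H1_ext h (eq_zero_of_inner_eigenfunction _ fun θ hθ n _ => ?_)
  have := inner_valH_dx f hθ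
  rw [h, inner_zero_left] at this
  linarith

/-- Smooth functions are dense in `H¹`. -/
theorem exists_smooth_approx_H1 (f : H1 R) {ε : ℝ} (hε : 0 < ε) :
    ∃ (g : Circ → E R) (hg : Smooth g), ‖f - ofSmooth g hg‖ < ε := by
  let S : Submodule ℝ (H1 R) :=
    { carrier := {p | ∃ (g : Circ → E R) (hg : Smooth g), p = ofSmooth g hg}
      add_mem' := by
        rintro _ _ ⟨g, hg, rfl⟩ ⟨k, hk, rfl⟩
        exact ⟨_, _, (ofSmooth_add hg hk).symm⟩
      zero_mem' := ⟨_, smooth_const 0, (eq_zero_of_valH_eq_zero rfl).symm⟩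
      smul_mem' := by
        rintro c _ ⟨g, hg, rfl⟩
        exact ⟨_, _, (ofSmooth_const_smul hg c).symm⟩ }
  have h := subset_closure_of_inner_eq_zero (S := S) (M := ⊤) isClosed_univ le_top fun m _ hm => ?_
  · obtain ⟨_, ⟨g, hg, rfl⟩, hd⟩ := Metric.mem_closure_iff.1
        (mem_of_subset_of_mem h (a := f) trivial) ε hε
    exact ⟨g, hg, by rwa [dist_eq_norm] at hd⟩
  · refine eq_zero_of_valH_eq_zero (eq_zero_of_inner_eigenfunction _ fun θ hθ n hn => ?_)
    have h1 := hm _ ⟨θ, hθ, rfl⟩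
    rw [inner_H1, valH_ofSmooth, derH_ofSmooth] at h1
    have h2 := inner_valH_dx m hθ.dx
    rw [inner_dx_dx_eigenfunction _ hθ hn] at h2
    have h3 : (1 + n ^ 2) * ⟪valH m, toL2 hθ.continuous⟫_ℝ = 0 := by linarith
    exact (mul_eq_zero.1 h3).resolve_left (by positivity)

/-- Smooth functions are dense in `H²`: if `k ∈ H¹` is the derivative of `f ∈ H¹`, one smooth
function approximates `f`, and its derivative approximates `k`, in `H¹`. -/
theorem exists_smooth_approx_H2 {f k : H1 R} (hfk : derH f = valH k) {ε : ℝ} (hε : 0 < ε) :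
    ∃ (g : Circ → E R) (hg : Smooth g), ‖f - ofSmooth g hg‖ < ε ∧
      ‖k - ofSmooth (dx g) hg.dx‖ < ε := by
  let M : Submodule ℝ (WithLp 2 (H1 R × H1 R)) :=
    LinearMap.ker ((derL R).comp (WithLp.fstL 2 ℝ (H1 R) (H1 R))
      - (valL R).comp (WithLp.sndL 2 ℝ (H1 R) (H1 R))).toLinearMap
  have hM : ∀ p : WithLp 2 (H1 R × H1 R), p ∈ M ↔ derH p.fst = valH p.snd := fun p => by
    change derH p.fst - valH p.snd = 0 ↔ _
    rw [sub_eq_zero]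
  let S : Submodule ℝ (WithLp 2 (H1 R × H1 R)) :=
    { carrier := {p | ∃ (g : Circ → E R) (hg : Smooth g),
        p = WithLp.toLp 2 (ofSmooth g hg, ofSmooth (dx g) hg.dx)}
      add_mem' := by
        rintro _ _ ⟨g, hg, rfl⟩ ⟨k, hk, rfl⟩
        refine ⟨_, hg.add hk, ?_⟩
        rw [ofSmooth_add hg hk, ofSmooth_congr _ (hg.dx.add hk.dx) (dx_add hg hk),
          ofSmooth_add hg.dx hk.dx]
        rfl
      zero_mem' := by
        refine ⟨_, smooth_const 0, ?_⟩
        rw [eq_zero_of_valH_eq_zero (f := ofSmooth _ (smooth_const 0)) rfl,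
          ofSmooth_congr _ (smooth_const 0) (dx_const 0),
          eq_zero_of_valH_eq_zero (f := ofSmooth _ (smooth_const 0)) rfl]
        rfl
      smul_mem' := by
        rintro c _ ⟨g, hg, rfl⟩
        refine ⟨_, hg.const_smul c, ?_⟩
        rw [ofSmooth_const_smul hg c, ofSmooth_congr _ (hg.dx.const_smul c) (dx_const_smul hg c),
          ofSmooth_const_smul hg.dx c]
        rfl }
  have hSM : S ≤ M := by
    rintro _ ⟨g, hg, rfl⟩
    exact (hM _).2 rfl
  have hMc : IsClosed (M : Set (WithLp 2 (H1 R × H1 R))) :=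
    ContinuousLinearMap.isClosed_ker ((derL R).comp (WithLp.fstL 2 ℝ (H1 R) (H1 R))
      - (valL R).comp (WithLp.sndL 2 ℝ (H1 R) (H1 R)))
  have h := subset_closure_of_inner_eq_zero hMc hSM fun m hmM hm => ?_
  · obtain ⟨_, ⟨g, hg, rfl⟩, hd⟩ := Metric.mem_closure_iff.1
      (mem_of_subset_of_mem h (a := WithLp.toLp 2 (f, k)) ((hM (WithLp.toLp 2 (f, k))).2 hfk)) ε hε
    rw [dist_eq_norm] at hd
    refine ⟨g, hg, ?_, ?_⟩
    · exact (WithLp.norm_fst_le _ (WithLp.toLp 2 (f, k)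
        - WithLp.toLp 2 (ofSmooth g hg, ofSmooth (dx g) hg.dx))).trans_lt hd
    · exact (WithLp.norm_snd_le _ (WithLp.toLp 2 (f, k)
        - WithLp.toLp 2 (ofSmooth g hg, ofSmooth (dx g) hg.dx))).trans_lt hd
  · have hd := (hM m).1 hmM
    have h0 : m.fst = 0 := by
      refine eq_zero_of_valH_eq_zero (eq_zero_of_inner_eigenfunction _ fun θ hθ n hn => ?_)
      have h1 := hm _ ⟨θ, hθ, rfl⟩
      rw [WithLp.prod_inner_apply] at h1
      change ⟪m.fst, ofSmooth θ hθ⟫_ℝ + ⟪m.snd, ofSmooth (dx θ) hθ.dx⟫_ℝ = 0 at h1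
      rw [inner_H1, inner_H1, valH_ofSmooth, derH_ofSmooth, valH_ofSmooth, derH_ofSmooth,
        inner_dx_dx_eigenfunction _ hθ hn, ← hd] at h1
      have h2 := inner_valH_dx m.fst hθ.dx
      rw [inner_dx_dx_eigenfunction _ hθ hn] at h2
      have h3 := inner_valH_dx m.snd hθ
      rw [← hd] at h3
      have h4 : (1 + 2 * n ^ 2 + n ^ 2 * n ^ 2) * ⟪valH m.fst, toL2 hθ.continuous⟫_ℝ = 0 := by
        linear_combination h1 - 2 * h2 + n ^ 2 * (h3 - h2)
      exact (mul_eq_zero.1 h4).resolve_left (by positivity)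
    have h1 : m.snd = 0 := by
      refine eq_zero_of_valH_eq_zero ?_
      rw [← hd, h0]
      rfl
    exact WithLp.ofLp_injective 2 (Prod.ext h0 h1)

end Sobolev

/-! ### Multiplication operators and limits of differentiable curves -/

section Operators

variable {R : ℕ}

/-- The action of a matrix on vectors, as a continuous linear map. -/
def actL (A : Matrix (Fin R) (Fin R) ℝ) : E R →L[ℝ] E R := Matrix.toEuclideanCLM (𝕜 := ℝ) A

@[simp] theorem actL_apply (A : Matrix (Fin R) (Fin R) ℝ) (v : E R) : actL A v = act A v := rfl

theorem continuous_actL : Continuous (actL (R := R)) :=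
  LinearMap.continuous_of_finiteDimensional
    (Matrix.toEuclideanCLM (n := Fin R) (𝕜 := ℝ)).toAlgEquiv.toLinearMap

theorem inner_act_left (A : Matrix (Fin R) (Fin R) ℝ) (v w : E R) :
    ⟪act A v, w⟫_ℝ = ⟪v, act A.transpose w⟫_ℝ := by
  simp only [act, EuclideanSpace.inner_eq_star_dotProduct, star_trivial]
  rw [Matrix.mulVec_transpose, ← Matrix.dotProduct_mulVec]

theorem SmoothMat.continuous {A : Circ → Matrix (Fin R) (Fin R) ℝ} (hA : SmoothMat A) :
    Continuous A :=
  continuous_pi fun i => continuous_pi fun j => (hA i j).continuous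

theorem SmoothMat.transpose {A : Circ → Matrix (Fin R) (Fin R) ℝ} (hA : SmoothMat A) :
    SmoothMat fun x => (A x).transpose := fun i j => hA j i

theorem SmoothMat.sub {A B : Circ → Matrix (Fin R) (Fin R) ℝ} (hA : SmoothMat A)
    (hB : SmoothMat B) : SmoothMat fun x => A x - B x := fun i j => (hA i j).sub (hB i j)

/-- The entrywise derivative of a matrix-valued function. -/
def dxMat (A : Circ → Matrix (Fin R) (Fin R) ℝ) (x : Circ) : Matrix (Fin R) (Fin R) ℝ :=
  Matrix.of fun i j => dx (fun y => A y i j) x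

theorem SmoothMat.dx {A : Circ → Matrix (Fin R) (Fin R) ℝ} (hA : SmoothMat A) :
    SmoothMat (dxMat A) := fun i j => (hA i j).dx

theorem exists_norm_actL_le {A : Circ → Matrix (Fin R) (Fin R) ℝ} (hA : SmoothMat A) :
    ∃ K, 0 ≤ K ∧ ∀ x, ‖actL (A x)‖ ≤ K := by
  obtain ⟨K, hK⟩ := (isCompact_range (continuous_actL.comp hA.continuous)).isBounded.exists_norm_le
  exact ⟨K, (norm_nonneg _).trans (hK _ ⟨0, rfl⟩), fun x => hK _ ⟨x, rfl⟩⟩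

theorem continuous_act {A : Circ → Matrix (Fin R) (Fin R) ℝ} (hA : SmoothMat A) {f : Circ → E R}
    (hf : Continuous f) : Continuous fun x => act (A x) (f x) :=
  (continuous_actL.comp hA.continuous).clm_apply hf

theorem hasDerivAt_act {A : Circ → Matrix (Fin R) (Fin R) ℝ} (hA : SmoothMat A)
    {f : ℝ → E R} {f' : E R} {s : ℝ} (hf : HasDerivAt f f' s) :
    HasDerivAt (fun r : ℝ => act (A r) (f r)) (act (dxMat A s) (f s) + act (A s) f') s := by
  have hf2 : ∀ j, HasDerivAt (fun r => f r j) (f' j) s := fun j =>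
    (EuclideanSpace.proj (𝕜 := ℝ) j).hasFDerivAt.comp_hasDerivAt s hf
  have hpi : HasDerivAt (fun r : ℝ => (A r).mulVec (f r).ofLp)
      ((dxMat A s).mulVec (f s).ofLp + (A s).mulVec f'.ofLp) s := by
    refine hasDerivAt_pi.2 fun i => ?_
    simp only [Matrix.mulVec, dotProduct, Pi.add_apply, ← Finset.sum_add_distrib]
    exact HasDerivAt.fun_sum fun j _ => ((hA i j).hasDerivAt s).mul (hf2 j)
  exact (EuclideanSpace.equiv (Fin R) ℝ).symm.hasFDerivAt.comp_hasDerivAt s hpi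

theorem Smooth.act {A : Circ → Matrix (Fin R) (Fin R) ℝ} (hA : SmoothMat A) {f : Circ → E R}
    (hf : Smooth f) : Smooth fun x => act (A x) (f x) := by
  have hf2 : ∀ j, Smooth fun x => f x j := fun j =>
    (EuclideanSpace.proj (𝕜 := ℝ) j).contDiff.comp (show ContDiff ℝ (⊤ : ℕ∞) _ from hf)
  refine contDiff_euclidean.2 fun i => ?_
  change ContDiff ℝ (⊤ : ℕ∞) fun s : ℝ => ∑ j, A s i j * f s j
  exact ContDiff.sum fun j _ => ContDiff.mul (show ContDiff ℝ (⊤ : ℕ∞) _ from hA i j)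
    (show ContDiff ℝ (⊤ : ℕ∞) _ from hf2 j)

theorem dx_act {A : Circ → Matrix (Fin R) (Fin R) ℝ} (hA : SmoothMat A) {f : Circ → E R}
    (hf : Smooth f) : WaveControl.dx (fun x => WaveControl.act (A x) (f x))
      = fun x => WaveControl.act (dxMat A x) (f x) + WaveControl.act (A x) (WaveControl.dx f x) :=
  dx_eq_of_hasDerivAt fun s => hasDerivAt_act hA (hf.hasDerivAt s)

theorem memLp_act {A : Circ → Matrix (Fin R) (Fin R) ℝ} (hA : SmoothMat A) (f : L2 R) :
    MemLp (fun x => act (A x) (f x)) 2 (volume : Measure Circ) := by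
  obtain ⟨K, _, hK⟩ := exists_norm_actL_le hA
  refine MemLp.of_le_mul (Lp.memLp f) (c := K) ?_ (ae_of_all _ fun x => ?_)
  · have hc : Continuous fun p : Circ × E R => actL (A p.1) p.2 :=
      (continuous_actL.comp (hA.continuous.comp continuous_fst)).clm_apply continuous_snd
    exact hc.comp_aestronglyMeasurable
      (continuous_id.aestronglyMeasurable.prodMk (Lp.aestronglyMeasurable f))
  · exact (actL (A x)).le_of_opNorm_le (hK x) _

/-- Multiplication by a smooth matrix-valued function, as an operator on `L²`. -/
def mulL2 {A : Circ → Matrix (Fin R) (Fin R) ℝ} (hA : SmoothMat A) : L2 R →L[ℝ] L2 R :=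
  LinearMap.mkContinuousOfExistsBound
    { toFun := fun f => (memLp_act hA f).toLp
      map_add' := fun f g => by
        refine Lp.ext ?_
        filter_upwards [(memLp_act hA f).coeFn_toLp, (memLp_act hA g).coeFn_toLp,
          (memLp_act hA (f + g)).coeFn_toLp, Lp.coeFn_add f g,
          Lp.coeFn_add (memLp_act hA f).toLp (memLp_act hA g).toLp] with x h1 h2 h3 h4 h5
        rw [h5, Pi.add_apply, h1, h2, h3, h4]
        exact map_add (actL (A x)) _ _
      map_smul' := fun c f => by
        refine Lp.ext ?_
        filter_upwards [(memLp_act hA f).coeFn_toLp,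
          (memLp_act hA (c • f)).coeFn_toLp, Lp.coeFn_smul c f,
          Lp.coeFn_smul c (memLp_act hA f).toLp] with x h1 h3 h4 h5
        rw [RingHom.id_apply, h5, Pi.smul_apply, h1, h3, h4]
        exact map_smul (actL (A x)) _ _ } <| by
    obtain ⟨K, _, hK⟩ := exists_norm_actL_le hA
    refine ⟨K, fun f => Lp.norm_le_mul_norm_of_ae_le_mul ?_⟩
    filter_upwards [(memLp_act hA f).coeFn_toLp] with x h1
    change ‖((memLp_act hA f).toLp) x‖ ≤ _
    rw [h1]
    exact (actL (A x)).le_of_opNorm_le (hK x) _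

theorem coeFn_mulL2 {A : Circ → Matrix (Fin R) (Fin R) ℝ} (hA : SmoothMat A) (f : L2 R) :
    mulL2 hA f =ᵐ[volume] fun x => act (A x) (f x) := (memLp_act hA f).coeFn_toLp

theorem mulL2_toL2 {A : Circ → Matrix (Fin R) (Fin R) ℝ} (hA : SmoothMat A) {f : Circ → E R}
    (hf : Continuous f) : mulL2 hA (toL2 hf) = toL2 (continuous_act hA hf) := by
  refine Lp.ext ?_
  filter_upwards [coeFn_mulL2 hA (toL2 hf), (memLp_of_continuous hf).coeFn_toLp,
    (memLp_of_continuous (continuous_act hA hf)).coeFn_toLp] with x h1 h2 h3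
  rw [h1, h2, h3]

theorem inner_mulL2_left {A : Circ → Matrix (Fin R) (Fin R) ℝ} (hA : SmoothMat A) (f g : L2 R) :
    ⟪mulL2 hA f, g⟫_ℝ = ⟪f, mulL2 hA.transpose g⟫_ℝ := by
  rw [L2.inner_def, L2.inner_def]
  refine integral_congr_ae ?_
  filter_upwards [coeFn_mulL2 hA f, coeFn_mulL2 hA.transpose g] with x h1 h2
  rw [h1, h2, inner_act_left]

theorem inner_mulL2_add {B C : Circ → Matrix (Fin R) (Fin R) ℝ} (hB : SmoothMat B)
    (hC : SmoothMat C) (f g h : L2 R) :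
    ∫ x : Circ, ⟪act (B x) (f x) + act (C x) (g x), h x⟫_ℝ = ⟪mulL2 hB f + mulL2 hC g, h⟫_ℝ := by
  rw [L2.inner_def]
  refine integral_congr_ae ?_
  filter_upwards [coeFn_mulL2 hB f, coeFn_mulL2 hC g,
    Lp.coeFn_add (mulL2 hB f) (mulL2 hC g)] with x h1 h2 h3
  rw [h3, Pi.add_apply, h1, h2]

theorem coeFn_chi {ω : Set Circ} (hω : IsOpen ω) (f : L2 R) :
    chi hω f =ᵐ[volume] ω.indicator f := MemLp.coeFn_toLp _

/-- Multiplication by the indicator function of `ω`, as an operator on `L²`. -/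
def chiL (R : ℕ) {ω : Set Circ} (hω : IsOpen ω) : L2 R →L[ℝ] L2 R :=
  LinearMap.mkContinuous
    { toFun := fun f => chi hω f
      map_add' := fun f g => by
        refine Lp.ext ?_
        filter_upwards [coeFn_chi hω f, coeFn_chi hω g, coeFn_chi hω (f + g), Lp.coeFn_add f g,
          Lp.coeFn_add (chi hω f) (chi hω g)] with x h1 h2 h3 h4 h5
        rw [h5, Pi.add_apply, h1, h2, h3]
        by_cases hx : x ∈ ω
        · simp only [indicator_of_mem hx, h4, Pi.add_apply]
        · simp only [indicator_of_notMem hx, add_zero]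
      map_smul' := fun c f => by
        refine Lp.ext ?_
        filter_upwards [coeFn_chi hω f, coeFn_chi hω (c • f), Lp.coeFn_smul c f,
          Lp.coeFn_smul c (chi hω f)] with x h1 h3 h4 h5
        rw [RingHom.id_apply, h5, Pi.smul_apply, h1, h3]
        by_cases hx : x ∈ ω
        · simp only [indicator_of_mem hx, h4, Pi.smul_apply]
        · simp only [indicator_of_notMem hx, smul_zero] } 1 fun f => by
    refine Lp.norm_le_mul_norm_of_ae_le_mul ?_
    filter_upwards [coeFn_chi hω f] with x h1
    change ‖(chi hω f) x‖ ≤ _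
    rw [h1, one_mul]
    exact norm_indicator_le_norm_self _ _

@[simp] theorem chiL_apply {ω : Set Circ} (hω : IsOpen ω) (f : L2 R) : chiL R hω f = chi hω f := rfl

theorem inner_chi_left {ω : Set Circ} (hω : IsOpen ω) (f g : L2 R) :
    ⟪chi hω f, g⟫_ℝ = ⟪f, chi hω g⟫_ℝ := by
  rw [L2.inner_def, L2.inner_def]
  refine integral_congr_ae ?_
  filter_upwards [coeFn_chi hω f, coeFn_chi hω g] with x h1 h2
  rw [h1, h2]
  by_cases hx : x ∈ ω <;> simp [hx]

theorem chi_toL2 {ω : Set Circ} (hω : IsOpen ω) {f : Circ → E R} (hf : Continuous f)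
    (h : ∀ x ∉ ω, f x = 0) : chi hω (toL2 hf) = toL2 hf := by
  refine Lp.ext ?_
  filter_upwards [coeFn_chi hω (toL2 hf), (memLp_of_continuous hf).coeFn_toLp] with x h1 h2
  rw [h1]
  by_cases hx : x ∈ ω
  · rw [indicator_of_mem hx]
  · rw [indicator_of_notMem hx, h2, h x hx]

end Operators

section Calculus

variable {F : Type*} [NormedAddCommGroup F] [NormedSpace ℝ F] [CompleteSpace F]

theorem hasDerivWithinAt_integral_Icc {g : ℝ → F} {a b : ℝ} (hg : ContinuousOn g (Icc a b)) {t : ℝ}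
    (ht : t ∈ Icc a b) :
    HasDerivWithinAt (fun s => ∫ r in a..s, g r) (g t) (Icc a b) t := by
  have hab : a ≤ b := ht.1.trans ht.2
  have hc : Continuous (IccExtend hab ((Icc a b).domRestrict g)) :=
    (continuousOn_iff_continuous_domRestrict.1 hg).Icc_extend'
  have he : ∀ r ∈ Icc a b, IccExtend hab ((Icc a b).domRestrict g) r = g r := fun r hr => by
    rw [IccExtend_of_mem hab _ hr]; rfl
  have h := (hc.integral_hasStrictDerivAt a t).hasDerivAt.hasDerivWithinAt (s := Icc a b)
  rw [he t ht] at h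
  have hs : ∀ s ∈ Icc a b, ∫ r in a..s, g r
      = ∫ r in a..s, IccExtend hab ((Icc a b).domRestrict g) r := by
    intro s hs
    refine intervalIntegral.integral_congr fun r hr => ?_
    rw [uIcc_of_le hs.1] at hr
    exact (he r ⟨hr.1, hr.2.trans hs.2⟩).symm
  exact h.congr hs (hs t ht)

theorem integral_eq_sub_of_hasDerivWithinAt_Icc {f g : ℝ → F} {a b : ℝ}
    (hg : ContinuousOn g (Icc a b))
    (h : ∀ t ∈ Icc a b, HasDerivWithinAt f (g t) (Icc a b) t) {s t : ℝ} (hs : s ∈ Icc a b)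
    (ht : t ∈ Icc a b) : ∫ r in s..t, g r = f t - f s := by
  have hsub : uIcc s t ⊆ Icc a b := by
    intro r hr
    exact ⟨(le_min hs.1 ht.1).trans hr.1, hr.2.trans (max_le hs.2 ht.2)⟩
  refine intervalIntegral.integral_eq_sub_of_hasDeriv_right
    (fun r hr => (h r (hsub hr)).continuousWithinAt.mono hsub) (fun r hr => ?_)
    ((hg.mono hsub).intervalIntegrable)
  have hr' : r ∈ Icc a b := hsub (Ioo_subset_Icc_self hr)
  have hlt : r < b := lt_of_lt_of_le hr.2 (max_le hs.2 ht.2)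
  exact ((h r hr').mono_of_mem_nhdsWithin
    (Filter.mem_of_superset (Ioo_mem_nhdsGT hlt) fun q hq => ⟨hr'.1.trans hq.1.le, hq.2.le⟩))

/-- Pointwise limits of functions whose derivatives converge uniformly on a compact interval. -/
theorem hasDerivWithinAt_Icc_of_tendsto {f g : ℕ → ℝ → F} {f' g' : ℝ → F} {a b : ℝ}
    (hf : ∀ n, ∀ t ∈ Icc a b, HasDerivWithinAt (f n) (g n t) (Icc a b) t)
    (hg : ∀ n, ContinuousOn (g n) (Icc a b))
    (hlim : ∀ t ∈ Icc a b, Filter.Tendsto (fun n => f n t) Filter.atTop (𝓝 (f' t)))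
    (hunif : TendstoUniformlyOn g g' Filter.atTop (Icc a b)) {t : ℝ} (ht : t ∈ Icc a b) :
    HasDerivWithinAt f' (g' t) (Icc a b) t := by
  have hc : ContinuousOn g' (Icc a b) := hunif.continuousOn (Filter.Frequently.of_forall hg)
  have ha : a ∈ Icc a b := ⟨le_rfl, ht.1.trans ht.2⟩
  have key : ∀ s ∈ Icc a b, f' s = f' a + ∫ r in a..s, g' r := by
    intro s hs
    have hsub : uIcc a s ⊆ Icc a b := by rw [uIcc_of_le hs.1]; exact Icc_subset_Icc_right hs.2
    have h1 : Filter.Tendsto (fun n => ∫ r in a..s, g n r) Filter.atTop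
        (𝓝 (∫ r in a..s, g' r)) := by
      rw [Metric.tendsto_atTop]
      intro ε hε
      obtain ⟨N, hN⟩ := Filter.eventually_atTop.1
        (Metric.tendstoUniformlyOn_iff.1 hunif (ε / (s - a + 1))
          (div_pos hε (by linarith [hs.1])))
      refine ⟨N, fun n hn => ?_⟩
      rw [dist_eq_norm, ← intervalIntegral.integral_sub ((hg n).mono hsub).intervalIntegrable
        (hc.mono hsub).intervalIntegrable]
      have h2 := intervalIntegral.norm_integral_le_of_norm_le_const (a := a) (b := s)
        (f := fun r => g n r - g' r) (C := ε / (s - a + 1)) fun r hr => by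
          have := hN n hn r (hsub (uIoc_subset_uIcc hr))
          rw [dist_comm, dist_eq_norm] at this
          exact this.le
      refine h2.trans_lt ?_
      have hsa : 0 ≤ s - a := sub_nonneg.2 hs.1
      rw [abs_of_nonneg hsa, div_mul_eq_mul_div, div_lt_iff₀ (by linarith)]
      nlinarith
    have h3 : Filter.Tendsto (fun n => f n a + ∫ r in a..s, g n r) Filter.atTop
        (𝓝 (f' a + ∫ r in a..s, g' r)) := (hlim a ha).add h1
    refine tendsto_nhds_unique ((hlim s hs).congr fun n => ?_) h3
    rw [integral_eq_sub_of_hasDerivWithinAt_Icc (hg n) (hf n) ha hs]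
    abel
  exact ((hasDerivWithinAt_integral_Icc hc ht).const_add (f' a)).congr key (key t ht)

end Calculus

/-! ### Averages in time of energy solutions -/

section Calculus

open Filter

/-- A derivative known on a convergent sequence of vectors passes to the limit vector, when the
derivative is a continuous functional. -/
theorem hasDerivWithinAt_clm_of_tendsto {X : Type*} [NormedAddCommGroup X] [NormedSpace ℝ X]
    {Ψ Λ : ℝ → X →L[ℝ] ℝ} {a b : ℝ} (hΛ : ContinuousOn Λ (Icc a b)) {θ : ℕ → X} {θ' : X}
    (hθ : Tendsto θ atTop (𝓝 θ'))
    (h : ∀ n, ∀ t ∈ Icc a b, HasDerivWithinAt (fun s => Ψ s (θ n)) (Λ t (θ n)) (Icc a b) t)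
    {t : ℝ} (ht : t ∈ Icc a b) : HasDerivWithinAt (fun s => Ψ s θ') (Λ t θ') (Icc a b) t := by
  refine hasDerivWithinAt_Icc_of_tendsto (f := fun n s => Ψ s (θ n)) (g := fun n t => Λ t (θ n))
    (g' := fun t => Λ t θ') h (fun n => hΛ.clm_apply continuousOn_const)
    (fun s _ => ((Ψ s).continuous.tendsto _).comp hθ) ?_ ht
  obtain ⟨K, hK⟩ := isCompact_Icc.exists_bound_of_continuousOn hΛ
  rw [Metric.tendstoUniformlyOn_iff]
  intro ε hε
  have hK0 : 0 ≤ K := (norm_nonneg _).trans (hK t ht)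
  filter_upwards [Metric.tendsto_nhds.1 hθ (ε / (K + 1)) (by positivity)] with n hn s hs
  rw [dist_comm, dist_eq_norm, ← map_sub]
  rw [dist_eq_norm, lt_div_iff₀ (by positivity)] at hn
  refine ((Λ s).le_of_opNorm_le (hK s hs) _).trans_lt ?_
  nlinarith [norm_nonneg (θ n - θ')]

/-- A product rule in which the functional `ψ` is only differentiable at the fixed vector `w t`. -/
theorem hasDerivWithinAt_clm_apply_of_continuousWithinAt {X : Type*} [NormedAddCommGroup X]
    [NormedSpace ℝ X] {ψ : ℝ → X →L[ℝ] ℝ} {w : ℝ → X} {w' : X} {d t : ℝ} {S : Set ℝ}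
    (hψ : ContinuousWithinAt ψ S t) (hw : HasDerivWithinAt w w' S t)
    (hψw : HasDerivWithinAt (fun s => ψ s (w t)) d S t) :
    HasDerivWithinAt (fun s => ψ s (w s)) (d + ψ t w') S t := by
  rw [hasDerivWithinAt_iff_tendsto_slope] at *
  have h1 : Tendsto (fun s => ψ s (slope w t s)) (𝓝[S \ {t}] t) (𝓝 (ψ t w')) :=
    ((isBoundedBilinearMap_apply (𝕜 := ℝ)).continuous.tendsto (ψ t, w')).comp
      (Tendsto.prodMk_nhds (Tendsto.mono_left hψ (nhdsWithin_mono _ sdiff_subset)) hw)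
  refine (hψw.add h1).congr fun s => ?_
  simp only [slope_def_module, map_smul, map_sub, smul_eq_mul]
  ring

variable {F : Type*} [NormedAddCommGroup F] [NormedSpace ℝ F] [CompleteSpace F]

/-- The average of `g` over `[t, t + h]`. -/
def avg (h : ℝ) (g : ℝ → F) (t : ℝ) : F := h⁻¹ • ∫ s in t..(t + h), g s

theorem intervalIntegrable_of_continuousOn_Icc {F : Type*} [NormedAddCommGroup F] {g : ℝ → F}
    {T a b : ℝ}
    (hg : ContinuousOn g (Icc 0 T)) (ha : a ∈ Icc 0 T) (hb : b ∈ Icc 0 T) :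
    IntervalIntegrable g volume a b :=
  (hg.mono fun _ hr => ⟨(le_min ha.1 hb.1).trans hr.1,
      hr.2.trans (max_le ha.2 hb.2)⟩).intervalIntegrable

theorem hasDerivWithinAt_avg {g : ℝ → F} {T h : ℝ} (hg : ContinuousOn g (Icc 0 T)) (hh : 0 < h)
    {t : ℝ} (ht : t ∈ Icc 0 (T - h)) :
    HasDerivWithinAt (avg h g) (h⁻¹ • (g (t + h) - g t)) (Icc 0 (T - h)) t := by
  have hm : MapsTo (fun s : ℝ => s + h) (Icc 0 (T - h)) (Icc 0 T) := fun s hs =>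
    ⟨by linarith [hs.1], by linarith [hs.2]⟩
  have hsub : Icc 0 (T - h) ⊆ Icc 0 T := Icc_subset_Icc_right (by linarith)
  have h1 := (hasDerivWithinAt_integral_Icc hg (hm ht)).scomp t
    ((hasDerivWithinAt_id t (Icc 0 (T - h))).add_const h) hm
  have h2 := (hasDerivWithinAt_integral_Icc hg (hsub ht)).mono hsub
  rw [one_smul] at h1
  refine ((h1.sub h2).const_smul h⁻¹).congr (fun s hs => ?_) ?_
  all_goals
    simp only [avg, Function.comp, Pi.smul_apply, Pi.sub_apply, id]
    rw [intervalIntegral.integral_interval_sub_left] <;>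
    exact intervalIntegrable_of_continuousOn_Icc hg (by grind) (by grind)

theorem continuousOn_avg {g : ℝ → F} {T h : ℝ} (hg : ContinuousOn g (Icc 0 T)) (hh : 0 < h) :
    ContinuousOn (avg h g) (Icc 0 (T - h)) :=
  fun _ ht => (hasDerivWithinAt_avg hg hh ht).continuousWithinAt

theorem map_avg {G : Type*} [NormedAddCommGroup G] [NormedSpace ℝ G] [CompleteSpace G]
    (L : F →L[ℝ] G) {g : ℝ → F} {T h : ℝ} (hg : ContinuousOn g (Icc 0 T)) (hh : 0 < h)
    {t : ℝ} (ht : t ∈ Icc 0 (T - h)) : L (avg h g t) = avg h (fun s => L (g s)) t := by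
  rw [avg, avg, map_smul, L.intervalIntegral_comp_comm]
  exact intervalIntegrable_of_continuousOn_Icc hg ⟨ht.1, by linarith [ht.2]⟩
    ⟨by linarith [ht.1], by linarith [ht.2]⟩

omit [CompleteSpace F] in
theorem avg_congr {f g : ℝ → F} {T h : ℝ} (hfg : ∀ s ∈ Icc 0 T, f s = g s) (hh : 0 < h)
    {t : ℝ} (ht : t ∈ Icc 0 (T - h)) : avg h f t = avg h g t := by
  rw [avg, avg, intervalIntegral.integral_congr]
  intro s hs
  rw [uIcc_of_le (by linarith)] at hs
  exact hfg s ⟨by linarith [ht.1, hs.1], by linarith [ht.2, hs.2]⟩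

omit [CompleteSpace F] in
theorem norm_avg_le {g : ℝ → F} {h t A : ℝ} (hh : 0 < h) (hA : ∀ s ∈ Icc t (t + h), ‖g s‖ ≤ A) :
    ‖avg h g t‖ ≤ A := by
  have h1 := intervalIntegral.norm_integral_le_of_norm_le_const (a := t) (b := t + h) (f := g)
    (C := A) fun s hs => hA s (by
      rw [uIoc_of_le (by linarith)] at hs
      exact Ioc_subset_Icc_self hs)
  rw [avg, norm_smul, Real.norm_of_nonneg (by positivity), inv_mul_le_iff₀ hh]
  rw [add_sub_cancel_left, abs_of_pos hh] at h1
  linarith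

theorem tendsto_avg {g : ℝ → F} {T : ℝ} (hg : ContinuousOn g (Icc 0 T)) {τ : ℝ → ℝ} {t : ℝ}
    (ht : t ∈ Icc 0 T) (hτ : ∀ᶠ h in 𝓝[>] 0, τ h ∈ Icc 0 (T - h))
    (hlim : Tendsto τ (𝓝[>] 0) (𝓝 t)) :
    Tendsto (fun h => avg h g (τ h)) (𝓝[>] 0) (𝓝 (g t)) := by
  rw [Metric.tendsto_nhds]
  intro ε hε
  obtain ⟨δ, hδ, hgδ⟩ := Metric.continuousOn_iff.1 hg t ht (ε / 2) (by positivity)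
  have h0 : ∀ᶠ h : ℝ in 𝓝[>] 0, h < δ / 2 :=
    (eventually_lt_nhds (by positivity : (0:ℝ) < δ / 2)).filter_mono nhdsWithin_le_nhds
  filter_upwards [hτ, h0, self_mem_nhdsWithin, Metric.tendsto_nhds.1 hlim (δ / 2) (by positivity)]
    with h h1 h2 h3 h4
  have h3 : 0 < h := h3
  rw [Real.dist_eq, abs_lt] at h4
  have hint := intervalIntegrable_of_continuousOn_Icc (a := τ h) (b := τ h + h) hg
    ⟨h1.1, by linarith [h1.2]⟩ ⟨by linarith [h1.1], by linarith [h1.2]⟩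
  have e : avg h g (τ h) - g t = avg h (fun s => g s - g t) (τ h) := by
    rw [avg, avg, intervalIntegral.integral_sub hint intervalIntegrable_const,
      intervalIntegral.integral_const, add_sub_cancel_left, smul_sub, smul_smul,
      inv_mul_cancel₀ h3.ne', one_smul]
  rw [dist_eq_norm, e]
  refine (norm_avg_le h3 (A := ε / 2) fun s hs => ?_).trans_lt (by linarith)
  rw [← dist_eq_norm]
  refine (hgδ s ⟨by linarith [h1.1, hs.1], by linarith [h1.2, hs.2]⟩ ?_).le
  rw [Real.dist_eq, abs_lt]
  constructor <;> linarith [hs.1, hs.2]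

end Calculus

section EnergySolutions

open Filter

variable {R : ℕ} {B C : Circ → Matrix (Fin R) (Fin R) ℝ}

/-- The functional on `H¹` that the equation prescribes as the value of `∂ₜ²w` when the state is
`w` and the forcing is `f`. -/
def weakForm (hB : SmoothMat B) (hC : SmoothMat C) (w : H1 R) (f : L2 R) : H1 R →L[ℝ] ℝ :=
  -((innerSL ℝ (derH w)).comp (derL R))
    - (innerSL ℝ (mulL2 hB (derH w) + mulL2 hC (valH w) + f)).comp (valL R)

theorem weakForm_apply (hB : SmoothMat B) (hC : SmoothMat C) (w : H1 R) (f : L2 R) (θ : H1 R) :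
    weakForm hB hC w f θ = -⟪derH w, derH θ⟫_ℝ
      - ⟪mulL2 hB (derH w) + mulL2 hC (valH w) + f, valH θ⟫_ℝ := rfl

theorem weakForm_eq (hB : SmoothMat B) (hC : SmoothMat C) (w : H1 R) (f : L2 R) (θ : H1 R) :
    weakForm hB hC w f θ = -⟪derH w, derH θ⟫_ℝ
      - (∫ x : Circ, ⟪act (B x) (derH w x) + act (C x) (valH w x), valH θ x⟫_ℝ)
      - ⟪f, valH θ⟫_ℝ := by
  rw [weakForm_apply, inner_mulL2_add hB hC, inner_add_left]
  ring

theorem weakForm_add_smul (hB : SmoothMat B) (hC : SmoothMat C) (c : ℝ) (w w' : H1 R)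
    (f f' : L2 R) (θ : H1 R) : weakForm hB hC (w + c • w') (f + c • f') θ
      = weakForm hB hC w f θ + c * weakForm hB hC w' f' θ := by
  have h1 : valH (w + c • w') = valH w + c • valH w' := rfl
  have h2 : derH (w + c • w') = derH w + c • derH w' := rfl
  simp only [weakForm_apply, h1, h2, map_add, map_smul, inner_add_left, real_inner_smul_left]
  ring

theorem continuousOn_valH {w : ℝ → H1 R} {s : Set ℝ} (hw : ContinuousOn w s) :
    ContinuousOn (fun t => valH (w t)) s := (valL R).continuous.comp_continuousOn hw

theorem continuousOn_derH {w : ℝ → H1 R} {s : Set ℝ} (hw : ContinuousOn w s) :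
    ContinuousOn (fun t => derH (w t)) s := (derL R).continuous.comp_continuousOn hw

theorem continuousOn_weakForm (hB : SmoothMat B) (hC : SmoothMat C) {w : ℝ → H1 R} {f : ℝ → L2 R}
    {s : Set ℝ} (hw : ContinuousOn w s) (hf : ContinuousOn f s) :
    ContinuousOn (fun t => weakForm hB hC (w t) (f t)) s := by
  have h1 := continuousOn_valH hw
  have h2 := continuousOn_derH hw
  refine ContinuousOn.sub (ContinuousOn.neg (ContinuousOn.clm_comp ?_ continuousOn_const))
    (ContinuousOn.clm_comp ?_ continuousOn_const)
  · exact (innerSL ℝ).continuous.comp_continuousOn h2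
  · exact (innerSL ℝ).continuous.comp_continuousOn
      ((((mulL2 hB).continuous.comp_continuousOn h2).add
        ((mulL2 hC).continuous.comp_continuousOn h1)).add hf)

theorem IsEnergySolution.hasDerivWithinAt {T : ℝ} {f : ℝ → L2 R} {w : ℝ → H1 R} {p : ℝ → L2 R}
    (hs : IsEnergySolution B C T f w p) (hB : SmoothMat B) (hC : SmoothMat C) (θ : H1 R)
    {t : ℝ} (ht : t ∈ Icc 0 T) : HasDerivWithinAt (fun s => ⟪p s, valH θ⟫_ℝ)
      (weakForm hB hC (w t) (f t) θ) (Icc 0 T) t := by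
  rw [weakForm_eq]
  exact hs.equation θ t ht

/-- It suffices to test the equation against smooth functions. -/
theorem isEnergySolution_of_smooth (hB : SmoothMat B) (hC : SmoothMat C) {T : ℝ} {f : ℝ → L2 R}
    {w : ℝ → H1 R} {p : ℝ → L2 R} (hf : ContinuousOn f (Icc 0 T)) (hw : ContinuousOn w (Icc 0 T))
    (hp : ContinuousOn p (Icc 0 T))
    (hd : ∀ t ∈ Icc 0 T, HasDerivWithinAt (fun s => valH (w s)) (p t) (Icc 0 T) t)
    (he : ∀ (θ : Circ → E R) (hθ : Smooth θ), ∀ t ∈ Icc 0 T,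
      HasDerivWithinAt (fun s => ⟪p s, toL2 hθ.continuous⟫_ℝ)
        (weakForm hB hC (w t) (f t) (ofSmooth θ hθ)) (Icc 0 T) t) :
    IsEnergySolution B C T f w p where
  continuousOn_fst := hw
  continuousOn_snd := hp
  hasDeriv := hd
  equation θ t ht := by
    rw [← weakForm_eq hB hC]
    choose g hg hlt using fun n : ℕ => exists_smooth_approx_H1 θ (Nat.one_div_pos_of_nat (n := n))
    refine hasDerivWithinAt_clm_of_tendsto (Ψ := fun s => (innerSL ℝ (p s)).comp (valL R))
      (θ := fun n => ofSmooth (g n) (hg n)) (continuousOn_weakForm hB hC hw hf) ?_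
      (fun n t ht => he (g n) (hg n) t ht) ht
    rw [tendsto_iff_norm_sub_tendsto_zero]
    refine squeeze_zero (fun n => norm_nonneg _) (fun n => ?_)
        tendsto_one_div_add_atTop_nhds_zero_nat
    rw [norm_sub_rev]
    exact (hlt n).le

theorem IsEnergySolution.add_smul (hB : SmoothMat B) (hC : SmoothMat C) {T : ℝ} {f f' : ℝ → L2 R}
    {w w' : ℝ → H1 R} {p p' : ℝ → L2 R} (h : IsEnergySolution B C T f w p)
    (h' : IsEnergySolution B C T f' w' p') (c : ℝ) :
    IsEnergySolution B C T (fun t => f t + c • f' t) (fun t => w t + c • w' t)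
      (fun t => p t + c • p' t) where
  continuousOn_fst := h.continuousOn_fst.add (h'.continuousOn_fst.const_smul c)
  continuousOn_snd := h.continuousOn_snd.add (h'.continuousOn_snd.const_smul c)
  hasDeriv t ht := (h.hasDeriv t ht).add ((h'.hasDeriv t ht).const_smul c)
  equation θ t ht := by
    rw [← weakForm_eq hB hC, weakForm_add_smul]
    have h1 := (h.hasDerivWithinAt hB hC θ ht).add ((h'.hasDerivWithinAt hB hC θ ht).const_mul c)
    refine h1.congr_of_eventuallyEq (Filter.Eventually.of_forall fun s => ?_) ?_ <;>
      simp only [inner_add_left, real_inner_smul_left, Pi.add_apply]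

/-- Averages in time of an energy solution are more regular: the average is `C¹` in time with
values in `H¹`, its derivative is `C¹` in time with values in `L²`, and they solve the averaged
equation. -/
theorem IsEnergySolution.average (hB : SmoothMat B) (hC : SmoothMat C) {T : ℝ} {f : ℝ → L2 R}
    {w : ℝ → H1 R} {p : ℝ → L2 R} (hs : IsEnergySolution B C T f w p)
    (hf : ContinuousOn f (Icc 0 T)) {h : ℝ} (hh : 0 < h) {t : ℝ} (ht : t ∈ Icc 0 (T - h)) :
    HasDerivWithinAt (avg h w) (h⁻¹ • (w (t + h) - w t)) (Icc 0 (T - h)) t ∧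
    valH (h⁻¹ • (w (t + h) - w t)) = avg h p t ∧
    HasDerivWithinAt (avg h p) (h⁻¹ • (p (t + h) - p t)) (Icc 0 (T - h)) t ∧
    ∀ θ : H1 R, ⟪h⁻¹ • (p (t + h) - p t), valH θ⟫_ℝ = weakForm hB hC (avg h w t) (avg h f t) θ := by
  have ht1 : t ∈ Icc 0 T := ⟨ht.1, by linarith [ht.2]⟩
  have ht2 : t + h ∈ Icc 0 T := ⟨by linarith [ht.1], by linarith [ht.2]⟩
  refine ⟨hasDerivWithinAt_avg hs.continuousOn_fst hh ht, ?_,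
    hasDerivWithinAt_avg hs.continuousOn_snd hh ht, fun θ => ?_⟩
  · rw [avg, integral_eq_sub_of_hasDerivWithinAt_Icc hs.continuousOn_snd hs.hasDeriv ht1 ht2]
    rfl
  · have hwf := continuousOn_weakForm hB hC hs.continuousOn_fst hf
    have h1 := integral_eq_sub_of_hasDerivWithinAt_Icc (hwf.clm_apply continuousOn_const)
      (fun r hr => hs.hasDerivWithinAt hB hC θ hr) ht1 ht2
    have e1 : valH (avg h w t) = avg h (fun s => valH (w s)) t :=
      map_avg (valL R) hs.continuousOn_fst hh ht
    have e2 : derH (avg h w t) = avg h (fun s => derH (w s)) t :=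
      map_avg (derL R) hs.continuousOn_fst hh ht
    have hv := continuousOn_valH hs.continuousOn_fst
    have hd := continuousOn_derH hs.continuousOn_fst
    have e3 : mulL2 hB (derH (avg h w t)) + mulL2 hC (valH (avg h w t)) + avg h f t
        = avg h (fun s => mulL2 hB (derH (w s)) + mulL2 hC (valH (w s)) + f s) t := by
      rw [e1, e2, map_avg (mulL2 hB) hd hh ht, map_avg (mulL2 hC) hv hh ht, avg, avg, avg, avg,
        ← smul_add, ← smul_add, ← intervalIntegral.integral_add, ← intervalIntegral.integral_add]
      · exact intervalIntegrable_of_continuousOn_Icc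
          (((mulL2 hB).continuous.comp_continuousOn hd).add
            ((mulL2 hC).continuous.comp_continuousOn hv)) ht1 ht2
      · exact intervalIntegrable_of_continuousOn_Icc hf ht1 ht2
      · exact intervalIntegrable_of_continuousOn_Icc
          ((mulL2 hB).continuous.comp_continuousOn hd) ht1 ht2
      · exact intervalIntegrable_of_continuousOn_Icc
          ((mulL2 hC).continuous.comp_continuousOn hv) ht1 ht2
    have hM : ContinuousOn (fun s => mulL2 hB (derH (w s)) + mulL2 hC (valH (w s)) + f s)
        (Icc 0 T) := (((mulL2 hB).continuous.comp_continuousOn hd).add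
            ((mulL2 hC).continuous.comp_continuousOn hv)).add hf
    have e4 : ∀ (g : ℝ → L2 R), ContinuousOn g (Icc 0 T) → ∀ u : L2 R,
        ⟪avg h g t, u⟫_ℝ = avg h (fun s => ⟪g s, u⟫_ℝ) t := fun g hg u => by
      rw [real_inner_comm]
      refine (map_avg (innerSL ℝ u) hg hh ht).trans (avg_congr (fun s _ => ?_) hh ht)
      exact real_inner_comm (g s) u
    rw [real_inner_smul_left, inner_sub_left, ← h1, weakForm_apply, e3, e2, e4 _ hd, e4 _ hM]
    simp only [weakForm_apply, avg, smul_eq_mul]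
    rw [intervalIntegral.integral_sub, intervalIntegral.integral_neg]
    · ring
    · exact (intervalIntegrable_of_continuousOn_Icc (hd.inner continuousOn_const) ht1 ht2).neg
    · exact intervalIntegrable_of_continuousOn_Icc (hM.inner continuousOn_const) ht1 ht2

end EnergySolutions

/-! ### Uniqueness and duality -/

section Uniqueness

open Filter

variable {R : ℕ} {B C : Circ → Matrix (Fin R) (Fin R) ℝ}

theorem hasDerivWithinAt_Ici_of_Icc {F : Type*} [NormedAddCommGroup F] [NormedSpace ℝ F]
    {f : ℝ → F} {f' : F} {a b t : ℝ} (h : HasDerivWithinAt f f' (Icc a b) t) (ht : t ∈ Ico a b) :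
    HasDerivWithinAt f f' (Ici t) t :=
  h.mono_of_mem_nhdsWithin (mem_of_superset (Icc_mem_nhdsGE ht.2) (Icc_subset_Icc_left ht.1))

/-- The energy estimate for the averages of a solution of the unforced equation. -/
theorem IsEnergySolution.average_energy_le (hB : SmoothMat B) (hC : SmoothMat C) :
    ∃ K : ℝ, ∀ {T : ℝ} {w : ℝ → H1 R} {p : ℝ → L2 R},
      IsEnergySolution B C T (fun _ => 0) w p → ∀ {h : ℝ}, 0 < h → ∀ t ∈ Icc 0 (T - h),
        ‖avg h p t‖ ^ 2 + ‖avg h w t‖ ^ 2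
          ≤ (‖avg h p 0‖ ^ 2 + ‖avg h w 0‖ ^ 2) * Real.exp (K * t) := by
  -- the derivative of the energy is `2 ⟪w_t, M w⟫`, as the pairing of `w_x` with `w_tx` cancels
  let M : H1 R →L[ℝ] L2 R := valL R - (mulL2 hB).comp (derL R) - (mulL2 hC).comp (valL R)
  refine ⟨‖M‖, fun {T w p} hs {h} hh t ht => ?_⟩
  have hwc := continuousOn_avg hs.continuousOn_fst hh
  have hpc := continuousOn_avg hs.continuousOn_snd hh
  let e : ℝ → ℝ := fun t => ‖avg h p t‖ ^ 2 + ‖avg h w t‖ ^ 2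
  have hder : ∀ s ∈ Icc 0 (T - h), HasDerivWithinAt e (2 * ⟪avg h p s, M (avg h w s)⟫_ℝ)
      (Icc 0 (T - h)) s := by
    intro s hs'
    obtain ⟨h1, h2, h3, h4⟩ := hs.average hB hC continuousOn_const hh hs'
    refine (h3.norm_sq.add h1.norm_sq).congr_deriv ?_
    have h5 := h4 (h⁻¹ • (w (s + h) - w s))
    have h6 : avg h (fun _ : ℝ => (0 : L2 R)) s = 0 := by simp [avg]
    rw [weakForm_apply, h6, add_zero, h2] at h5
    rw [inner_H1, h2, real_inner_comm, h5]
    simp only [M, sub_apply, ContinuousLinearMap.comp_apply, valL_apply,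
      derL_apply, inner_sub_right, inner_add_left]
    rw [real_inner_comm (avg h p s) (valH (avg h w s)),
      real_inner_comm (avg h p s) (mulL2 hB _), real_inner_comm (avg h p s) (mulL2 hC _)]
    ring
  have hle := norm_le_gronwallBound_of_norm_deriv_right_le (f := e)
    (f' := fun s => 2 * ⟪avg h p s, M (avg h w s)⟫_ℝ) (δ := e 0) (K := ‖M‖) (ε := 0) (a := 0)
    (b := T - h) (fun s hs' => (hder s hs').continuousWithinAt)
    (fun s hs' => hasDerivWithinAt_Ici_of_Icc (hder s (Ico_subset_Icc_self hs')) hs')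
    (by rw [Real.norm_of_nonneg (by positivity)]) (fun s _ => by
      have he : 0 ≤ e s := by positivity
      rw [Real.norm_of_nonneg he, add_zero, norm_mul, Real.norm_of_nonneg zero_le_two]
      have h1 := norm_inner_le_norm (𝕜 := ℝ) (avg h p s) (M (avg h w s))
      have h2 := M.le_opNorm (avg h w s)
      have h3 : 2 * (‖avg h p s‖ * ‖avg h w s‖) ≤ e s := by
        nlinarith [sq_nonneg (‖avg h p s‖ - ‖avg h w s‖)]
      calc 2 * ‖⟪avg h p s, M (avg h w s)⟫_ℝ‖ ≤ 2 * (‖avg h p s‖ * (‖M‖ * ‖avg h w s‖)) := by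
            have := mul_le_mul_of_nonneg_left h2 (norm_nonneg (avg h p s))
            linarith
        _ = ‖M‖ * (2 * (‖avg h p s‖ * ‖avg h w s‖)) := by ring
        _ ≤ ‖M‖ * e s := mul_le_mul_of_nonneg_left h3 M.opNorm_nonneg) t ht
  rw [gronwallBound_ε0, sub_zero, Real.norm_of_nonneg (by positivity)] at hle
  exact hle

/-- The energy estimate for the averages passes to the limit of vanishing averaging length. Near the
final time `T` the average over `[t, t + h]` is not defined by the solution, whence the evaluation
at `min t (T - h)`. -/
theorem IsEnergySolution.eq_zero (hB : SmoothMat B) (hC : SmoothMat C) {T : ℝ} (hT : 0 < T)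
    {w : ℝ → H1 R} {p : ℝ → L2 R} (hs : IsEnergySolution B C T (fun _ => 0) w p) (hw : w 0 = 0)
    (hp : p 0 = 0) {t : ℝ} (ht : t ∈ Icc 0 T) : w t = 0 ∧ p t = 0 := by
  obtain ⟨K, hK⟩ := IsEnergySolution.average_energy_le hB hC
  let τ : ℝ → ℝ := fun h => min t (T - h)
  have hsmall : ∀ᶠ h : ℝ in 𝓝[>] 0, 0 < h ∧ h < T := by
    filter_upwards [self_mem_nhdsWithin,
      (eventually_lt_nhds hT).filter_mono nhdsWithin_le_nhds] with h h1 h2 using ⟨h1, h2⟩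
  have hτ : ∀ᶠ h in 𝓝[>] 0, τ h ∈ Icc 0 (T - h) := by
    filter_upwards [hsmall] with h h1
    exact ⟨le_min ht.1 (by linarith), min_le_right _ _⟩
  have hlim : Tendsto τ (𝓝[>] 0) (𝓝 t) := by
    have hc : Continuous τ := by fun_prop
    have := (hc.tendsto 0).mono_left (nhdsWithin_le_nhds (s := Ioi 0))
    simpa [τ, ht.2] using this
  have h0 : ∀ᶠ h : ℝ in 𝓝[>] 0, (0 : ℝ) ∈ Icc 0 (T - h) := by
    filter_upwards [hsmall] with h h1
    exact ⟨le_rfl, by linarith⟩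
  have ht0 : (0 : ℝ) ∈ Icc 0 T := ⟨le_rfl, hT.le⟩
  have a1 := tendsto_avg hs.continuousOn_snd ht hτ hlim
  have a2 := tendsto_avg hs.continuousOn_fst ht hτ hlim
  have b1 := tendsto_avg hs.continuousOn_snd ht0 h0 tendsto_const_nhds
  have b2 := tendsto_avg hs.continuousOn_fst ht0 h0 tendsto_const_nhds
  have c1 := (a1.norm.pow 2).add (a2.norm.pow 2)
  have c2 := ((b1.norm.pow 2).add (b2.norm.pow 2)).mul ((hlim.const_mul K).rexp)
  have hle := le_of_tendsto_of_tendsto c1 c2 (by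
    filter_upwards [hsmall, hτ] with h h1 h2
    exact hK hs h1.1 _ h2)
  rw [hw, hp] at hle
  simp only [norm_zero, ne_eq, OfNat.ofNat_ne_zero, not_false_eq_true, zero_pow, add_zero,
    zero_mul] at hle
  constructor
  · exact norm_eq_zero.1 (pow_eq_zero_iff two_ne_zero |>.1
      (le_antisymm (by nlinarith [sq_nonneg ‖p t‖]) (sq_nonneg _)))
  · exact norm_eq_zero.1 (pow_eq_zero_iff two_ne_zero |>.1
      (le_antisymm (by nlinarith [sq_nonneg ‖w t‖]) (sq_nonneg _)))

/-- Energy solutions are determined by their forcing and their initial data. -/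
theorem IsEnergySolution.unique (hB : SmoothMat B) (hC : SmoothMat C) {T : ℝ} (hT : 0 < T)
    {f : ℝ → L2 R} {w w' : ℝ → H1 R} {p p' : ℝ → L2 R} (h : IsEnergySolution B C T f w p)
    (h' : IsEnergySolution B C T f w' p') (hw : w' 0 = w 0) (hp : p' 0 = p 0) {t : ℝ}
    (ht : t ∈ Icc 0 T) : w' t = w t ∧ p' t = p t := by
  have hd := h'.add_smul hB hC h (-1)
  simp only [neg_smul, one_smul, ← sub_eq_add_neg, sub_self] at hd
  obtain ⟨h1, h2⟩ := hd.eq_zero hB hC hT (sub_eq_zero.2 hw) (sub_eq_zero.2 hp) ht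
  exact ⟨sub_eq_zero.1 h1, sub_eq_zero.1 h2⟩

end Uniqueness

section Duality

open Filter

variable {R : ℕ} {b c : Circ → Matrix (Fin R) (Fin R) ℝ}

theorem hasDerivWithinAt_eval {X : Type*} [NormedAddCommGroup X] [NormedSpace ℝ X]
    {Ψ : ℝ → X →L[ℝ] ℝ} {Ψ' : X →L[ℝ] ℝ} {S : Set ℝ} {t : ℝ} (h : HasDerivWithinAt Ψ Ψ' S t)
    (x : X) : HasDerivWithinAt (fun s => Ψ s x) (Ψ' x) S t := by
  have h1 := h.clm_apply (hasDerivWithinAt_const t S x)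
  rwa [map_zero, add_zero] at h1

/-- The equation satisfied by a weak solution, tested against a function `θ` of `H²` with
derivative `k ∈ H¹`. -/
theorem IsWeakSolution.hasDerivWithinAt (hb : SmoothMat b) (hc : SmoothMat c) {T : ℝ}
    {φ : ℝ → L2 R} {ψ : ℝ → HNeg1 R} (hφ : IsWeakSolution b c T φ ψ) {θ k : H1 R}
    (hθk : derH θ = valH k) {t : ℝ} (ht : t ∈ Icc 0 T) :
    HasDerivWithinAt (fun s => ψ s θ)
      ⟪φ t, derH k - (mulL2 hb.transpose (derH θ)
        + mulL2 (hb.transpose.dx.sub hc.transpose) (valH θ))⟫_ℝ (Icc 0 T) t := by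
  let L : H1 R × H1 R →L[ℝ] L2 R :=
    (derL R).comp (ContinuousLinearMap.snd ℝ _ _) -
      ((mulL2 hb.transpose).comp (derL R)
        + (mulL2 (hb.transpose.dx.sub hc.transpose)).comp (valL R)).comp
          (ContinuousLinearMap.fst ℝ _ _)
  choose g hg hlt hlt' using fun n : ℕ =>
    exists_smooth_approx_H2 hθk (Nat.one_div_pos_of_nat (α := ℝ) (n := n))
  refine hasDerivWithinAt_clm_of_tendsto
    (Ψ := fun s => (ψ s).comp (ContinuousLinearMap.fst ℝ (H1 R) (H1 R)))
    (Λ := fun s => (innerSL ℝ (φ s)).comp L)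
    (θ := fun n => (ofSmooth (g n) (hg n), ofSmooth (dx (g n)) (hg n).dx)) (θ' := (θ, k))
    (((innerSL ℝ).continuous.comp_continuousOn hφ.continuousOn_fst).clm_comp continuousOn_const)
    ?_ (fun n t ht => ?_) ht
  · refine Tendsto.prodMk_nhds ?_ ?_ <;> rw [tendsto_iff_norm_sub_tendsto_zero] <;>
      refine squeeze_zero (fun n => norm_nonneg _) (fun n => ?_)
        tendsto_one_div_add_atTop_nhds_zero_nat <;> rw [norm_sub_rev]
    exacts [(hlt n).le, (hlt' n).le]
  · refine (hφ.equation (g n) (hg n) t ht).congr_deriv ?_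
    have hbg := Smooth.act hb.transpose (hg n)
    have hcg := Smooth.act hc.transpose (hg n)
    have e : L (ofSmooth (g n) (hg n), ofSmooth (dx (g n)) (hg n).dx)
        = toL2 (((hg n).dx.dx.sub hbg.dx).add hcg).continuous := by
      change toL2 (hg n).dx.dx.continuous - (mulL2 hb.transpose (toL2 (hg n).dx.continuous)
        + mulL2 (hb.transpose.dx.sub hc.transpose) (toL2 (hg n).continuous)) = _
      rw [mulL2_toL2, mulL2_toL2, ← toL2_add]
      refine Eq.trans (MemLp.toLp_sub _ _).symm (toL2_congr ((hg n).dx.dx.continuous.sub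
        ((continuous_act hb.transpose (hg n).dx.continuous).add
          (continuous_act (hb.transpose.dx.sub hc.transpose) (hg n).continuous))) _ ?_)
      funext x
      have e1 := congrFun (dx_act hb.transpose (hg n)) x
      have e2 : act (dxMat (fun x => (b x).transpose) x - (c x).transpose) (g n x)
          = act (dxMat (fun x => (b x).transpose) x) (g n x) - act (c x).transpose (g n x) := by
        simp only [act, Matrix.sub_mulVec]
        rfl
      simp only [Pi.sub_apply, Pi.add_apply]
      rw [e1, e2]
      abel
    rw [ContinuousLinearMap.comp_apply, e, innerSL_apply_apply, inner_toL2]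

theorem IsWeakSolution.hasDerivWithinAt_inner {T : ℝ} {φ : ℝ → L2 R} {ψ : ℝ → HNeg1 R}
    (hφ : IsWeakSolution b c T φ ψ) (θ : H1 R) {t : ℝ} (ht : t ∈ Icc 0 T) :
    HasDerivWithinAt (fun s => ⟪φ s, valH θ⟫_ℝ) (ψ t θ) (Icc 0 T) t :=
  hasDerivWithinAt_eval (hφ.hasDeriv t ht) θ

/-- The duality between the adjoint equation and the control problem. -/
theorem IsWeakSolution.abs_pairing_le (hb : SmoothMat b) (hc : SmoothMat c) {T : ℝ} (hT : 0 < T)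
    {φ : ℝ → L2 R} {ψ : ℝ → HNeg1 R} (hφ : IsWeakSolution b c T φ ψ) {ω : Set Circ}
    (hω : IsOpen ω) {α : ℝ → L2 R} (hα : ContinuousOn α (Icc 0 T)) {A : ℝ}
    (hA : ∀ t ∈ Icc 0 T, ‖α t‖ ≤ A) {w : ℝ → H1 R} {p : ℝ → L2 R}
    (hs : IsEnergySolution (fun x => (b x).transpose)
      (fun x => dxMat (fun x => (b x).transpose) x - (c x).transpose) T
      (fun t => chi hω (α t)) w p) (hw : w T = 0) (hp : p T = 0) :
    |ψ 0 (w 0) - ⟪φ 0, p 0⟫_ℝ| ≤ A * ∫ t in (0)..T, ‖chi hω (φ t)‖ := by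
  have hB := hb.transpose
  have hC := hb.transpose.dx.sub hc.transpose
  have hf : ContinuousOn (fun t => chi hω (α t)) (Icc 0 T) :=
    (chiL R hω).continuous.comp_continuousOn hα
  have hχφ : ContinuousOn (fun t => chi hω (φ t)) (Icc 0 T) :=
    (chiL R hω).continuous.comp_continuousOn hφ.continuousOn_fst
  have hT0 : (0 : ℝ) ∈ Icc 0 T := ⟨le_rfl, hT.le⟩
  have hTT : T ∈ Icc 0 T := ⟨hT.le, le_rfl⟩
  have hA0 : 0 ≤ A := (norm_nonneg _).trans (hA 0 hT0)
  -- the terms without forcing cancel in the derivative of this pairing, the two equations being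
  -- adjoint to each other
  let G : ℝ → ℝ → ℝ := fun h t => ψ t (avg h w t) - ⟪φ t, avg h p t⟫_ℝ
  have hder : ∀ h, 0 < h → ∀ t ∈ Icc 0 (T - h), HasDerivWithinAt (G h)
      ⟪φ t, avg h (fun t => chi hω (α t)) t⟫_ℝ (Icc 0 (T - h)) t := by
    intro h hh t ht
    have hsub : Icc 0 (T - h) ⊆ Icc 0 T := Icc_subset_Icc_right (by linarith)
    obtain ⟨h1, h2, h3, h4⟩ := hs.average hB hC hf hh ht
    -- the averaged equation shows that the average of `w` lies in `H²`, so that it may test `φ`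
    let k : H1 R := mkH1 (derH (avg h w t)) (h⁻¹ • (p (t + h) - p t)
        + (mulL2 hB (derH (avg h w t)) + mulL2 hC (valH (avg h w t))
          + avg h (fun t => chi hω (α t)) t)) fun θ hθ => by
      have h5 := h4 (ofSmooth θ hθ)
      rw [weakForm_apply, valH_ofSmooth, derH_ofSmooth] at h5
      rw [inner_add_left, h5]
      ring
    have d1 := hasDerivWithinAt_clm_apply_of_continuousWithinAt
      ((hφ.continuousOn_snd t (hsub ht)).mono hsub) h1
      ((hφ.hasDerivWithinAt hb hc (θ := avg h w t) (k := k) rfl (hsub ht)).mono hsub)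
    have d3 := (hφ.hasDerivWithinAt_inner (h⁻¹ • (w (t + h) - w t)) (hsub ht)).mono hsub
    rw [h2] at d3
    have d2 := hasDerivWithinAt_clm_apply_of_continuousWithinAt (ψ := fun s => innerSL ℝ (φ s))
      (((innerSL ℝ).continuous.comp_continuousOn hφ.continuousOn_fst t (hsub ht)).mono hsub) h3
      (d := ψ t (h⁻¹ • (w (t + h) - w t))) d3
    refine (d1.sub d2).congr_deriv ?_
    simp only [k, derH_mkH1, innerSL_apply_apply, inner_sub_right, inner_add_right]
    ring
  have hbound : ∀ h, 0 < h → h < T → |G h (T - h) - G h 0| ≤ A * ∫ t in (0)..T, ‖chi hω (φ t)‖ := by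
    intro h hh hhT
    have hsub : Icc 0 (T - h) ⊆ Icc 0 T := Icc_subset_Icc_right (by linarith)
    have hfc := continuousOn_avg hf hh
    have hg : ContinuousOn (fun t => ⟪φ t, avg h (fun t => chi hω (α t)) t⟫_ℝ) (Icc 0 (T - h)) :=
      (hφ.continuousOn_fst.mono hsub).inner hfc
    have h0h : 0 ≤ T - h := by linarith
    rw [← integral_eq_sub_of_hasDerivWithinAt_Icc hg (hder h hh) ⟨le_rfl, h0h⟩ ⟨h0h, le_rfl⟩]
    have hint := intervalIntegrable_of_continuousOn_Icc hχφ.norm hT0 hTT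
    calc |∫ t in (0)..(T - h), ⟪φ t, avg h (fun t => chi hω (α t)) t⟫_ℝ|
        ≤ ∫ t in (0)..(T - h), A * ‖chi hω (φ t)‖ := by
          rw [← Real.norm_eq_abs]
          refine intervalIntegral.norm_integral_le_of_norm_le h0h ?_ ?_
          · refine ae_of_all _ fun t ht => ?_
            have ht' := Ioc_subset_Icc_self ht
            have e : avg h (fun t => chi hω (α t)) t = chi hω (avg h α t) :=
              (map_avg (chiL R hω) hα hh ht').symm
            rw [e, ← inner_chi_left, mul_comm A]
            refine (norm_inner_le_norm _ _).trans (mul_le_mul_of_nonneg_left ?_ (norm_nonneg _))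
            exact norm_avg_le hh fun s hs => hA s
              ⟨by linarith [ht'.1, hs.1], by linarith [ht'.2, hs.2]⟩
          · exact intervalIntegrable_of_continuousOn_Icc (hχφ.norm.const_smul A) hT0
              (hsub ⟨h0h, le_rfl⟩)
      _ = A * ∫ t in (0)..(T - h), ‖chi hω (φ t)‖ := intervalIntegral.integral_const_mul _ _
      _ ≤ A * ∫ t in (0)..T, ‖chi hω (φ t)‖ := by
          refine mul_le_mul_of_nonneg_left ?_ hA0
          refine intervalIntegral.integral_mono_interval le_rfl h0h (by linarith)
            (ae_of_all _ fun _ => norm_nonneg _) hint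
  have hsmall : ∀ᶠ h : ℝ in 𝓝[>] 0, 0 < h ∧ h < T := by
    filter_upwards [self_mem_nhdsWithin,
      (eventually_lt_nhds hT).filter_mono nhdsWithin_le_nhds] with h h1 h2 using ⟨h1, h2⟩
  have hlim : ∀ (τ : ℝ → ℝ) (t : ℝ), t ∈ Icc 0 T → (∀ᶠ h in 𝓝[>] 0, τ h ∈ Icc 0 (T - h)) →
      Tendsto τ (𝓝[>] 0) (𝓝 t) →
      Tendsto (fun h => G h (τ h)) (𝓝[>] 0) (𝓝 (ψ t (w t) - ⟪φ t, p t⟫_ℝ)) := by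
    intro τ t ht hτ hl
    have hl' : Tendsto τ (𝓝[>] 0) (𝓝[Icc 0 T] t) := by
      refine tendsto_nhdsWithin_iff.2 ⟨hl, ?_⟩
      filter_upwards [hτ, hsmall] with h h1 h2
      exact ⟨h1.1, by linarith [h1.2]⟩
    refine Tendsto.sub ?_ ?_
    · exact ((isBoundedBilinearMap_apply (𝕜 := ℝ)).continuous.tendsto (ψ t, w t)).comp
        (Tendsto.prodMk_nhds ((hφ.continuousOn_snd t ht).tendsto.comp hl')
          (tendsto_avg hs.continuousOn_fst ht hτ hl))
    · exact ((hφ.continuousOn_fst t ht).tendsto.comp hl').inner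
        (tendsto_avg hs.continuousOn_snd ht hτ hl)
  have l0 := hlim (fun _ => 0) 0 hT0 (by
    filter_upwards [hsmall] with h h1
    exact ⟨le_rfl, by linarith⟩) tendsto_const_nhds
  have l1 := hlim (fun h => T - h) T hTT (by
    filter_upwards [hsmall] with h h1
    exact ⟨by linarith, le_rfl⟩) (by
    have hc : Continuous fun h : ℝ => T - h := by fun_prop
    have := (hc.tendsto 0).mono_left (nhdsWithin_le_nhds (s := Ioi 0))
    simpa using this)
  have hle := le_of_tendsto (l1.sub l0).abs (by
    filter_upwards [hsmall] with h h1
    exact hbound h h1.1 h1.2)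
  rwa [hw, hp, map_zero, inner_zero_right, sub_zero, zero_sub, abs_neg] at hle

end Duality

/-! ### The cutoff, and pairings of transported functions -/

section Cutoff

/-- `ζ` is a cutoff on `[0, 4π]`, with derivatives `ζ₁` and `ζ₂`, whose translates by `2π` form a
partition of unity and which is locally constant, modulo `2π`, outside `(0, ε)`. -/
structure FoldCutoff (ε : ℝ) (ζ ζ₁ ζ₂ : ℝ → ℝ) : Prop where
  cont₂ : Continuous ζ₂
  deriv₀ : ∀ y, HasDerivAt ζ (ζ₁ y) y
  deriv₁ : ∀ y, HasDerivAt ζ₁ (ζ₂ y) y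
  zero_off : ∀ y, y ∉ Ioo 0 (4 * Real.pi) → ζ y = 0 ∧ ζ₁ y = 0 ∧ ζ₂ y = 0
  partition : ∀ y ∈ Icc 0 (2 * Real.pi), ζ y + ζ (y + 2 * Real.pi) = 1
  locally_const : ∀ y ∈ Icc 0 (2 * Real.pi), y ∉ Ioo 0 ε → ζ₁ y = 0 ∧ ζ₁ (y + 2 * Real.pi) = 0 ∧
    ζ₂ y = 0 ∧ ζ₂ (y + 2 * Real.pi) = 0
  bound : ∃ κ, 0 ≤ κ ∧ ∀ y, |ζ y| ≤ κ ∧ |ζ₁ y| ≤ κ ∧ |ζ₂ y| ≤ κ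

/-- The cutoff is `σ y - σ (y - 2π)` for a smooth step `σ` that rises from `0` to `1` inside `(0,
ε)`. -/
theorem exists_fold_cutoff {ε : ℝ} (hε : 0 < ε) (hεπ : ε ≤ Real.pi) :
    ∃ ζ ζ₁ ζ₂ : ℝ → ℝ, FoldCutoff ε ζ ζ₁ ζ₂ := by
  have hpi := Real.pi_pos
  let σ : ℝ → ℝ := fun y => Real.smoothTransition ((y - ε / 3) * (3 / ε))
  have hσ : ContDiff ℝ (⊤ : ℕ∞) σ :=
    Real.smoothTransition.contDiff.comp ((contDiff_id.sub contDiff_const).mul contDiff_const)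
  have hσ1 : ContDiff ℝ (⊤ : ℕ∞) (deriv σ) := ((contDiff_infty_iff_deriv (𝕜 := ℝ)).1 hσ).2
  have hσ2 : ContDiff ℝ (⊤ : ℕ∞) (deriv (deriv σ)) := ((contDiff_infty_iff_deriv (𝕜 := ℝ)).1 hσ1).2
  have z0 : ∀ y, y ≤ ε / 3 → σ y = 0 := fun y hy =>
    Real.smoothTransition.zero_of_nonpos
      (mul_nonpos_of_nonpos_of_nonneg (by linarith) (by positivity))
  have z1 : ∀ y, 2 * ε / 3 ≤ y → σ y = 1 := fun y hy => by
    refine Real.smoothTransition.one_of_one_le ?_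
    rw [← div_le_iff₀ (by positivity)]
    have : 1 / (3 / ε) = ε / 3 := by field_simp
    linarith
  have d0 : ∀ y, y < ε / 3 → deriv σ y = 0 := fun y hy => by
    have h : σ =ᶠ[𝓝 y] fun _ => 0 := by
      filter_upwards [eventually_lt_nhds hy] with z hz using z0 z hz.le
    rw [h.deriv_eq, deriv_const]
  have d1 : ∀ y, 2 * ε / 3 < y → deriv σ y = 0 := fun y hy => by
    have h : σ =ᶠ[𝓝 y] fun _ => 1 := by
      filter_upwards [eventually_gt_nhds hy] with z hz using z1 z hz.le
    rw [h.deriv_eq, deriv_const]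
  have dd0 : ∀ y, y < ε / 3 → deriv (deriv σ) y = 0 := fun y hy => by
    have h : deriv σ =ᶠ[𝓝 y] fun _ => 0 := by
      filter_upwards [eventually_lt_nhds hy] with z hz using d0 z hz
    rw [h.deriv_eq, deriv_const]
  have dd1 : ∀ y, 2 * ε / 3 < y → deriv (deriv σ) y = 0 := fun y hy => by
    have h : deriv σ =ᶠ[𝓝 y] fun _ => 0 := by
      filter_upwards [eventually_gt_nhds hy] with z hz using d1 z hz
    rw [h.deriv_eq, deriv_const]
  have hd : ∀ y, HasDerivAt σ (deriv σ y) y := fun y =>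
    ((hσ.differentiable (by simp)) y).hasDerivAt
  have hd1 : ∀ y, HasDerivAt (deriv σ) (deriv (deriv σ) y) y := fun y =>
    ((hσ1.differentiable (by simp)) y).hasDerivAt
  have c2 : Continuous (fun y => deriv (deriv σ) y - deriv (deriv σ) (y - 2 * Real.pi)) :=
    hσ2.continuous.sub (hσ2.continuous.comp (continuous_id.sub continuous_const))
  have c1 : Continuous (fun y => deriv σ y - deriv σ (y - 2 * Real.pi)) :=
    hσ1.continuous.sub (hσ1.continuous.comp (continuous_id.sub continuous_const))
  have c0 : Continuous (fun y => σ y - σ (y - 2 * Real.pi)) :=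
    hσ.continuous.sub (hσ.continuous.comp (continuous_id.sub continuous_const))
  have hout : ∀ y, y ∉ Ioo 0 (4 * Real.pi) → σ y - σ (y - 2 * Real.pi) = 0 ∧
      deriv σ y - deriv σ (y - 2 * Real.pi) = 0 ∧
      deriv (deriv σ) y - deriv (deriv σ) (y - 2 * Real.pi) = 0 := by
    intro y hy
    by_cases h : 0 < y
    · have h2 : 4 * Real.pi ≤ y := not_lt.1 fun h' => hy ⟨h, h'⟩
      rw [z1 y (by linarith), z1 (y - 2 * Real.pi) (by linarith), d1 y (by linarith),
        d1 (y - 2 * Real.pi) (by linarith), dd1 y (by linarith),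
        dd1 (y - 2 * Real.pi) (by linarith)]
      simp
    · rw [z0 y (by linarith), z0 (y - 2 * Real.pi) (by linarith), d0 y (by linarith),
        d0 (y - 2 * Real.pi) (by linarith), dd0 y (by linarith),
        dd0 (y - 2 * Real.pi) (by linarith)]
      simp
  refine ⟨fun y => σ y - σ (y - 2 * Real.pi), fun y => deriv σ y - deriv σ (y - 2 * Real.pi), _, c2,
    fun y => (hd y).sub ((hd (y - 2 * Real.pi)).comp_sub_const y _),
    fun y => (hd1 y).sub ((hd1 (y - 2 * Real.pi)).comp_sub_const y _), hout, ?_, ?_, ?_⟩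
  · intro y hy
    rw [z0 (y - 2 * Real.pi) (by linarith [hy.2]), z1 (y + 2 * Real.pi) (by linarith [hy.1]),
      add_sub_cancel_right]
    ring
  · intro y hy hyε
    rw [d0 (y - 2 * Real.pi) (by linarith [hy.2]), d1 (y + 2 * Real.pi) (by linarith [hy.1]),
      dd0 (y - 2 * Real.pi) (by linarith [hy.2]), dd1 (y + 2 * Real.pi) (by linarith [hy.1]),
      add_sub_cancel_right]
    by_cases h : 0 < y
    · have h2 : ε ≤ y := not_lt.1 fun h' => hyε ⟨h, h'⟩
      rw [d1 y (by linarith), dd1 y (by linarith)]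
      simp
    · rw [d0 y (by linarith), dd0 y (by linarith)]
      simp
  · have hb : ∀ f : ℝ → ℝ, Continuous f → (∀ y, y ∉ Ioo 0 (4 * Real.pi) → f y = 0) →
        ∃ κ, 0 ≤ κ ∧ ∀ y, |f y| ≤ κ := by
      intro f hf h0
      obtain ⟨κ, hκ⟩ := (isCompact_Icc (a := 0) (b := 4 * Real.pi)).exists_bound_of_continuousOn
        hf.continuousOn
      have hκ0 : 0 ≤ κ := (norm_nonneg _).trans (hκ 0 ⟨le_rfl, by positivity⟩)
      refine ⟨κ, hκ0, fun y => ?_⟩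
      by_cases hy : y ∈ Ioo 0 (4 * Real.pi)
      · exact hκ y (Ioo_subset_Icc_self hy)
      · rwa [h0 y hy, abs_zero]
    obtain ⟨κ₀, p0, h0⟩ := hb _ c0 fun y hy => (hout y hy).1
    obtain ⟨κ₁, p1, h1⟩ := hb _ c1 fun y hy => (hout y hy).2.1
    obtain ⟨κ₂, p2, h2⟩ := hb _ c2 fun y hy => (hout y hy).2.2
    exact ⟨κ₀ + κ₁ + κ₂, by positivity, fun y =>
      ⟨by linarith [h0 y], by linarith [h1 y], by linarith [h2 y]⟩⟩

end Cutoff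

section Integrals

variable {F : Type*} [NormedAddCommGroup F] [NormedSpace ℝ F] [CompleteSpace F]

/-- Differentiation under the integral sign, for continuous integrands. -/
theorem hasDerivAt_integral_param {f f' : ℝ → ℝ → F}
    (hf : ∀ t y, HasDerivAt (fun τ => f τ y) (f' t y) t)
    (cf : Continuous fun p : ℝ × ℝ => f p.1 p.2) (cf' : Continuous fun p : ℝ × ℝ => f' p.1 p.2)
    (a b t : ℝ) :
    HasDerivAt (fun t => ∫ y in a..b, f t y) (∫ y in a..b, f' t y) t := by
  have c1 : ∀ t, Continuous fun y => f t y := fun t =>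
    cf.comp (by fun_prop : Continuous fun y : ℝ => (t, y))
  have c2 : ∀ t, Continuous fun y => f' t y := fun t =>
    cf'.comp (by fun_prop : Continuous fun y : ℝ => (t, y))
  have c3 : ∀ y, Continuous fun t => f' t y := fun y =>
    cf'.comp (by fun_prop : Continuous fun t : ℝ => (t, y))
  have c4 : Continuous fun t => ∫ y in a..b, f' t y :=
    intervalIntegral.continuous_parametric_intervalIntegral_of_continuous' (f := f') cf' a b
  have key : (fun t => ∫ y in a..b, f t y)
      = fun t => (∫ y in a..b, f 0 y) + ∫ s in (0:ℝ)..t, ∫ y in a..b, f' s y := by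
    funext t
    rw [← integral_swap_of_continuous (f := fun y s => f' s y)
      (cf'.comp continuous_swap), ← intervalIntegral.integral_add ((c1 0).intervalIntegrable _ _)]
    · refine intervalIntegral.integral_congr fun y _ => ?_
      rw [intervalIntegral.integral_eq_sub_of_hasDerivAt (fun s _ => hf s y)
        ((c3 y).intervalIntegrable _ _)]
      abel
    · exact (intervalIntegral.continuous_parametric_intervalIntegral_of_continuous'
        (f := fun y s => f' s y) (cf'.comp continuous_swap) 0 t).intervalIntegrable _ _
  rw [key]
  exact (c4.integral_hasStrictDerivAt 0 t).hasDerivAt.const_add _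

omit [CompleteSpace F] in
theorem integral_eq_of_zero_off {f : ℝ → F} (cf : Continuous f) {a b c d : ℝ} (hca : c ≤ a)
    (hbd : b ≤ d) (hl : ∀ x ≤ a, f x = 0) (hr : ∀ x, b ≤ x → f x = 0) :
    ∫ x in c..d, f x = ∫ x in a..b, f x := by
  rw [← intervalIntegral.integral_add_adjacent_intervals (b := a) (cf.intervalIntegrable _ _)
    (cf.intervalIntegrable _ _), ← intervalIntegral.integral_add_adjacent_intervals (a := a)
    (b := b) (c := d) (cf.intervalIntegrable _ _) (cf.intervalIntegrable _ _)]
  have h1 : ∫ x in c..a, f x = ∫ x in c..a, (0 : F) :=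
    intervalIntegral.integral_congr fun x hx => by
      rw [uIcc_of_le hca] at hx
      exact hl x hx.2
  have h2 : ∫ x in b..d, f x = ∫ x in b..d, (0 : F) :=
    intervalIntegral.integral_congr fun x hx => by
      rw [uIcc_of_le hbd] at hx
      exact hr x hx.1
  rw [h1, h2]
  simp

end Integrals

section Transport

variable {F : Type*} [NormedAddCommGroup F] [InnerProductSpace ℝ F]

/-- The time derivative of a pairing with a function that is only differentiable along the
characteristics of speed `c`. -/
theorem hasDerivAt_integral_inner_of_char {Φ Φ' : ℝ → F} {r g : ℝ → ℝ → F} {c : ℝ}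
    (hΦ : ∀ y, HasDerivAt Φ (Φ' y) y) (cΦ' : Continuous Φ') {a b : ℝ}
    (hl : ∀ y ≤ a, Φ y = 0 ∧ Φ' y = 0) (hr : ∀ y, b ≤ y → Φ y = 0 ∧ Φ' y = 0)
    (cr : Continuous fun p : ℝ × ℝ => r p.1 p.2) (cg : Continuous fun p : ℝ × ℝ => g p.1 p.2)
    (hrg : ∀ t x τ, HasDerivAt (fun σ => r (t + σ) (x + c * σ)) (g (t + τ) (x + c * τ)) τ) (t : ℝ) :
    HasDerivAt (fun t => ∫ y in a..b, ⟪Φ y, r t y⟫_ℝ)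
      (∫ y in a..b, (⟪Φ y, g t y⟫_ℝ + c * ⟪Φ' y, r t y⟫_ℝ)) t := by
  have cΦ : Continuous Φ := continuous_iff_continuousAt.2 fun x => (hΦ x).continuousAt
  -- shear the variable of integration along the characteristic through `(t, y)`
  let f : ℝ → ℝ → ℝ := fun τ y => ⟪Φ (y + c * τ), r (t + τ) (y + c * τ)⟫_ℝ
  let f' : ℝ → ℝ → ℝ := fun τ y => ⟪Φ (y + c * τ), g (t + τ) (y + c * τ)⟫_ℝ
    + ⟪c • Φ' (y + c * τ), r (t + τ) (y + c * τ)⟫_ℝ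
  have hf : ∀ τ y, HasDerivAt (fun τ => f τ y) (f' τ y) τ := by
    intro τ y
    have h1 : HasDerivAt (fun τ : ℝ => y + c * τ) c τ := by
      simpa using ((hasDerivAt_id τ).const_mul c).const_add y
    exact ((hΦ (y + c * τ)).scomp τ h1).inner ℝ (hrg t y τ)
  have e1 : Continuous fun p : ℝ × ℝ => (t + p.1, p.2 + c * p.1) := by fun_prop
  have e2 : Continuous fun p : ℝ × ℝ => p.2 + c * p.1 := by fun_prop
  have cf : Continuous fun p : ℝ × ℝ => f p.1 p.2 := (cΦ.comp e2).inner (cr.comp e1)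
  have cf' : Continuous fun p : ℝ × ℝ => f' p.1 p.2 :=
    ((cΦ.comp e2).inner (cg.comp e1)).add (((cΦ'.comp e2).const_smul c).inner (cr.comp e1))
  have h := hasDerivAt_integral_param hf cf cf' (a - |c|) (b + |c|) 0
  have s1 : Continuous fun y => ⟪Φ y, g t y⟫_ℝ + c * ⟪Φ' y, r t y⟫_ℝ :=
    (cΦ.inner (cg.comp (by fun_prop : Continuous fun y : ℝ => (t, y)))).add
      (continuous_const.mul (cΦ'.inner (cr.comp (by fun_prop : Continuous fun y : ℝ => (t, y)))))
  have e3 : ∫ y in (a - |c|)..(b + |c|), f' 0 y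
      = ∫ y in a..b, (⟪Φ y, g t y⟫_ℝ + c * ⟪Φ' y, r t y⟫_ℝ) := by
    rw [← integral_eq_of_zero_off s1 (c := a - |c|) (d := b + |c|) (by linarith [abs_nonneg c])
      (by linarith [abs_nonneg c]) (fun y hy => by simp [hl y hy]) (fun y hy => by simp [hr y hy])]
    refine intervalIntegral.integral_congr fun y _ => ?_
    simp only [f', mul_zero, add_zero, real_inner_smul_left]
  rw [e3] at h
  have h0 : HasDerivAt (fun s => ∫ y in (a - |c|)..(b + |c|), f (s - t) y)
      (∫ y in a..b, (⟪Φ y, g t y⟫_ℝ + c * ⟪Φ' y, r t y⟫_ℝ)) t := by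
    refine HasDerivAt.comp_sub_const t t (f := fun τ => ∫ y in (a - |c|)..(b + |c|), f τ y) ?_
    rwa [sub_self]
  refine h0.congr_of_eventuallyEq ?_
  filter_upwards [Metric.ball_mem_nhds t one_pos] with s hs
  rw [Metric.mem_ball, Real.dist_eq] at hs
  have hcs : |c * (s - t)| ≤ |c| := by
    rw [abs_mul]
    nlinarith [abs_nonneg c]
  have cs : Continuous fun y => ⟪Φ y, r s y⟫_ℝ :=
    cΦ.inner (cr.comp (by fun_prop : Continuous fun y : ℝ => (s, y)))
  have e4 : ∀ y, f (s - t) y = (fun z => ⟪Φ z, r s z⟫_ℝ) (y + c * (s - t)) := fun y => by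
    simp only [f, add_sub_cancel]
  rw [abs_le] at hcs
  simp only [e4]
  rw [intervalIntegral.integral_comp_add_right (fun z => ⟪Φ z, r s z⟫_ℝ)]
  exact (integral_eq_of_zero_off cs (by linarith) (by linarith)
    (fun y hy => by simp [hl y hy]) (fun y hy => by simp [hr y hy])).symm

end Transport

/-! ### Winding the double window around the circle -/

section Fold

variable {F : Type*} [NormedAddCommGroup F]

/-- The coordinate in `[0, 2π)` on the circle with origin `a`. -/
def coordFrom (a : ℝ) (x : Circ) : ℝ := (AddCircle.equivIco (2 * Real.pi) 0 (x - (a : Circ)) : ℝ)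

/-- The function on the circle obtained from a function on `[0, 4π]` by winding this interval twice
around the circle, from the origin `a`, and adding the two values. -/
def fold (a : ℝ) (Φ : ℝ → F) (x : Circ) : F :=
  Φ (coordFrom a x) + Φ (coordFrom a x + 2 * Real.pi)

theorem coordFrom_mem (a : ℝ) (x : Circ) : coordFrom a x ∈ Ico 0 (2 * Real.pi) := by
  have h := (AddCircle.equivIco (2 * Real.pi) 0 (x - (a : Circ))).2
  exact ⟨h.1, h.2.trans_eq (zero_add _)⟩

theorem coe_add_coordFrom (a : ℝ) (x : Circ) : ((a + coordFrom a x : ℝ) : Circ) = x := by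
  have h := AddCircle.coe_equivIco (p := 2 * Real.pi) (a := 0) (y := x - (a : Circ))
  rw [AddCircle.coe_add, coordFrom, h, add_sub_cancel]

theorem coordFrom_coe {a y : ℝ} (hy : y ∈ Ico 0 (2 * Real.pi)) :
    coordFrom a ((a + y : ℝ) : Circ) = y := by
  rw [coordFrom, AddCircle.coe_add, add_sub_cancel_left,
      AddCircle.equivIco_coe_eq (by rwa [zero_add])]

theorem fold_coe {a : ℝ} {Φ : ℝ → F} (hl : Φ 0 = 0) (hr : Φ (4 * Real.pi) = 0) {y : ℝ}
    (hy : y ∈ Icc 0 (2 * Real.pi)) : fold a Φ ((a + y : ℝ) : Circ) = Φ y + Φ (y + 2 * Real.pi) := by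
  rcases hy.2.lt_or_eq with h | h
  · rw [fold, coordFrom_coe ⟨hy.1, h⟩]
  · have h0 : ((a + y : ℝ) : Circ) = ((a + 0 : ℝ) : Circ) := by
      rw [h, AddCircle.coe_add, AddCircle.coe_period, AddCircle.coe_add, QuotientAddGroup.mk_zero]
    rw [h0, fold, coordFrom_coe ⟨le_rfl, Real.two_pi_pos⟩, h, hl, zero_add, zero_add,
      show 2 * Real.pi + 2 * Real.pi = 4 * Real.pi by ring, hr, add_zero]

/-- A continuous curve of functions on the line which vanish at `0` and at `4π`. -/
structure FoldCurve (Φ : ℝ → ℝ → F) : Prop where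
  cont : Continuous fun p : ℝ × ℝ => Φ p.1 p.2
  left : ∀ t, Φ t 0 = 0
  right : ∀ t, Φ t (4 * Real.pi) = 0

theorem FoldCurve.continuous_apply {Φ : ℝ → ℝ → F} (h : FoldCurve Φ) (t : ℝ) :
    Continuous (Φ t) := h.cont.comp (by fun_prop : Continuous fun y : ℝ => (t, y))

theorem FoldCurve.add {Φ Ψ : ℝ → ℝ → F} (h : FoldCurve Φ) (h' : FoldCurve Ψ) :
    FoldCurve fun t y => Φ t y + Ψ t y where
  cont := h.cont.add h'.cont
  left t := by rw [h.left, h'.left, add_zero]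
  right t := by rw [h.right, h'.right, add_zero]

theorem FoldCurve.sub {Φ Ψ : ℝ → ℝ → F} (h : FoldCurve Φ) (h' : FoldCurve Ψ) :
    FoldCurve fun t y => Φ t y - Ψ t y where
  cont := h.cont.sub h'.cont
  left t := by rw [h.left, h'.left, sub_zero]
  right t := by rw [h.right, h'.right, sub_zero]

theorem FoldCurve.const_smul [NormedSpace ℝ F] {Φ : ℝ → ℝ → F} (h : FoldCurve Φ) (c : ℝ) :
    FoldCurve fun t y => c • Φ t y where
  cont := h.cont.const_smul c
  left t := by rw [h.left, smul_zero]
  right t := by rw [h.right, smul_zero]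

theorem FoldCurve.const {Φ : ℝ → ℝ → F} (h : FoldCurve Φ) (t : ℝ) :
    FoldCurve fun _ y => Φ t y where
  cont := (h.continuous_apply t).comp continuous_snd
  left _ := h.left t
  right _ := h.right t

theorem FoldCurve.continuous_fold {Φ : ℝ → ℝ → F} (h : FoldCurve Φ) (a : ℝ) :
    Continuous fun p : ℝ × Circ => fold a (Φ p.1) p.2 := by
  -- wind the curve `y ↦ (t ↦ Φ t y)` of continuous functions of the time
  let g : C(ℝ, C(ℝ, F)) := ContinuousMap.curry
    ⟨fun p : ℝ × ℝ => Φ p.2 p.1, h.cont.comp continuous_swap⟩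
  have hg : Continuous fun y : ℝ => g y + g (y + 2 * Real.pi) := by fun_prop
  have hc : Continuous (AddCircle.liftIco (2 * Real.pi) 0 fun y => g y + g (y + 2 * Real.pi)) := by
    refine AddCircle.liftIco_zero_continuous ?_ hg.continuousOn
    ext t
    change Φ t 0 + Φ t (0 + 2 * Real.pi) = Φ t (2 * Real.pi) + Φ t (2 * Real.pi + 2 * Real.pi)
    rw [h.left, show 2 * Real.pi + 2 * Real.pi = 4 * Real.pi by ring, h.right, zero_add, zero_add,
      add_zero]
  have h2 : Continuous fun p : ℝ × Circ => (AddCircle.liftIco (2 * Real.pi) 0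
      (fun y => g y + g (y + 2 * Real.pi)) (p.2 - (a : Circ))) p.1 :=
    (hc.comp (continuous_snd.sub continuous_const)).eval continuous_fst
  exact h2

theorem FoldCurve.continuous_fold_apply {Φ : ℝ → ℝ → F} (h : FoldCurve Φ) (a t : ℝ) :
    Continuous (fold a (Φ t)) :=
  (h.continuous_fold a).comp (by fun_prop : Continuous fun x : Circ => (t, x))

end Fold

section FoldL2

variable {R : ℕ}

/-- The curve in `L²` of the circle obtained by winding a curve of functions on `[0, 4π]`. -/
def FoldCurve.toL2 {Φ : ℝ → ℝ → E R} (h : FoldCurve Φ) (a t : ℝ) : L2 R :=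
  WaveControl.toL2 (h.continuous_fold_apply a t)

theorem integral_double_window {f : ℝ → ℝ} (cf : Continuous f) :
    ∫ y in (0:ℝ)..(2 * Real.pi), (f y + f (y + 2 * Real.pi))
      = ∫ y in (0:ℝ)..(4 * Real.pi), f y := by
  have cf2 : Continuous fun y => f (y + 2 * Real.pi) := cf.comp (continuous_id.add continuous_const)
  rw [intervalIntegral.integral_add (cf.intervalIntegrable _ _) (cf2.intervalIntegrable _ _),
    intervalIntegral.integral_comp_add_right, zero_add,
    intervalIntegral.integral_add_adjacent_intervals (cf.intervalIntegrable _ _)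
      (cf.intervalIntegrable _ _)]
  congr 1
  ring

theorem continuous_shift {F : Type*} [TopologicalSpace F] {θ : Circ → F} (hθ : Continuous θ)
    (a : ℝ) : Continuous fun y : ℝ => θ ((a + y : ℝ) : Circ) :=
  hθ.comp ((AddCircle.continuous_mk' (2 * Real.pi)).comp (continuous_const.add continuous_id))

theorem coe_add_two_pi (a y : ℝ) : ((a + (y + 2 * Real.pi) : ℝ) : Circ) = ((a + y : ℝ) : Circ) := by
  rw [← add_assoc, AddCircle.coe_add, AddCircle.coe_period, add_zero]

theorem FoldCurve.inner_toL2 {Φ : ℝ → ℝ → E R} (h : FoldCurve Φ) (a t : ℝ) {θ : Circ → E R}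
    (hθ : Continuous θ) : ⟪h.toL2 a t, WaveControl.toL2 hθ⟫_ℝ
      = ∫ y in (0:ℝ)..(4 * Real.pi), ⟪Φ t y, θ ((a + y : ℝ) : Circ)⟫_ℝ := by
  rw [FoldCurve.toL2, inner_toL2_toL2 _ hθ a, ← integral_double_window
    ((h.continuous_apply t).inner (continuous_shift hθ a))]
  have e := intervalIntegral.integral_comp_add_left (a := 0) (b := 2 * Real.pi)
    (fun s : ℝ => ⟪fold a (Φ t) (s : Circ), θ (s : Circ)⟫_ℝ) a
  rw [add_zero] at e
  rw [← e]
  refine intervalIntegral.integral_congr fun y hy => ?_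
  rw [uIcc_of_le Real.two_pi_pos.le] at hy
  rw [fold_coe (h.left t) (h.right t) hy, inner_add_left, coe_add_two_pi]

/-- Winding twice costs a factor `2` in the square of the norm. -/
theorem FoldCurve.norm_toL2_sq_le {Φ : ℝ → ℝ → E R} (h : FoldCurve Φ) (a t : ℝ) :
    ‖h.toL2 a t‖ ^ 2 ≤ 2 * ∫ y in (0:ℝ)..(4 * Real.pi), ‖Φ t y‖ ^ 2 := by
  have cf := h.continuous_apply t
  have e := intervalIntegral.integral_comp_add_left (a := 0) (b := 2 * Real.pi)
    (fun s : ℝ => ‖fold a (Φ t) (s : Circ)‖ ^ 2) a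
  rw [add_zero] at e
  rw [FoldCurve.toL2, norm_toL2_sq _ a,
    ← integral_double_window (f := fun y => ‖Φ t y‖ ^ 2) (cf.norm.pow 2), ← e, ← intervalIntegral.integral_const_mul]
  refine intervalIntegral.integral_mono_on Real.two_pi_pos.le ?_ ?_ fun y hy => ?_
  · exact ((continuous_shift (h.continuous_fold_apply a t) a).norm.pow 2).intervalIntegrable _ _
  · exact (continuous_const.mul ((cf.norm.pow 2).add
      ((cf.comp (continuous_id.add continuous_const)).norm.pow 2))).intervalIntegrable _ _
  · rw [fold_coe (h.left t) (h.right t) hy]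
    have h1 := norm_add_le (Φ t y) (Φ t (y + 2 * Real.pi))
    have h2 : ‖Φ t y + Φ t (y + 2 * Real.pi)‖ ^ 2 ≤ (‖Φ t y‖ + ‖Φ t (y + 2 * Real.pi)‖) ^ 2 :=
      pow_le_pow_left₀ (norm_nonneg _) h1 2
    nlinarith [sq_nonneg (‖Φ t y‖ - ‖Φ t (y + 2 * Real.pi)‖)]

theorem FoldCurve.continuous_toL2 {Φ : ℝ → ℝ → E R} (h : FoldCurve Φ) (a : ℝ) :
    Continuous (h.toL2 a) := by
  refine continuous_iff_continuousAt.2 fun s => ?_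
  have hsub : ∀ t, h.toL2 a t - h.toL2 a s = (h.sub (h.const s)).toL2 a t := fun t => by
    refine toL2_congr ((h.continuous_fold_apply a t).sub (h.continuous_fold_apply a s))
      ((h.sub (h.const s)).continuous_fold_apply a t) ?_
    funext x
    simp only [fold, Pi.sub_apply]
    abel
  have hc : Continuous fun t => 2 * ∫ y in (0:ℝ)..(4 * Real.pi), ‖Φ t y - Φ s y‖ ^ 2 :=
    continuous_const.mul (intervalIntegral.continuous_parametric_intervalIntegral_of_continuous'
      (f := fun t y => ‖Φ t y - Φ s y‖ ^ 2)
      (show Continuous fun p : ℝ × ℝ => ‖Φ p.1 p.2 - Φ s p.2‖ ^ 2 from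
        (h.sub (h.const s)).cont.norm.pow 2) 0 _)
  have h0 : Filter.Tendsto 
      (fun t => Real.sqrt (2 * ∫ y in (0:ℝ)..(4 * Real.pi), ‖Φ t y - Φ s y‖ ^ 2))
      (𝓝 s) (𝓝 0) := by
    have h1 : Real.sqrt (2 * ∫ y in (0:ℝ)..(4 * Real.pi), ‖Φ s y - Φ s y‖ ^ 2) = 0 := by simp
    have h2 := (Real.continuous_sqrt.comp hc).tendsto s
    rw [Function.comp_apply, h1] at h2
    exact h2
  rw [ContinuousAt, tendsto_iff_norm_sub_tendsto_zero]
  refine squeeze_zero (fun t => norm_nonneg _) (fun t => ?_) h0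
  rw [hsub]
  exact Real.le_sqrt_of_sq_le ((h.sub (h.const s)).norm_toL2_sq_le a t)

/-- The formula for the integral of the derivative is tested against the eigenfunctions of the
second derivative, where it is a derivative under the integral sign. -/
theorem FoldCurve.hasDerivAt_toL2 {Φ Φ' : ℝ → ℝ → E R} (h : FoldCurve Φ) (h' : FoldCurve Φ')
    (hd : ∀ t y, HasDerivAt (fun τ => Φ τ y) (Φ' t y) t) (a t : ℝ) :
    HasDerivAt (h.toL2 a) (h'.toL2 a t) t := by
  have hc := h'.continuous_toL2 a
  have key : h.toL2 a = fun t => h.toL2 a 0 + ∫ s in (0:ℝ)..t, h'.toL2 a s := by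
    funext t
    rw [← sub_eq_zero]
    refine eq_zero_of_inner_eigenfunction _ fun θ hθ n _ => ?_
    have hθ' := continuous_shift hθ.continuous a
    have e1 : ⟪∫ s in (0:ℝ)..t, h'.toL2 a s, WaveControl.toL2 hθ.continuous⟫_ℝ
        = ∫ s in (0:ℝ)..t, ⟪h'.toL2 a s, WaveControl.toL2 hθ.continuous⟫_ℝ := by
      have := (innerSL ℝ (WaveControl.toL2 hθ.continuous)).intervalIntegral_comp_comm
        (hc.intervalIntegrable (μ := volume) 0 t)
      simp only [innerSL_apply_apply] at this
      rw [real_inner_comm, ← this]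
      refine intervalIntegral.integral_congr fun s _ => real_inner_comm _ _
    have e2 : ∀ t, HasDerivAt (fun t => ⟪h.toL2 a t, WaveControl.toL2 hθ.continuous⟫_ℝ)
        ⟪h'.toL2 a t, WaveControl.toL2 hθ.continuous⟫_ℝ t := by
      intro t
      simp only [FoldCurve.inner_toL2]
      refine hasDerivAt_integral_param (f := fun t y => ⟪Φ t y, θ ((a + y : ℝ) : Circ)⟫_ℝ)
        (f' := fun t y => ⟪Φ' t y, θ ((a + y : ℝ) : Circ)⟫_ℝ) (fun t y => ?_)
        (h.cont.inner (hθ'.comp continuous_snd)) (h'.cont.inner (hθ'.comp continuous_snd)) _ _ t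
      have := (hd t y).inner ℝ (hasDerivAt_const t (θ ((a + y : ℝ) : Circ)))
      simpa using this
    have e3 := intervalIntegral.integral_eq_sub_of_hasDerivAt (a := 0) (b := t)
      (fun s _ => e2 s) ((hc.inner continuous_const).intervalIntegrable _ _)
    rw [inner_sub_left, inner_add_left, e1, e3]
    ring
  rw [key]
  exact (hc.integral_hasStrictDerivAt 0 t).hasDerivAt.const_add _

end FoldL2

/-! ### The equation of the wound wave -/

section FoldedWave

variable {R : ℕ} {B C : Circ → Matrix (Fin R) (Fin R) ℝ}

theorem FoldCutoff.cont₁ {ε : ℝ} {ζ ζ₁ ζ₂ : ℝ → ℝ} (h : FoldCutoff ε ζ ζ₁ ζ₂) : Continuous ζ₁ :=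
  continuous_iff_continuousAt.2 fun x => (h.deriv₁ x).continuousAt

theorem FoldCutoff.cont₀ {ε : ℝ} {ζ ζ₁ ζ₂ : ℝ → ℝ} (h : FoldCutoff ε ζ ζ₁ ζ₂) : Continuous ζ :=
  continuous_iff_continuousAt.2 fun x => (h.deriv₀ x).continuousAt

/-- The pairing with `w_t = (r + s) / 2`. The transport terms of the two characteristic families
combine to `-⟪Φ', w_x⟫`, with `w_x = (r - s) / 2`. -/
theorem hasDerivAt_integral_inner_of_chars {F : Type*} [NormedAddCommGroup F]
    [InnerProductSpace ℝ F]
    {Φ Φ' : ℝ → F} {r s g : ℝ → ℝ → F} (hΦ : ∀ y, HasDerivAt Φ (Φ' y) y) (cΦ' : Continuous Φ')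
    {a b : ℝ} (hl : ∀ y ≤ a, Φ y = 0 ∧ Φ' y = 0) (hr : ∀ y, b ≤ y → Φ y = 0 ∧ Φ' y = 0)
    (cr : Continuous fun p : ℝ × ℝ => r p.1 p.2) (cs : Continuous fun p : ℝ × ℝ => s p.1 p.2)
    (cg : Continuous fun p : ℝ × ℝ => g p.1 p.2)
    (dr : ∀ t x, HasDerivAt (fun σ => r (t + σ) (x - σ)) (g t x) 0)
    (ds : ∀ t x, HasDerivAt (fun σ => s (t + σ) (x + σ)) (g t x) 0) (t : ℝ) :
    HasDerivAt (fun t => ∫ y in a..b, ⟪Φ y, (1 / 2 : ℝ) • (r t y + s t y)⟫_ℝ)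
      (∫ y in a..b, (⟪Φ y, g t y⟫_ℝ - ⟪Φ' y, (1 / 2 : ℝ) • (r t y - s t y)⟫_ℝ)) t := by
  have cΦ : Continuous Φ := continuous_iff_continuousAt.2 fun x => (hΦ x).continuousAt
  have crt : ∀ t, Continuous (r t) := fun t =>
      cr.comp (by fun_prop : Continuous fun y : ℝ => (t, y))
  have cst : ∀ t, Continuous (s t) := fun t =>
      cs.comp (by fun_prop : Continuous fun y : ℝ => (t, y))
  have cgt : Continuous (g t) := cg.comp (by fun_prop : Continuous fun y : ℝ => (t, y))
  have d1 := hasDerivAt_integral_inner_of_char (c := -1) hΦ cΦ' hl hr cr cg (fun t x τ => by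
      have := hasDerivAt_char_r dr t x τ
      simpa only [neg_mul, one_mul, ← sub_eq_add_neg] using this) t
  have d2 := hasDerivAt_integral_inner_of_char (c := 1) hΦ cΦ' hl hr cs cg (fun t x τ => by
      have := hasDerivAt_char_s ds t x τ
      simpa only [one_mul] using this) t
  have d3 : HasDerivAt (fun t => (1 / 2 : ℝ) * ((∫ y in a..b, ⟪Φ y, r t y⟫_ℝ)
      + ∫ y in a..b, ⟪Φ y, s t y⟫_ℝ)) _ t := (d1.add d2).const_mul (1 / 2 : ℝ)
  have e : (fun t => ∫ y in a..b, ⟪Φ y, (1 / 2 : ℝ) • (r t y + s t y)⟫_ℝ)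
      = fun t => (1 / 2 : ℝ) * ((∫ y in a..b, ⟪Φ y, r t y⟫_ℝ) + ∫ y in a..b, ⟪Φ y, s t y⟫_ℝ) := by
    funext t
    rw [← intervalIntegral.integral_add ((cΦ.inner (crt t)).intervalIntegrable _ _)
      ((cΦ.inner (cst t)).intervalIntegrable _ _), ← intervalIntegral.integral_const_mul]
    refine intervalIntegral.integral_congr fun y _ => ?_
    simp only [inner_add_right, real_inner_smul_right]
  rw [e]
  refine d3.congr_deriv ?_
  rw [← intervalIntegral.integral_add (((cΦ.inner cgt).add
      (continuous_const.mul (cΦ'.inner (crt t)))).intervalIntegrable _ _)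
    (((cΦ.inner cgt).add (continuous_const.mul (cΦ'.inner (cst t)))).intervalIntegrable _ _),
    ← intervalIntegral.integral_const_mul]
  refine intervalIntegral.integral_congr fun y _ => ?_
  simp only [inner_sub_right, real_inner_smul_right]
  ring

theorem foldCurve_smul {F : Type*} [NormedAddCommGroup F] [NormedSpace ℝ F] {χ : ℝ → ℝ}
    {V : ℝ → ℝ → F} (hχ : Continuous χ) (h0 : ∀ y, y ∉ Ioo 0 (4 * Real.pi) → χ y = 0)
    (hV : Continuous fun p : ℝ × ℝ => V p.1 p.2) : FoldCurve fun t y => χ y • V t y where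
  cont := (hχ.comp continuous_snd).smul hV
  left t := by rw [h0 0 (by simp), zero_smul]
  right t := by rw [h0 (4 * Real.pi) (by simp), zero_smul]

theorem foldCurve_act {A : Circ → Matrix (Fin R) (Fin R) ℝ} (hA : SmoothMat A) (a : ℝ)
    {Φ : ℝ → ℝ → E R} (h : FoldCurve Φ) :
    FoldCurve fun t y => act (A ((a + y : ℝ) : Circ)) (Φ t y) where
  cont := ((continuous_actL.comp (continuous_shift hA.continuous a)).comp continuous_snd).clm_apply
    h.cont
  left t := by rw [h.left]; exact map_zero (actL _)
  right t := by rw [h.right]; exact map_zero (actL _)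

theorem FoldCurve.inner_mulL2_toL2 {A : Circ → Matrix (Fin R) (Fin R) ℝ} (hA : SmoothMat A)
    {Φ : ℝ → ℝ → E R} (h : FoldCurve Φ) (a t : ℝ) {θ : Circ → E R} (hθ : Continuous θ) :
    ⟪mulL2 hA (h.toL2 a t), WaveControl.toL2 hθ⟫_ℝ = ∫ y in (0:ℝ)..(4 * Real.pi),
      ⟪act (A ((a + y : ℝ) : Circ)) (Φ t y), θ ((a + y : ℝ) : Circ)⟫_ℝ := by
  rw [inner_mulL2_left, mulL2_toL2, h.inner_toL2]
  refine intervalIntegral.integral_congr fun y _ => ?_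
  rw [inner_act_left]

theorem Smooth.hasDerivAt_shift {F : Type*} [NormedAddCommGroup F] [NormedSpace ℝ F] {θ : Circ → F}
    (hθ : Smooth θ) (a y : ℝ) : HasDerivAt (fun y : ℝ => θ ((a + y : ℝ) : Circ))
      (WaveControl.dx θ ((a + y : ℝ) : Circ)) y :=
  (hθ.hasDerivAt (a + y)).comp_const_add a y

theorem integral_deriv_eq_zero {f f' : ℝ → ℝ} (hf : ∀ y, HasDerivAt f (f' y) y)
    (cf' : Continuous f') {a b : ℝ} (ha : f a = 0) (hb : f b = 0) : ∫ y in a..b, f' y = 0 := by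
  rw [intervalIntegral.integral_eq_sub_of_hasDerivAt (fun y _ => hf y)
    (cf'.intervalIntegrable _ _), ha, hb, sub_zero]

/-- An identity between integrands that holds up to a term of vanishing integral. -/
theorem integral_eq_of_balance {f f₁ f₂ f₃ f₄ k : ℝ → ℝ} {a b : ℝ} (c₁ : Continuous f₁)
    (c₂ : Continuous f₂) (c₃ : Continuous f₃) (c₄ : Continuous f₄) (ck : Continuous k)
    (h : ∀ y, f y = -f₁ y - (f₂ y + f₃ y + f₄ y) + k y) (hk : ∫ y in a..b, k y = 0) :
    ∫ y in a..b, f y = -(∫ y in a..b, f₁ y)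
      - ((∫ y in a..b, f₂ y) + (∫ y in a..b, f₃ y) + ∫ y in a..b, f₄ y) := by
  have i : ∀ {g : ℝ → ℝ}, Continuous g → IntervalIntegrable g volume a b := fun hg =>
    hg.intervalIntegrable a b
  have c₂₃ : Continuous fun y => f₂ y + f₃ y := c₂.add c₃
  have c₂₄ : Continuous fun y => f₂ y + f₃ y + f₄ y := c₂₃.add c₄
  have c₁' : Continuous fun y => -f₁ y := c₁.neg
  have c₁₄ : Continuous fun y => -f₁ y - (f₂ y + f₃ y + f₄ y) := c₁'.sub c₂₄
  rw [← intervalIntegral.integral_add (i c₂) (i c₃), ← intervalIntegral.integral_add (i c₂₃) (i c₄),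
    ← intervalIntegral.integral_neg, ← intervalIntegral.integral_sub (i c₁') (i c₂₄),
    ← add_zero (∫ y in a..b, -f₁ y - (f₂ y + f₃ y + f₄ y)), ← hk,
    ← intervalIntegral.integral_add (i c₁₄) (i ck)]
  exact intervalIntegral.integral_congr fun y _ => h y

/-- The weak derivative in `x` of a wound function. -/
theorem FoldCurve.inner_toL2_dx {Φ Ψ : ℝ → ℝ → E R} (h : FoldCurve Φ) (h' : FoldCurve Ψ)
    (hd : ∀ t y, HasDerivAt (Φ t) (Ψ t y) y) (a t : ℝ) {θ : Circ → E R} (hθ : Smooth θ) :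
    ⟪h.toL2 a t, WaveControl.toL2 hθ.dx.continuous⟫_ℝ
      = -⟪h'.toL2 a t, WaveControl.toL2 hθ.continuous⟫_ℝ := by
  have c1 := continuous_shift hθ.continuous a
  have c2 := continuous_shift hθ.dx.continuous a
  have cΦ := h.continuous_apply t
  have cΨ := h'.continuous_apply t
  have key := integral_deriv_eq_zero (f := fun y => ⟪Φ t y, θ ((a + y : ℝ) : Circ)⟫_ℝ)
    (fun y => (hd t y).inner ℝ (hθ.hasDerivAt_shift a y)) ((cΦ.inner c2).add (cΨ.inner c1))
    (a := 0) (b := 4 * Real.pi) (by rw [h.left, inner_zero_left])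
    (by rw [h.right, inner_zero_left])
  rw [intervalIntegral.integral_add ((cΦ.inner c2).intervalIntegrable _ _)
    ((cΨ.inner c1).intervalIntegrable _ _)] at key
  rw [h.inner_toL2, h'.inner_toL2]
  linarith

variable {a : ℝ} {r s V : ℝ → ℝ → E R} {ε : ℝ} {ζ ζ₁ ζ₂ : ℝ → ℝ}

/-- The solution, in the coordinate `y` with `x = a + y`, of the unforced wave system. -/
abbrev LocalWave (B C : Circ → Matrix (Fin R) (Fin R) ℝ) (a : ℝ) (r s V : ℝ → ℝ → E R) : Prop :=
  CharSol (fun _ y => -((1 / 2 : ℝ) • actL (B ((a + y : ℝ) : Circ))))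
    (fun _ y => (1 / 2 : ℝ) • actL (B ((a + y : ℝ) : Circ)))
    (fun _ y => -actL (C ((a + y : ℝ) : Circ))) r s V

/-- The cut-off wave. -/
theorem foldCurve_value (hζ : FoldCutoff ε ζ ζ₁ ζ₂) (h : LocalWave B C a r s V) :
    FoldCurve fun t y => ζ y • V t y :=
  foldCurve_smul hζ.cont₀ (fun y hy => (hζ.zero_off y hy).1) h.cont_w

/-- The derivative of the cut-off wave in space. -/
theorem foldCurve_space (hζ : FoldCutoff ε ζ ζ₁ ζ₂) (h : LocalWave B C a r s V) :
    FoldCurve fun t y => ζ y • ((1 / 2 : ℝ) • (r t y - s t y)) + ζ₁ y • V t y :=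
  (foldCurve_smul hζ.cont₀ (fun y hy => (hζ.zero_off y hy).1)
    ((h.cont_r.sub h.cont_s).const_smul (1 / 2 : ℝ))).add
    (foldCurve_smul hζ.cont₁ (fun y hy => (hζ.zero_off y hy).2.1) h.cont_w)

/-- The derivative of the cut-off wave in time. -/
theorem foldCurve_time (hζ : FoldCutoff ε ζ ζ₁ ζ₂) (h : LocalWave B C a r s V) :
    FoldCurve fun t y => ζ y • ((1 / 2 : ℝ) • (r t y + s t y)) :=
  foldCurve_smul hζ.cont₀ (fun y hy => (hζ.zero_off y hy).1)
    ((h.cont_r.add h.cont_s).const_smul (1 / 2 : ℝ))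

/-- The forcing is the commutator of the wave operator with the cutoff. -/
theorem foldCurve_control (hB : SmoothMat B) (hζ : FoldCutoff ε ζ ζ₁ ζ₂)
    (h : LocalWave B C a r s V) :
    FoldCurve fun t y => ζ₁ y • (r t y - s t y) + ζ₂ y • V t y
      - act (B ((a + y : ℝ) : Circ)) (ζ₁ y • V t y) :=
  ((foldCurve_smul hζ.cont₁ (fun y hy => (hζ.zero_off y hy).2.1) (h.cont_r.sub h.cont_s)).add
    (foldCurve_smul hζ.cont₂ (fun y hy => (hζ.zero_off y hy).2.2) h.cont_w)).sub
    (foldCurve_act hB a (foldCurve_smul hζ.cont₁ (fun y hy => (hζ.zero_off y hy).2.1) h.cont_w))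

theorem hasDerivAt_value_space (hζ : FoldCutoff ε ζ ζ₁ ζ₂) (h : LocalWave B C a r s V) (t y : ℝ) :
    HasDerivAt (fun y => ζ y • V t y)
      (ζ y • ((1 / 2 : ℝ) • (r t y - s t y)) + ζ₁ y • V t y) y :=
  (hζ.deriv₀ y).smul (h.deriv_x t y)

theorem hasDerivAt_value_time (h : LocalWave B C a r s V) (t y : ℝ) :
    HasDerivAt (fun τ => ζ y • V τ y) (ζ y • ((1 / 2 : ℝ) • (r t y + s t y))) t :=
  (h.deriv_t t y).const_smul (ζ y)

/-- The wound wave solves the forced equation, tested against smooth functions. -/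
theorem hasDerivAt_inner_time (hB : SmoothMat B) (hC : SmoothMat C) (hζ : FoldCutoff ε ζ ζ₁ ζ₂)
    (h : LocalWave B C a r s V) {θ : Circ → E R} (hθ : Smooth θ) (t : ℝ) :
    HasDerivAt (fun t => ⟪(foldCurve_time hζ h).toL2 a t, toL2 hθ.continuous⟫_ℝ)
      (-⟪(foldCurve_space hζ h).toL2 a t, toL2 hθ.dx.continuous⟫_ℝ
        - ⟪mulL2 hB ((foldCurve_space hζ h).toL2 a t) + mulL2 hC ((foldCurve_value hζ h).toL2 a t)
          + (foldCurve_control hB hζ h).toL2 a t, toL2 hθ.continuous⟫_ℝ) t := by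
  let ϑ : ℝ → E R := fun y => θ ((a + y : ℝ) : Circ)
  let ϑ' : ℝ → E R := fun y => dx θ ((a + y : ℝ) : Circ)
  have cϑ : Continuous ϑ := continuous_shift hθ.continuous a
  have cϑ' : Continuous ϑ' := continuous_shift hθ.dx.continuous a
  have dϑ : ∀ y, HasDerivAt ϑ (ϑ' y) y := hθ.hasDerivAt_shift a
  have cβ : Continuous fun y : ℝ => actL (B ((a + y : ℝ) : Circ)) :=
    continuous_actL.comp (continuous_shift hB.continuous a)
  have cγ : Continuous fun y : ℝ => actL (C ((a + y : ℝ) : Circ)) :=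
    continuous_actL.comp (continuous_shift hC.continuous a)
  obtain ⟨G, hG⟩ : ∃ G : ℝ → ℝ → E R, ∀ t y, G t y
      = (-((1 / 2 : ℝ) • actL (B ((a + y : ℝ) : Circ)))) (r t y)
        + ((1 / 2 : ℝ) • actL (B ((a + y : ℝ) : Circ))) (s t y)
        + (-actL (C ((a + y : ℝ) : Circ))) (V t y) := ⟨_, fun _ _ => rfl⟩
  have cG : Continuous fun p : ℝ × ℝ => G p.1 p.2 := by
    simp only [hG]
    exact ((((cβ.const_smul (1 / 2 : ℝ)).neg.comp continuous_snd).clm_apply h.cont_r).add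
      (((cβ.const_smul (1 / 2 : ℝ)).comp continuous_snd).clm_apply h.cont_s)).add
      ((cγ.neg.comp continuous_snd).clm_apply h.cont_w)
  have hout : ∀ y, y ∉ Ioo 0 (4 * Real.pi) → ζ y • ϑ y = 0 ∧ ζ y • ϑ' y + ζ₁ y • ϑ y = 0 :=
    fun y hy => by
      obtain ⟨h0, h1, _⟩ := hζ.zero_off y hy
      rw [h0, h1]
      simp
  have hl : ∀ y ≤ 0, ζ y • ϑ y = 0 ∧ ζ y • ϑ' y + ζ₁ y • ϑ y = 0 := fun y hy =>
    hout y fun h => by linarith [h.1]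
  have hr : ∀ y, 4 * Real.pi ≤ y → ζ y • ϑ y = 0 ∧ ζ y • ϑ' y + ζ₁ y • ϑ y = 0 := fun y hy =>
    hout y fun h => by linarith [h.2]
  have cΦ' : Continuous fun y => ζ y • ϑ' y + ζ₁ y • ϑ y :=
    (hζ.cont₀.smul cϑ').add (hζ.cont₁.smul cϑ)
  have d3 := hasDerivAt_integral_inner_of_chars (fun y => (hζ.deriv₀ y).smul (dϑ y)) cΦ' hl hr
    h.cont_r h.cont_s cG (fun t x => by rw [hG]; exact h.deriv_r t x)
    (fun t x => by rw [hG]; exact h.deriv_s t x) t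
  have cy : Continuous fun y : ℝ => (t, y) := by fun_prop
  have crt : ∀ t, Continuous fun y => r t y := fun t =>
    h.cont_r.comp (by fun_prop : Continuous fun y : ℝ => (t, y))
  have cst : ∀ t, Continuous fun y => s t y := fun t =>
    h.cont_s.comp (by fun_prop : Continuous fun y : ℝ => (t, y))
  have cVt : Continuous fun y => V t y := h.cont_w.comp cy
  have cGt : Continuous fun y => G t y := cG.comp cy
  have e0 : (fun t => ⟪(foldCurve_time hζ h).toL2 a t, toL2 hθ.continuous⟫_ℝ)
      = fun t => ∫ y in (0:ℝ)..(4 * Real.pi), ⟪ζ y • ϑ y, (1 / 2 : ℝ) • (r t y + s t y)⟫_ℝ := by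
    funext t
    rw [FoldCurve.inner_toL2]
    refine intervalIntegral.integral_congr fun y _ => ?_
    simp only [ϑ, real_inner_smul_left, real_inner_smul_right]
    rw [real_inner_comm]
    ring
  rw [e0]
  refine d3.congr_deriv ?_
  -- the remaining terms form the integral of the derivative of `⟪ζ' V, θ⟫`
  have key := integral_deriv_eq_zero (f := fun y => ⟪ζ₁ y • V t y, ϑ y⟫_ℝ)
    (fun y => ((hζ.deriv₁ y).smul (h.deriv_x t y)).inner ℝ (dϑ y))
    (((hζ.cont₁.smul cVt).inner cϑ').add
      (((hζ.cont₁.smul (((crt t).sub (cst t)).const_smul (1 / 2 : ℝ))).add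
        (hζ.cont₂.smul cVt)).inner cϑ))
    (a := 0) (b := 4 * Real.pi) (by simp [(hζ.zero_off 0 (by simp)).2.1])
    (by simp [(hζ.zero_off (4 * Real.pi) (by simp)).2.1])
  have cQ := (foldCurve_space hζ h).continuous_apply t
  have cW := (foldCurve_value hζ h).continuous_apply t
  have cA := (foldCurve_control hB hζ h).continuous_apply t
  rw [inner_add_left, inner_add_left, FoldCurve.inner_mulL2_toL2, FoldCurve.inner_mulL2_toL2,
    FoldCurve.inner_toL2, FoldCurve.inner_toL2]
  refine integral_eq_of_balance (cQ.inner cϑ') ((cβ.clm_apply cQ).inner cϑ)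
    ((cγ.clm_apply cW).inner cϑ) (cA.inner cϑ) (((hζ.cont₁.smul cVt).inner cϑ').add
      (((hζ.cont₁.smul (((crt t).sub (cst t)).const_smul (1 / 2 : ℝ))).add
        (hζ.cont₂.smul cVt)).inner cϑ)) (fun y => ?_) key
  have e1 : ∀ (A : Matrix (Fin R) (Fin R) ℝ) (u v : E R), act A (u + v) = act A u + act A v :=
    fun A => map_add (actL A)
  have e2 : ∀ (A : Matrix (Fin R) (Fin R) ℝ) (c : ℝ) (v : E R), act A (c • v) = c • act A v :=
    fun A => map_smul (actL A)
  have e3 : ∀ (A : Matrix (Fin R) (Fin R) ℝ) (u v : E R), act A (u - v) = act A u - act A v :=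
    fun A => map_sub (actL A)
  simp only [ϑ, ϑ', hG, Pi.smul_apply', Pi.smul_apply, Pi.add_apply, Pi.sub_apply, inner_sub_right,
    neg_apply, smul_apply, actL_apply, e1, e2, e3, inner_add_left, inner_sub_left, inner_add_right,
    real_inner_smul_left, real_inner_smul_right, inner_neg_right]
  simp only [real_inner_comm (θ ((a + y : ℝ) : Circ)), real_inner_comm (dx θ ((a + y : ℝ) : Circ))]
  ring

end FoldedWave

/-! ### Majorants and bounds of wound functions -/

section Majorants

/-- The square-integrable function of one null coordinate that dominates a wound wave: the interval
`[0, 4π]` is wound twice and its origin is arbitrary, so that three translates are needed. -/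
theorem exists_majorant {m : ℝ → ℝ} (cm : Continuous m) (hm : ∀ u, 0 ≤ m u) {κ b D : ℝ}
    (hκ : 0 ≤ κ) (hb : 0 ≤ b) (hD : ∫ u in (-(4 * Real.pi))..(36 * Real.pi), m u ≤ D) (c : ℕ → ℝ) :
    ∃ M : ℝ → ℝ≥0∞, Measurable M ∧
      ∫⁻ u, M u ^ 2 ≤ ENNReal.ofReal (18 * κ ^ 2 * (D + 130 * b)) ∧
      ∀ u, ∀ i < 2, u + c i ∈ Icc (-(4 * Real.pi)) (36 * Real.pi) →
        u + c (i + 1) ∈ Icc (-(4 * Real.pi)) (36 * Real.pi) → ∀ z,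
        z ≤ κ * (√(m (u + c i)) + √b) + κ * (√(m (u + c (i + 1))) + √b) →
        ENNReal.ofReal z ≤ M u := by
  have hpi := Real.pi_pos
  let I : Set ℝ := Icc (-(4 * Real.pi)) (36 * Real.pi)
  let g : ℝ → ℝ := fun u => κ * (√(m u) + √b)
  have cg : Continuous g := continuous_const.mul
      ((Real.continuous_sqrt.comp cm).add continuous_const)
  have cg2 : Continuous fun u => g u ^ 2 := cg.pow 2
  have g0 : ∀ u, 0 ≤ g u := fun u => by positivity
  let k : ℝ → ℝ := I.indicator g
  have mk : Measurable k := cg.measurable.indicator measurableSet_Icc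
  have k0 : ∀ u, 0 ≤ k u := fun u => indicator_nonneg (fun u _ => g0 u) u
  have hk : ∀ u ∈ I, k u = g u := fun u hu => indicator_of_mem hu g
  have hk2 : ∫⁻ u, ENNReal.ofReal (k u ^ 2) ≤ ENNReal.ofReal (2 * κ ^ 2 * (D + 130 * b)) := by
    have e1 : (fun u => ENNReal.ofReal (k u ^ 2))
        = I.indicator fun u => ENNReal.ofReal (g u ^ 2) := by
      funext u
      by_cases hu : u ∈ I
      · rw [hk u hu, indicator_of_mem hu]
      · simp [k, hu]
    rw [e1, lintegral_indicator measurableSet_Icc,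
      ← ofReal_integral_eq_lintegral_ofReal cg2.continuousOn.integrableOn_Icc
        (ae_of_all _ fun u => sq_nonneg (g u)), integral_Icc_eq_integral_Ioc,
      ← intervalIntegral.integral_of_le (by linarith)]
    refine ENNReal.ofReal_le_ofReal ?_
    have h1 : ∫ u in (-(4 * Real.pi))..(36 * Real.pi), g u ^ 2
        ≤ ∫ u in (-(4 * Real.pi))..(36 * Real.pi), 2 * κ ^ 2 * (m u + b) := by
      refine intervalIntegral.integral_mono_on (by linarith) (cg2.intervalIntegrable _ _)
        ((continuous_const.mul (cm.add continuous_const)).intervalIntegrable _ _) fun u _ => ?_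
      have h2 := Real.sq_sqrt (hm u)
      have h3 := Real.sq_sqrt hb
      simp only [g]
      rw [mul_pow, mul_comm 2, mul_assoc]
      refine mul_le_mul_of_nonneg_left ?_ (sq_nonneg κ)
      nlinarith [sq_nonneg (√(m u) - √b)]
    refine h1.trans ?_
    rw [intervalIntegral.integral_const_mul, intervalIntegral.integral_add
      (cm.intervalIntegrable _ _) intervalIntegrable_const, intervalIntegral.integral_const,
      smul_eq_mul]
    refine mul_le_mul_of_nonneg_left ?_ (by positivity)
    nlinarith [Real.pi_lt_d2]
  have hshift : ∀ d : ℝ, ∫⁻ u, ENNReal.ofReal (k (u + d) ^ 2)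
      ≤ ENNReal.ofReal (2 * κ ^ 2 * (D + 130 * b)) := fun d =>
    (lintegral_add_right_eq_self (fun u => ENNReal.ofReal (k u ^ 2)) d).trans_le hk2
  have ms : ∀ d : ℝ, Measurable fun u => k (u + d) := fun d => mk.comp (measurable_id.add_const d)
  have mo : ∀ d : ℝ, Measurable fun u => ENNReal.ofReal (k (u + d) ^ 2) := fun d =>
    ((ms d).pow_const 2).ennreal_ofReal
  have mo2 : Measurable fun u => ENNReal.ofReal (k (u + c 0) ^ 2)
      + ENNReal.ofReal (k (u + c 1) ^ 2) :=
    (mo _).add (mo _)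
  have mo3 : Measurable fun u => ENNReal.ofReal (k (u + c 0) ^ 2) + ENNReal.ofReal (k (u + c 1) ^ 2)
      + ENNReal.ofReal (k (u + c 2) ^ 2) := mo2.add (mo _)
  refine ⟨fun u => ENNReal.ofReal (k (u + c 0) + k (u + c 1) + k (u + c 2)),
    (((ms _).add (ms _)).add (ms _)).ennreal_ofReal, ?_, ?_⟩
  · calc ∫⁻ u, ENNReal.ofReal (k (u + c 0) + k (u + c 1) + k (u + c 2)) ^ 2
        ≤ ∫⁻ u, 3 * (ENNReal.ofReal (k (u + c 0) ^ 2) + ENNReal.ofReal (k (u + c 1) ^ 2)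
            + ENNReal.ofReal (k (u + c 2) ^ 2)) := by
          refine lintegral_mono fun u => ?_
          rw [← ENNReal.ofReal_pow (add_nonneg (add_nonneg (k0 _) (k0 _)) (k0 _)),
            ← ENNReal.ofReal_add (sq_nonneg _) (sq_nonneg _),
            ← ENNReal.ofReal_add (by positivity) (sq_nonneg _),
            show (3 : ℝ≥0∞) = ENNReal.ofReal 3 by norm_num, ← ENNReal.ofReal_mul (by norm_num)]
          refine ENNReal.ofReal_le_ofReal ?_
          nlinarith [sq_nonneg (k (u + c 0) - k (u + c 1)), sq_nonneg (k (u + c 0) - k (u + c 2)),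
            sq_nonneg (k (u + c 1) - k (u + c 2))]
      _ = 3 * ((∫⁻ u, ENNReal.ofReal (k (u + c 0) ^ 2)) + (∫⁻ u, ENNReal.ofReal (k (u + c 1) ^ 2))
            + ∫⁻ u, ENNReal.ofReal (k (u + c 2) ^ 2)) := by
          rw [lintegral_const_mul _ mo3, lintegral_add_left mo2, lintegral_add_left (mo _)]
      _ ≤ 3 * (ENNReal.ofReal (2 * κ ^ 2 * (D + 130 * b))
            + ENNReal.ofReal (2 * κ ^ 2 * (D + 130 * b))
            + ENNReal.ofReal (2 * κ ^ 2 * (D + 130 * b))) := by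
          gcongr <;> exact hshift _
      _ = ENNReal.ofReal (18 * κ ^ 2 * (D + 130 * b)) := by
          have hD0 : 0 ≤ D := le_trans (intervalIntegral.integral_nonneg (by linarith)
            fun u _ => hm u) hD
          rw [← ENNReal.ofReal_add (by positivity) (by positivity),
            ← ENNReal.ofReal_add (by positivity) (by positivity),
            show (3 : ℝ≥0∞) = ENNReal.ofReal 3 by norm_num, ← ENNReal.ofReal_mul (by norm_num)]
          congr 1
          ring
  · intro u i hi h1 h2 z hz
    refine ENNReal.ofReal_le_ofReal (hz.trans ?_)
    change g (u + c i) + g (u + c (i + 1)) ≤ _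
    rw [← hk _ h1, ← hk _ h2]
    interval_cases i
    · linarith [k0 (u + c 2)]
    · linarith [k0 (u + c 0)]

/-- The coordinate from `a` differs from `x - a` by at most one period. -/
theorem exists_coordFrom_eq {a x : ℝ} (ha : a ∈ Ico 0 (2 * Real.pi))
    (hx : x ∈ Ico 0 (2 * Real.pi)) :
    ∃ i : ℕ, i < 2 ∧ coordFrom a (x : Circ) = x - a + i * (2 * Real.pi) := by
  by_cases h : a ≤ x
  · refine ⟨0, by norm_num, ?_⟩
    have e := coordFrom_coe (a := a) (y := x - a) ⟨by linarith, by linarith [hx.2, ha.1]⟩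
    rw [add_sub_cancel] at e
    rw [e]
    simp
  · push Not at h
    refine ⟨1, by norm_num, ?_⟩
    have e := coordFrom_coe (a := a) (y := x - a + 2 * Real.pi)
      ⟨by linarith [hx.1, ha.2], by linarith⟩
    rw [coe_add_two_pi, add_sub_cancel] at e
    rw [e]
    simp

theorem norm_fold_le {F : Type*} [NormedAddCommGroup F] {a : ℝ} {Φ : ℝ → F} {g : ℝ → ℝ} {x : Circ}
    (h : ∀ y ∈ Icc 0 (4 * Real.pi), ‖Φ y‖ ≤ g y) :
    ‖fold a Φ x‖ ≤ g (coordFrom a x) + g (coordFrom a x + 2 * Real.pi) := by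
  have hy := coordFrom_mem a x
  have hpi := Real.pi_pos
  exact (norm_add_le _ _).trans (add_le_add (h _ ⟨hy.1, by linarith [hy.2]⟩)
    (h _ ⟨by linarith [hy.1], by linarith [hy.2]⟩))

end Majorants

section FoldedBounds

variable {R : ℕ}

/-- On the line of constant `t`, functions of one null coordinate are integrable in `y`, so
majorants along characteristics control the `L²` norm at each time. -/
theorem FoldCurve.norm_toL2_sq_le_of_le {Φ r s V : ℝ → ℝ → E R} (h : FoldCurve Φ) {a t c D : ℝ}
    {mr ms : ℝ → ℝ} (cmr : Continuous mr) (cms : Continuous ms) (mr0 : ∀ u, 0 ≤ mr u)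
    (ms0 : ∀ u, 0 ≤ ms u)
    (ht : t ∈ Icc 0 (32 * Real.pi))
    (hr : ∀ y ∈ Icc 0 (4 * Real.pi), ‖r t y‖ ^ 2 ≤ mr (t + y))
    (hs : ∀ y ∈ Icc 0 (4 * Real.pi), ‖s t y‖ ^ 2 ≤ ms (t - y))
    (hV : ∀ y ∈ Icc 0 (4 * Real.pi), ‖V t y‖ ^ 2 ≤ D)
    (imr : ∫ u in (-(4 * Real.pi))..(36 * Real.pi), mr u ≤ D)
    (ims : ∫ u in (-(4 * Real.pi))..(36 * Real.pi), ms u ≤ D)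
    (hΦ : ∀ y ∈ Icc 0 (4 * Real.pi), ‖Φ t y‖ ≤ c * (‖r t y‖ + ‖s t y‖ + ‖V t y‖)) :
    ‖h.toL2 a t‖ ^ 2 ≤ 90 * c ^ 2 * D := by
  have hpi := Real.pi_pos
  have cy : Continuous fun y : ℝ => (t, y) := by fun_prop
  have cΦ := h.continuous_apply t
  have D0 : 0 ≤ D := (sq_nonneg _).trans (hV 0 ⟨le_rfl, by positivity⟩)
  have e1 : ∫ y in (0:ℝ)..(4 * Real.pi), mr (t + y) ≤ D := by
    rw [intervalIntegral.integral_comp_add_left]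
    exact (integral_le_of_subinterval cmr mr0 (by linarith [ht.1]) (by linarith)
      (by linarith [ht.2])).trans imr
  have e2 : ∫ y in (0:ℝ)..(4 * Real.pi), ms (t - y) ≤ D := by
    rw [intervalIntegral.integral_comp_sub_left]
    exact (integral_le_of_subinterval cms ms0 (by linarith [ht.1]) (by linarith)
      (by linarith [ht.2])).trans ims
  have i1 : Continuous fun y => mr (t + y) := cmr.comp (by fun_prop)
  have i2 : Continuous fun y => ms (t - y) := cms.comp (by fun_prop)
  have i12 : Continuous fun y => mr (t + y) + ms (t - y) := i1.add i2
  have h1 : ∫ y in (0:ℝ)..(4 * Real.pi), ‖Φ t y‖ ^ 2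
      ≤ ∫ y in (0:ℝ)..(4 * Real.pi), 3 * c ^ 2 * (mr (t + y) + ms (t - y) + D) := by
    refine intervalIntegral.integral_mono_on (by linarith) ((cΦ.norm.pow 2).intervalIntegrable _ _)
      ((continuous_const.mul (i12.add continuous_const)).intervalIntegrable _ _)
      fun y hy => ?_
    have h2 := pow_le_pow_left₀ (norm_nonneg _) (hΦ y hy) 2
    have h3 : (‖r t y‖ + ‖s t y‖ + ‖V t y‖) ^ 2
        ≤ 3 * (‖r t y‖ ^ 2 + ‖s t y‖ ^ 2 + ‖V t y‖ ^ 2) := by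
      nlinarith [sq_nonneg (‖r t y‖ - ‖s t y‖), sq_nonneg (‖r t y‖ - ‖V t y‖),
        sq_nonneg (‖s t y‖ - ‖V t y‖)]
    rw [mul_pow] at h2
    nlinarith [hr y hy, hs y hy, hV y hy, sq_nonneg c]
  have h4 := h.norm_toL2_sq_le a t
  rw [intervalIntegral.integral_const_mul, intervalIntegral.integral_add
    (i12.intervalIntegrable _ _) intervalIntegrable_const, intervalIntegral.integral_add
    (i1.intervalIntegrable _ _) (i2.intervalIntegrable _ _), intervalIntegral.integral_const,
    smul_eq_mul] at h1
  have h5 : (∫ y in (0:ℝ)..(4 * Real.pi), mr (t + y)) + (∫ y in (0:ℝ)..(4 * Real.pi), ms (t - y))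
      + (4 * Real.pi - 0) * D ≤ 15 * D := by nlinarith [Real.pi_lt_d2]
  nlinarith [mul_le_mul_of_nonneg_left h5 (by positivity : 0 ≤ 3 * c ^ 2)]

/-- Winding a periodic function multiplied by the cutoff gives back the function. -/
theorem fold_partition {ε a : ℝ} {ζ ζ₁ ζ₂ : ℝ → ℝ} (hζ : FoldCutoff ε ζ ζ₁ ζ₂) {Φ : ℝ → E R}
    {f : Circ → E R} (h : ∀ y ∈ Icc 0 (4 * Real.pi), Φ y = ζ y • f ((a + y : ℝ) : Circ)) :
    fold a Φ = f := by
  funext x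
  have hy := coordFrom_mem a x
  have hpi := Real.pi_pos
  rw [fold, h _ ⟨hy.1, by linarith [hy.2]⟩, h _ ⟨by linarith [hy.1], by linarith [hy.2]⟩,
    coe_add_two_pi, coe_add_coordFrom, ← add_smul, hζ.partition _ ⟨hy.1, hy.2.le⟩, one_smul]

end FoldedBounds

/-! ### Steered waves on the circle and on the double window -/

section Steering

variable {R : ℕ} {B C : Circ → Matrix (Fin R) (Fin R) ℝ}

/-- A controlled wave on the circle, steered from `(w₀, w₁)` to rest in time `32π`, together with
representatives `W`, `Gu`, `Gv` of `w`, `w_u`, `w_v` and functions `μu`, `μv` of one null coordinate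
that dominate `w_u` and `w_v`. All the quantities are bounded by `A`. -/
structure SteeredWave {ω : Set Circ} (hω : IsOpen ω) (B C : Circ → Matrix (Fin R) (Fin R) ℝ) (A : ℝ)
    (w₀ : H1 R) (w₁ : L2 R) (α : ℝ → L2 R) (w : ℝ → H1 R) (p : ℝ → L2 R) (W Gu Gv : ℝ → Circ → E R)
    (μu μv : ℝ → ℝ≥0∞) : Prop where
  cont_α : ContinuousOn α (Icc 0 (32 * Real.pi))
  chi_α : ∀ t ∈ Icc 0 (32 * Real.pi), chi hω (α t) = α t
  sol : IsEnergySolution B C (32 * Real.pi) (fun t => chi hω (α t)) w p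
  init_w : w 0 = w₀
  init_p : p 0 = w₁
  final_w : w (32 * Real.pi) = 0
  final_p : p (32 * Real.pi) = 0
  bound : ∀ t ∈ Icc 0 (32 * Real.pi), ‖α t‖ ≤ A ∧ ‖w t‖ ≤ A ∧ ‖p t‖ ≤ A
  cont_W : ContinuousOn (Function.uncurry W) (Icc 0 (32 * Real.pi) ×ˢ univ)
  rep_W : ∀ t ∈ Icc 0 (32 * Real.pi), W t =ᵐ[volume] valH (w t)
  bound_W : ∀ t ∈ Icc 0 (32 * Real.pi), ∀ x, ‖W t x‖ ≤ A
  meas_u : StronglyMeasurable (Function.uncurry Gu)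
  meas_v : StronglyMeasurable (Function.uncurry Gv)
  rep_u : ∀ t ∈ Icc 0 (32 * Real.pi), Gu t =ᵐ[volume] ((1 / 2 : ℝ) • (p t + derH (w t)) : L2 R)
  rep_v : ∀ t ∈ Icc 0 (32 * Real.pi), Gv t =ᵐ[volume] ((1 / 2 : ℝ) • (p t - derH (w t)) : L2 R)
  le_u : ∀ t ∈ Icc 0 (32 * Real.pi), ∀ x ∈ Ico 0 (2 * Real.pi), ‖Gu t (x : Circ)‖ₑ ≤ μu (t + x)
  le_v : ∀ t ∈ Icc 0 (32 * Real.pi), ∀ x ∈ Ico 0 (2 * Real.pi), ‖Gv t (x : Circ)‖ₑ ≤ μv (t - x)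
  meas_μu : Measurable μu
  meas_μv : Measurable μv
  int_u : ∫⁻ u, μu u ^ 2 ≤ ENNReal.ofReal (A ^ 2)
  int_v : ∫⁻ v, μv v ^ 2 ≤ ENNReal.ofReal (A ^ 2)

/-- A wave on the double window `[0, 4π]`, in the coordinate `y` with `x = a + y`, that starts from
the given periodic data and is at rest at time `32π`. The functions `mr`, `ms` dominate the
characteristic derivatives. -/
structure LocalSteering (B C : Circ → Matrix (Fin R) (Fin R) ℝ) (a D : ℝ) (f₀ f₀' f₁ : Circ → E R)
    (r s V : ℝ → ℝ → E R) (mr ms : ℝ → ℝ) : Prop where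
  wave : LocalWave B C a r s V
  init : ∀ y ∈ Icc 0 (4 * Real.pi), r 0 y = f₁ ((a + y : ℝ) : Circ) + f₀' ((a + y : ℝ) : Circ) ∧
    s 0 y = f₁ ((a + y : ℝ) : Circ) - f₀' ((a + y : ℝ) : Circ) ∧ V 0 y = f₀ ((a + y : ℝ) : Circ)
  final : ∀ y ∈ Icc 0 (4 * Real.pi), r (32 * Real.pi) y = 0 ∧ s (32 * Real.pi) y = 0 ∧
    V (32 * Real.pi) y = 0
  bound : ∀ t ∈ Icc 0 (32 * Real.pi), ∀ y ∈ Icc 0 (4 * Real.pi), ‖V t y‖ ^ 2 ≤ D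
  cont_mr : Continuous mr
  cont_ms : Continuous ms
  mr_nonneg : ∀ u, 0 ≤ mr u
  ms_nonneg : ∀ u, 0 ≤ ms u
  le_mr : ∀ t, ∀ y ∈ Icc 0 (4 * Real.pi), ‖r t y‖ ^ 2 ≤ mr (t + y)
  le_ms : ∀ t, ∀ y ∈ Icc 0 (4 * Real.pi), ‖s t y‖ ^ 2 ≤ ms (t - y)
  int_mr : ∫ u in (-(4 * Real.pi))..(36 * Real.pi), mr u ≤ D
  int_ms : ∫ u in (-(4 * Real.pi))..(36 * Real.pi), ms u ≤ D

theorem integral_shift_period {f : Circ → ℝ} (a : ℝ) :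
    ∫ y in (0:ℝ)..(2 * Real.pi), f ((a + y : ℝ) : Circ)
      = ∫ s in a..(a + 2 * Real.pi), f (s : Circ) := by
  have e := intervalIntegral.integral_comp_add_left (a := 0) (b := 2 * Real.pi)
    (fun s : ℝ => f (s : Circ)) a
  rwa [add_zero] at e

/-- `exists_steered_solution` for the coefficients and the data read in the coordinate `y`. -/
theorem exists_localSteering (hB : SmoothMat B) (hC : SmoothMat C) (a : ℝ) :
    ∃ K, 0 ≤ K ∧ ∀ (f₀ f₁ : Circ → E R) (h₀ : Smooth f₀) (h₁ : Continuous f₁),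
      ∃ r s V mr ms, LocalSteering B C a (K * (‖ofSmooth f₀ h₀‖ ^ 2 + ‖toL2 h₁‖ ^ 2))
        f₀ (dx f₀) f₁ r s V mr ms := by
  obtain ⟨KB, hKB, hB'⟩ := exists_norm_actL_le hB
  obtain ⟨KC, hKC, hC'⟩ := exists_norm_actL_le hC
  obtain ⟨K, hK, H⟩ := exists_steered_solution
    (β := fun y : ℝ => actL (B ((a + y : ℝ) : Circ)))
    (γ := fun y : ℝ => actL (C ((a + y : ℝ) : Circ)))
    (continuous_actL.comp (continuous_shift hB.continuous a))
    (continuous_actL.comp (continuous_shift hC.continuous a))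
    (K := max KB KC) (fun x => (hB' _).trans (le_max_left _ _))
    fun x => (hC' _).trans (le_max_right _ _)
  refine ⟨K, hK, fun f₀ f₁ h₀ h₁ => ?_⟩
  have per : ∀ f : Circ → E R,
      Function.Periodic (fun y : ℝ => f ((a + y : ℝ) : Circ)) (2 * Real.pi) :=
    fun f y => congrArg f (coe_add_two_pi a y)
  have c₀ := continuous_shift h₀.continuous a
  have c₀' := continuous_shift h₀.dx.continuous a
  have c₁ := continuous_shift h₁ a
  have n₀ : Continuous fun y : ℝ => ‖f₀ ((a + y : ℝ) : Circ)‖ ^ 2 := c₀.norm.pow 2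
  have n₀' : Continuous fun y : ℝ => ‖dx f₀ ((a + y : ℝ) : Circ)‖ ^ 2 := c₀'.norm.pow 2
  have n₁ : Continuous fun y : ℝ => ‖f₁ ((a + y : ℝ) : Circ)‖ ^ 2 := c₁.norm.pow 2
  have n₂ : Continuous fun y : ℝ => ‖f₀ ((a + y : ℝ) : Circ)‖ ^ 2
      + ‖dx f₀ ((a + y : ℝ) : Circ)‖ ^ 2 :=
    n₀.add n₀'
  obtain ⟨r, s, V, h1, h2, h3, h4, mr, ms, h5, h6, h7, h8, h9, h10, h11, h12⟩ :=
    H _ _ _ (h₀.hasDerivAt_shift a) c₀' c₁ (per _) (per _) (per _)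
      (‖ofSmooth f₀ h₀‖ ^ 2 + ‖toL2 h₁‖ ^ 2) (by
        rw [norm_sq_H1, valH_ofSmooth, derH_ofSmooth, norm_toL2_sq _ a, norm_toL2_sq _ a,
          norm_toL2_sq _ a, intervalIntegral.integral_add (n₂.intervalIntegrable _ _)
          (n₁.intervalIntegrable _ _), intervalIntegral.integral_add (n₀.intervalIntegrable _ _)
          (n₀'.intervalIntegrable _ _), integral_shift_period (f := fun x => ‖f₀ x‖ ^ 2),
          integral_shift_period (f := fun x => ‖dx f₀ x‖ ^ 2),
          integral_shift_period (f := fun x => ‖f₁ x‖ ^ 2)])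
  exact ⟨r, s, V, mr, ms, h1, h2, h3, h4, h5, h6, h7, h8, h9, h10, h11, h12⟩

theorem LocalSteering.norm_toL2_sq_le {a D c : ℝ} {f₀ f₀' f₁ : Circ → E R} {r s V : ℝ → ℝ → E R}
    {mr ms : ℝ → ℝ} (h : LocalSteering B C a D f₀ f₀' f₁ r s V mr ms) {Φ : ℝ → ℝ → E R}
    (hΦ : FoldCurve Φ) {t : ℝ} (ht : t ∈ Icc 0 (32 * Real.pi))
    (hle : ∀ y, ‖Φ t y‖ ≤ c * (‖r t y‖ + ‖s t y‖ + ‖V t y‖)) :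
    ‖hΦ.toL2 a t‖ ^ 2 ≤ 90 * c ^ 2 * D :=
  hΦ.norm_toL2_sq_le_of_le h.cont_mr h.cont_ms h.mr_nonneg h.ms_nonneg ht (h.le_mr t) (h.le_ms t)
    (h.bound t ht) h.int_mr h.int_ms fun y _ => hle y

theorem norm_smul_le_of_abs_le {F : Type*} [NormedAddCommGroup F] [NormedSpace ℝ F] {z κ : ℝ}
    (h : |z| ≤ κ) (v : F) : ‖z • v‖ ≤ κ * ‖v‖ := by
  rw [norm_smul, Real.norm_eq_abs]
  exact mul_le_mul_of_nonneg_right h (norm_nonneg v)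

variable {ε : ℝ} {ζ ζ₁ ζ₂ : ℝ → ℝ}

/-- With `r` for `w_t + w_x`, this is the derivative `w_u` of the cut-off wave. -/
theorem foldCurve_null (hζ : FoldCutoff ε ζ ζ₁ ζ₂) {r V : ℝ → ℝ → E R}
    (cr : Continuous fun p : ℝ × ℝ => r p.1 p.2) (cV : Continuous fun p : ℝ × ℝ => V p.1 p.2) :
    FoldCurve fun t y => (1 / 2 : ℝ) • (ζ y • r t y + ζ₁ y • V t y) :=
  ((foldCurve_smul hζ.cont₀ (fun y hy => (hζ.zero_off y hy).1) cr).add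
    (foldCurve_smul hζ.cont₁ (fun y hy => (hζ.zero_off y hy).2.1) cV)).const_smul _

/-- The bound of `w_u` after winding, by the majorant at the two points of the double window above
`x`. -/
theorem norm_fold_null_le {κ D a : ℝ} (hκ : ∀ y, |ζ y| ≤ κ ∧ |ζ₁ y| ≤ κ) {r V : ℝ → E R}
    {m : ℝ → ℝ} (hr : ∀ y ∈ Icc 0 (4 * Real.pi), ‖r y‖ ^ 2 ≤ m y)
    (hV : ∀ y ∈ Icc 0 (4 * Real.pi), ‖V y‖ ^ 2 ≤ D) (x : Circ) :
    ‖fold a (fun y => (1 / 2 : ℝ) • (ζ y • r y + ζ₁ y • V y)) x‖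
      ≤ κ * (√(m (coordFrom a x)) + √D) + κ * (√(m (coordFrom a x + 2 * Real.pi)) + √D) := by
  have hκ0 : 0 ≤ κ := (abs_nonneg _).trans (hκ 0).1
  refine norm_fold_le (g := fun y => κ * (√(m y) + √D)) fun y hy => ?_
  have h1 := Real.le_sqrt_of_sq_le (hr y hy)
  have h2 := Real.le_sqrt_of_sq_le (hV y hy)
  rw [norm_smul, Real.norm_eq_abs, abs_of_pos (by norm_num : (0:ℝ) < 1 / 2)]
  have h3 := norm_add_le (ζ y • r y) (ζ₁ y • V y)
  have h4 := norm_smul_le_of_abs_le (hκ y).1 (r y)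
  have h5 := norm_smul_le_of_abs_le (hκ y).2 (V y)
  have h6 := mul_le_mul_of_nonneg_left h1 hκ0
  have h7 := mul_le_mul_of_nonneg_left h2 hκ0
  have h8 := norm_nonneg (ζ y • r y + ζ₁ y • V y)
  linarith

end Steering

/-! ### Steering smooth data on the circle -/

section Winding

variable {R : ℕ} {B C : Circ → Matrix (Fin R) (Fin R) ℝ} {ε : ℝ} {ζ ζ₁ ζ₂ : ℝ → ℝ}

/-- The wound wave, as a curve in `H¹`. -/
def woundWave (hζ : FoldCutoff ε ζ ζ₁ ζ₂) {a : ℝ} {r s V : ℝ → ℝ → E R}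
    (h : LocalWave B C a r s V) (t : ℝ) : H1 R :=
  mkH1 ((foldCurve_value hζ h).toL2 a t) ((foldCurve_space hζ h).toL2 a t)
    fun _ hθ => (foldCurve_value hζ h).inner_toL2_dx (foldCurve_space hζ h)
      (hasDerivAt_value_space hζ h) a t hθ

theorem continuous_woundWave (hζ : FoldCutoff ε ζ ζ₁ ζ₂) {a : ℝ} {r s V : ℝ → ℝ → E R}
    (h : LocalWave B C a r s V) : Continuous (woundWave hζ h) :=
  Continuous.subtype_mk ((WithLp.prod_continuous_toLp 2 (L2 R) (L2 R)).comp
    (((foldCurve_value hζ h).continuous_toL2 a).prodMk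
      ((foldCurve_space hζ h).continuous_toL2 a))) _

theorem isEnergySolution_woundWave (hB : SmoothMat B) (hC : SmoothMat C)
    (hζ : FoldCutoff ε ζ ζ₁ ζ₂) {a : ℝ} {r s V : ℝ → ℝ → E R} (h : LocalWave B C a r s V) (T : ℝ) :
    IsEnergySolution B C T ((foldCurve_control hB hζ h).toL2 a) (woundWave hζ h)
      ((foldCurve_time hζ h).toL2 a) :=
  isEnergySolution_of_smooth hB hC ((foldCurve_control hB hζ h).continuous_toL2 a).continuousOn
    (continuous_woundWave hζ h).continuousOn ((foldCurve_time hζ h).continuous_toL2 a).continuousOn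
    (fun t _ => ((foldCurve_value hζ h).hasDerivAt_toL2 (foldCurve_time hζ h)
      (hasDerivAt_value_time h) a t).hasDerivWithinAt)
    fun _ hθ t _ => (hasDerivAt_inner_time hB hC hζ h hθ t).hasDerivWithinAt

theorem fold_eq_zero_of_forall {F : Type*} [NormedAddCommGroup F] {a : ℝ} {Φ : ℝ → F}
    (h : ∀ y ∈ Icc 0 (4 * Real.pi), Φ y = 0) : fold a Φ = 0 := by
  funext x
  have hy := coordFrom_mem a x
  have hpi := Real.pi_pos
  rw [fold, h _ ⟨hy.1, by linarith [hy.2]⟩, h _ ⟨by linarith [hy.1], by linarith [hy.2]⟩, add_zero]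
  rfl

theorem FoldCurve.toL2_eq_zero {Φ : ℝ → ℝ → E R} (h : FoldCurve Φ) {a t : ℝ}
    (h0 : ∀ y ∈ Icc 0 (4 * Real.pi), Φ t y = 0) : h.toL2 a t = 0 :=
  (toL2_congr (h.continuous_fold_apply a t) continuous_const (fold_eq_zero_of_forall h0)).trans
      (MemLp.toLp_zero _)

theorem half_smul_add_fold {Φ Ψ Θ : ℝ → E R} {a : ℝ}
    (h : ∀ y, (1 / 2 : ℝ) • (Φ y + Ψ y) = Θ y) (x : Circ) :
    (1 / 2 : ℝ) • (fold a Φ x + fold a Ψ x) = fold a Θ x := by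
  simp only [fold, ← h, smul_add]
  abel

theorem half_smul_sub_fold {Φ Ψ Θ : ℝ → E R} {a : ℝ}
    (h : ∀ y, (1 / 2 : ℝ) • (Φ y - Ψ y) = Θ y) (x : Circ) :
    (1 / 2 : ℝ) • (fold a Φ x - fold a Ψ x) = fold a Θ x := by
  simp only [fold, ← h, smul_sub, smul_add]
  abel

/-- A continuous representative of `w_u = (w_t + w_x) / 2` for the wound wave. -/
theorem coeFn_half_time_add_der (hζ : FoldCutoff ε ζ ζ₁ ζ₂) {a : ℝ} {r s V : ℝ → ℝ → E R}
    (h : LocalWave B C a r s V) (t : ℝ) :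
    (fold a fun y => (1 / 2 : ℝ) • (ζ y • r t y + ζ₁ y • V t y)) =ᵐ[volume]
      ((1 / 2 : ℝ) • ((foldCurve_time hζ h).toL2 a t + derH (woundWave hζ h t)) : L2 R) := by
  have e1 := MemLp.coeFn_toLp (memLp_of_continuous
    ((foldCurve_time hζ h).continuous_fold_apply a t))
  have e2 := MemLp.coeFn_toLp (memLp_of_continuous
    ((foldCurve_space hζ h).continuous_fold_apply a t))
  filter_upwards [e1, e2, Lp.coeFn_smul (1 / 2 : ℝ) ((foldCurve_time hζ h).toL2 a t
    + derH (woundWave hζ h t)), Lp.coeFn_add ((foldCurve_time hζ h).toL2 a t)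
    (derH (woundWave hζ h t))] with x x1 x2 x3 x4
  rw [x3, Pi.smul_apply, x4, Pi.add_apply]
  change _ = (1 / 2 : ℝ) • (toL2 ((foldCurve_time hζ h).continuous_fold_apply a t) x
    + toL2 ((foldCurve_space hζ h).continuous_fold_apply a t) x)
  rw [x1, x2]
  refine (half_smul_add_fold (fun y => ?_) x).symm
  module

/-- A continuous representative of `w_v = (w_t - w_x) / 2` for the wound wave. -/
theorem coeFn_half_time_sub_der (hζ : FoldCutoff ε ζ ζ₁ ζ₂) {a : ℝ} {r s V : ℝ → ℝ → E R}
    (h : LocalWave B C a r s V) (t : ℝ) :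
    (fold a fun y => (1 / 2 : ℝ) • (ζ y • s t y - ζ₁ y • V t y)) =ᵐ[volume]
      ((1 / 2 : ℝ) • ((foldCurve_time hζ h).toL2 a t - derH (woundWave hζ h t)) : L2 R) := by
  have e1 := MemLp.coeFn_toLp (memLp_of_continuous
    ((foldCurve_time hζ h).continuous_fold_apply a t))
  have e2 := MemLp.coeFn_toLp (memLp_of_continuous
    ((foldCurve_space hζ h).continuous_fold_apply a t))
  filter_upwards [e1, e2, Lp.coeFn_smul (1 / 2 : ℝ) ((foldCurve_time hζ h).toL2 a t
    - derH (woundWave hζ h t)), Lp.coeFn_sub ((foldCurve_time hζ h).toL2 a t)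
    (derH (woundWave hζ h t))] with x x1 x2 x3 x4
  rw [x3, Pi.smul_apply, x4, Pi.sub_apply]
  change _ = (1 / 2 : ℝ) • (toL2 ((foldCurve_time hζ h).continuous_fold_apply a t) x
    - toL2 ((foldCurve_space hζ h).continuous_fold_apply a t) x)
  rw [x1, x2]
  refine (half_smul_sub_fold (fun y => ?_) x).symm
  module

/-- The bounds in `L²`, in `H¹` and in `L²` of the control, of the wave and of its time derivative.
-/
theorem LocalSteering.norm_le (hB : SmoothMat B) (hζ : FoldCutoff ε ζ ζ₁ ζ₂) {a : ℝ} {K κ D A : ℝ}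
    (hK : 0 ≤ K) (hBK : ∀ x, ‖actL (B x)‖ ≤ K)
    (hκ : ∀ y, |ζ y| ≤ κ ∧ |ζ₁ y| ≤ κ ∧ |ζ₂ y| ≤ κ) {f₀ f₀' f₁ : Circ → E R}
    {r s V : ℝ → ℝ → E R} {mr ms : ℝ → ℝ} (h : LocalSteering B C a D f₀ f₀' f₁ r s V mr ms)
    {t : ℝ} (ht : t ∈ Icc 0 (32 * Real.pi)) (hA : 0 ≤ A)
    (hA' : 2400 * (κ * (1 + K)) ^ 2 * D ≤ A ^ 2) :
    ‖(foldCurve_control hB hζ h.wave).toL2 a t‖ ≤ A ∧ ‖woundWave hζ h.wave t‖ ≤ A ∧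
      ‖(foldCurve_time hζ h.wave).toL2 a t‖ ≤ A := by
  have hpi := Real.pi_pos
  have hκ0 : 0 ≤ κ := (abs_nonneg _).trans (hκ 0).1
  have D0 : 0 ≤ D := (sq_nonneg _).trans
    (h.bound 0 ⟨le_rfl, by positivity⟩ 0 ⟨le_rfl, by positivity⟩)
  have hκc : κ ≤ κ * (1 + K) := by nlinarith [mul_nonneg hκ0 hK]
  have hκc2 : κ ^ 2 * D ≤ (κ * (1 + K)) ^ 2 * D :=
    mul_le_mul_of_nonneg_right (pow_le_pow_left₀ hκ0 hκc 2) D0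
  have hcD : 0 ≤ (κ * (1 + K)) ^ 2 * D := mul_nonneg (sq_nonneg _) D0
  have sq_le : ∀ {x : ℝ}, x ^ 2 ≤ A ^ 2 → x ≤ A := fun hx => le_of_abs_le (abs_le_of_sq_le_sq hx hA)
  have n1 : ‖(foldCurve_control hB hζ h.wave).toL2 a t‖ ^ 2 ≤ 90 * (κ * (1 + K)) ^ 2 * D := by
    refine h.norm_toL2_sq_le (foldCurve_control hB hζ h.wave) ht fun y => ?_
    have b1 := norm_smul_le_of_abs_le (hκ y).2.1 (r t y - s t y)
    have b2 := norm_smul_le_of_abs_le (hκ y).2.1 (V t y)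
    have b3 := norm_smul_le_of_abs_le (hκ y).2.2 (V t y)
    have b4 : ‖act (B ((a + y : ℝ) : Circ)) (ζ₁ y • V t y)‖ ≤ K * (κ * ‖V t y‖) := by
      rw [← actL_apply]
      exact ((actL (B ((a + y : ℝ) : Circ))).le_opNorm (ζ₁ y • V t y)).trans
        (mul_le_mul (hBK ((a + y : ℝ) : Circ)) b2 (norm_nonneg (ζ₁ y • V t y)) hK)
    have b5 := mul_le_mul_of_nonneg_left (norm_sub_le (r t y) (s t y)) hκ0
    refine (norm_sub_le _ _).trans ((add_le_add_left (norm_add_le _ _) _).trans ?_)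
    have b6 := mul_nonneg (mul_nonneg hκ0 hK)
        (add_nonneg (norm_nonneg (r t y)) (norm_nonneg (s t y)))
    nlinarith
  have n2 : ‖(foldCurve_value hζ h.wave).toL2 a t‖ ^ 2 ≤ 90 * κ ^ 2 * D := by
    refine h.norm_toL2_sq_le (foldCurve_value hζ h.wave) ht fun y =>
      (norm_smul_le_of_abs_le (hκ y).1 (V t y)).trans ?_
    nlinarith [mul_nonneg hκ0 (norm_nonneg (r t y)), mul_nonneg hκ0 (norm_nonneg (s t y))]
  have half : ∀ u v : E R, ‖(1 / 2 : ℝ) • (u - v)‖ ≤ ‖u‖ + ‖v‖ ∧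
      ‖(1 / 2 : ℝ) • (u + v)‖ ≤ ‖u‖ + ‖v‖ := by
    intro u v
    simp only [norm_smul, Real.norm_eq_abs, abs_of_pos (by norm_num : (0:ℝ) < 1 / 2)]
    constructor <;> linarith [norm_sub_le u v, norm_add_le u v, norm_nonneg u, norm_nonneg v]
  have n3 : ‖(foldCurve_space hζ h.wave).toL2 a t‖ ^ 2 ≤ 90 * κ ^ 2 * D := by
    refine h.norm_toL2_sq_le (foldCurve_space hζ h.wave) ht fun y => (norm_add_le _ _).trans ?_
    have b1 := norm_smul_le_of_abs_le (hκ y).1 ((1 / 2 : ℝ) • (r t y - s t y))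
    have b2 := norm_smul_le_of_abs_le (hκ y).2.1 (V t y)
    have b3 := mul_le_mul_of_nonneg_left (half (r t y) (s t y)).1 hκ0
    linarith
  have n4 : ‖(foldCurve_time hζ h.wave).toL2 a t‖ ^ 2 ≤ 90 * κ ^ 2 * D := by
    refine h.norm_toL2_sq_le (foldCurve_time hζ h.wave) ht fun y => ?_
    have b1 := norm_smul_le_of_abs_le (hκ y).1 ((1 / 2 : ℝ) • (r t y + s t y))
    have b3 := mul_le_mul_of_nonneg_left (half (r t y) (s t y)).2 hκ0
    linarith [mul_nonneg hκ0 (norm_nonneg (V t y))]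
  refine ⟨sq_le (by linarith), sq_le ?_, sq_le (by linarith)⟩
  rw [norm_sq_H1]
  change ‖(foldCurve_value hζ h.wave).toL2 a t‖ ^ 2 + ‖(foldCurve_space hζ h.wave).toL2 a t‖ ^ 2 ≤ _
  linarith

/-- Winding a steered wave of the double window produces a controlled wave on the circle. -/
theorem LocalSteering.exists_steeredWave (hB : SmoothMat B) (hC : SmoothMat C)
    (hζ : FoldCutoff ε ζ ζ₁ ζ₂) {ω : Set Circ} (hω : IsOpen ω) {a : ℝ}
    (ha : a ∈ Ico 0 (2 * Real.pi)) (haω : ∀ y ∈ Ioo 0 ε, ((a + y : ℝ) : Circ) ∈ ω) {K κ D A : ℝ}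
    (hK : 0 ≤ K) (hBK : ∀ x, ‖actL (B x)‖ ≤ K)
    (hκ : ∀ y, |ζ y| ≤ κ ∧ |ζ₁ y| ≤ κ ∧ |ζ₂ y| ≤ κ) {f₀ f₁ : Circ → E R} (h₀ : Smooth f₀)
    (h₁ : Continuous f₁) {r s V : ℝ → ℝ → E R} {mr ms : ℝ → ℝ}
    (h : LocalSteering B C a D f₀ (dx f₀) f₁ r s V mr ms) (hA : 0 ≤ A)
    (hA' : 2400 * (κ * (1 + K)) ^ 2 * D ≤ A ^ 2) :
    ∃ α w p W Gu Gv μu μv,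
      SteeredWave hω B C A (ofSmooth f₀ h₀) (toL2 h₁) α w p W Gu Gv μu μv := by
  have hpi := Real.pi_pos
  have hκ0 : 0 ≤ κ := (abs_nonneg _).trans (hκ 0).1
  have D0 : 0 ≤ D := (sq_nonneg _).trans
    (h.bound 0 ⟨le_rfl, by positivity⟩ 0 ⟨le_rfl, by positivity⟩)
  have hκc : κ ≤ κ * (1 + K) := by nlinarith [mul_nonneg hκ0 hK]
  have hκc2 : κ ^ 2 * D ≤ (κ * (1 + K)) ^ 2 * D :=
    mul_le_mul_of_nonneg_right (pow_le_pow_left₀ hκ0 hκc 2) D0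
  have hc0 : 0 ≤ κ * (1 + K) := hκ0.trans hκc
  have hcD : 0 ≤ (κ * (1 + K)) ^ 2 * D := mul_nonneg (sq_nonneg _) D0
  have sq_le : ∀ {x : ℝ}, x ^ 2 ≤ A ^ 2 → x ≤ A := fun hx => le_of_abs_le (abs_le_of_sq_le_sq hx hA)
  have gu := foldCurve_null hζ h.wave.cont_r h.wave.cont_w
  have gv : FoldCurve fun t y => (1 / 2 : ℝ) • (ζ y • s t y - ζ₁ y • V t y) :=
    ((foldCurve_smul hζ.cont₀ (fun y hy => (hζ.zero_off y hy).1) h.wave.cont_s).sub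
      (foldCurve_smul hζ.cont₁ (fun y hy => (hζ.zero_off y hy).2.1) h.wave.cont_w)).const_smul _
  -- `t + y` and `t - y` for the two points `y` above `x` are translates of `t + x` and `t - x`, by
  -- a constant that depends on whether `x` lies to the left of `a`
  obtain ⟨μu, mμu, iμu, hμu⟩ := exists_majorant h.cont_mr h.mr_nonneg hκ0 D0 h.int_mr
    fun i => -a + i * (2 * Real.pi)
  obtain ⟨μv, mμv, iμv, hμv⟩ := exists_majorant h.cont_ms h.ms_nonneg hκ0 D0 h.int_ms
    fun i => a - i * (2 * Real.pi)
  have hint : ENNReal.ofReal (18 * κ ^ 2 * (D + 130 * D)) ≤ ENNReal.ofReal (A ^ 2) :=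
    ENNReal.ofReal_le_ofReal (by nlinarith)
  -- outside `(0, ε)` both derivatives of the cutoff vanish at the two points above `x`, and with
  -- them the control
  have hchi : ∀ t, chi hω ((foldCurve_control hB hζ h.wave).toL2 a t)
      = (foldCurve_control hB hζ h.wave).toL2 a t := fun t => by
    refine chi_toL2 hω ((foldCurve_control hB hζ h.wave).continuous_fold_apply a t) fun x hx => ?_
    have hy := coordFrom_mem a x
    obtain ⟨z1, z2, z3, z4⟩ := hζ.locally_const _ ⟨hy.1, hy.2.le⟩ fun hy' =>
      hx (coe_add_coordFrom a x ▸ haω _ hy')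
    have e : ∀ M : Matrix (Fin R) (Fin R) ℝ, act M (0 : E R) = 0 := fun M => map_zero (actL M)
    simp only [fold, z1, z2, z3, z4, zero_smul, e, add_zero, sub_zero]
  have hsol := isEnergySolution_woundWave hB hC hζ h.wave (32 * Real.pi)
  refine ⟨(foldCurve_control hB hζ h.wave).toL2 a, woundWave hζ h.wave,
    (foldCurve_time hζ h.wave).toL2 a, fun t => fold a fun y => ζ y • V t y,
    fun t => fold a fun y => (1 / 2 : ℝ) • (ζ y • r t y + ζ₁ y • V t y),
    fun t => fold a fun y => (1 / 2 : ℝ) • (ζ y • s t y - ζ₁ y • V t y), μu, μv,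
    ((foldCurve_control hB hζ h.wave).continuous_toL2 a).continuousOn, fun t _ => hchi t,
    ?_, ?_, ?_,
    ?_, ?_, ?_, ((foldCurve_value hζ h.wave).continuous_fold a).continuousOn, ?_, ?_,
    (gu.continuous_fold a).stronglyMeasurable, (gv.continuous_fold a).stronglyMeasurable,
    ?_, ?_, ?_,
    ?_, mμu, mμv, iμu.trans hint, iμv.trans hint⟩
  · simpa only [hchi] using hsol
  · rw [← sub_eq_zero]
    refine eq_zero_of_valH_eq_zero ?_
    rw [← valL_apply, map_sub, sub_eq_zero]
    exact toL2_congr ((foldCurve_value hζ h.wave).continuous_fold_apply a 0) h₀.continuous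
      (fold_partition hζ fun y hy => congrArg (ζ y • ·) (h.init y hy).2.2)
  · refine toL2_congr ((foldCurve_time hζ h.wave).continuous_fold_apply a 0) h₁
      (fold_partition hζ fun y hy => congrArg (ζ y • ·) ?_)
    rw [(h.init y hy).1, (h.init y hy).2.1, add_add_sub_cancel, ← two_smul ℝ, smul_smul]
    norm_num
  · refine H1_ext ((foldCurve_value hζ h.wave).toL2_eq_zero fun y hy => ?_)
      ((foldCurve_space hζ h.wave).toL2_eq_zero fun y hy => ?_)
    · rw [(h.final y hy).2.2, smul_zero]
    · rw [(h.final y hy).1, (h.final y hy).2.1, (h.final y hy).2.2, sub_zero, smul_zero, smul_zero,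
        smul_zero, add_zero]
  · refine FoldCurve.toL2_eq_zero _ fun y hy => ?_
    rw [(h.final y hy).1, (h.final y hy).2.1, add_zero, smul_zero, smul_zero]
  · exact fun t ht => h.norm_le hB hζ hK hBK hκ ht hA hA'
  · exact fun t _ => (MemLp.coeFn_toLp (memLp_of_continuous
      ((foldCurve_value hζ h.wave).continuous_fold_apply a t))).symm
  · intro t ht x
    have b1 : ∀ y ∈ Icc 0 (4 * Real.pi), ‖ζ y • V t y‖ ≤ κ * √D := fun y hy =>
      (norm_smul_le_of_abs_le (hκ y).1 _).trans
        (mul_le_mul_of_nonneg_left (Real.le_sqrt_of_sq_le (h.bound t ht y hy)) hκ0)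
    refine (norm_fold_le (g := fun _ => κ * √D) b1).trans (sq_le ?_)
    have b2 := Real.sq_sqrt D0
    have b3 : (κ * √D + κ * √D) ^ 2 = 4 * (κ ^ 2 * √D ^ 2) := by ring
    rw [b2] at b3
    linarith
  · exact fun t _ => coeFn_half_time_add_der hζ h.wave t
  · exact fun t _ => coeFn_half_time_sub_der hζ h.wave t
  · intro t ht x hx
    obtain ⟨i, hi, e⟩ := exists_coordFrom_eq ha hx
    have hy := coordFrom_mem a (x : Circ)
    have e1 : t + coordFrom a (x : Circ) = t + x + (-a + i * (2 * Real.pi)) := by rw [e]; ring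
    have e2 : t + (coordFrom a (x : Circ) + 2 * Real.pi)
        = t + x + (-a + ((i + 1 : ℕ) : ℝ) * (2 * Real.pi)) := by rw [e]; push_cast; ring
    rw [← ofReal_norm]
    refine hμu (t + x) i hi ?_ ?_ _ ?_
    · rw [← e1]
      constructor <;> linarith [ht.1, ht.2, hy.1, hy.2]
    · rw [← e2]
      constructor <;> linarith [ht.1, ht.2, hy.1, hy.2]
    · rw [← e1, ← e2]
      exact norm_fold_null_le (m := fun y => mr (t + y)) (fun y => ⟨(hκ y).1, (hκ y).2.1⟩)
        (h.le_mr t) (h.bound t ht) _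
  · intro t ht x hx
    obtain ⟨i, hi, e⟩ := exists_coordFrom_eq ha hx
    have hy := coordFrom_mem a (x : Circ)
    have e1 : t - coordFrom a (x : Circ) = t - x + (a - i * (2 * Real.pi)) := by rw [e]; ring
    have e2 : t - (coordFrom a (x : Circ) + 2 * Real.pi)
        = t - x + (a - ((i + 1 : ℕ) : ℝ) * (2 * Real.pi)) := by rw [e]; push_cast; ring
    rw [← ofReal_norm]
    refine hμv (t - x) i hi ?_ ?_ _ ?_
    · rw [← e1]
      constructor <;> linarith [ht.1, ht.2, hy.1, hy.2]
    · rw [← e2]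
      constructor <;> linarith [ht.1, ht.2, hy.1, hy.2]
    · rw [← e1, ← e2]
      have key := norm_fold_null_le (a := a) (r := s t) (V := fun y => -V t y)
        (m := fun y => ms (t - y)) (fun y => ⟨(hκ y).1, (hκ y).2.1⟩) (h.le_ms t)
        (fun y hy => by rw [norm_neg]; exact h.bound t ht y hy) (x : Circ)
      simpa only [smul_neg, ← sub_eq_add_neg] using key

/-- Smooth data can be steered to rest by a control supported in `ω`. -/
theorem exists_steeredWave (hB : SmoothMat B) (hC : SmoothMat C) {ω : Set Circ} (hω : IsOpen ω)
    (hne : ω.Nonempty) :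
    ∃ K, 0 < K ∧ ∀ (f₀ f₁ : Circ → E R) (h₀ : Smooth f₀) (h₁ : Continuous f₁),
      ∃ α w p W Gu Gv μu μv,
        SteeredWave hω B C (K * √(‖ofSmooth f₀ h₀‖ ^ 2 + ‖toL2 h₁‖ ^ 2)) (ofSmooth f₀ h₀) (toL2 h₁)
          α w p W Gu Gv μu μv := by
  have hpi := Real.pi_pos
  obtain ⟨x₀, hx₀⟩ := hne
  let a := coordFrom 0 x₀
  have ha : a ∈ Ico 0 (2 * Real.pi) := coordFrom_mem 0 x₀
  have ea : (a : Circ) = x₀ := by simpa only [zero_add] using coe_add_coordFrom 0 x₀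
  have hop : IsOpen ((fun y : ℝ => ((a + y : ℝ) : Circ)) ⁻¹' ω) :=
    hω.preimage (continuous_shift continuous_id a)
  obtain ⟨ε, hε, hball⟩ := Metric.isOpen_iff.1 hop 0 (by
    change ((a + 0 : ℝ) : Circ) ∈ ω
    rwa [add_zero, ea])
  have hε' : 0 < min ε Real.pi := lt_min hε hpi
  obtain ⟨ζ, ζ₁, ζ₂, hζ⟩ := exists_fold_cutoff hε' (min_le_right _ _)
  obtain ⟨κ, hκ0, hκ⟩ := hζ.bound
  obtain ⟨K, hK, hBK⟩ := exists_norm_actL_le hB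
  obtain ⟨K', hK', H⟩ := exists_localSteering hB hC a
  -- `2400` exceeds `180`, for the `H¹` norm, and `18 * 131 = 2358`, for the majorants
  refine ⟨√(2400 * (κ * (1 + K)) ^ 2 * K') + 1, by positivity, fun f₀ f₁ h₀ h₁ => ?_⟩
  obtain ⟨r, s, V, mr, ms, h⟩ := H f₀ f₁ h₀ h₁
  refine h.exists_steeredWave hB hC hζ hω ha (fun y hy => hball ?_) hK hBK hκ h₀ h₁
    (by positivity) ?_
  · rw [Metric.mem_ball, Real.dist_eq, sub_zero, abs_of_pos hy.1]
    exact hy.2.trans_le (min_le_left _ _)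
  · set N := ‖ofSmooth f₀ h₀‖ ^ 2 + ‖toL2 h₁‖ ^ 2 with hN
    have hN0 : 0 ≤ N := by positivity
    have hq : 0 ≤ 2400 * (κ * (1 + K)) ^ 2 * K' := by positivity
    rw [mul_pow _ (√N), Real.sq_sqrt hN0, ← mul_assoc]
    refine mul_le_mul_of_nonneg_right ?_ hN0
    nlinarith [Real.sq_sqrt hq, Real.sqrt_nonneg (2400 * (κ * (1 + K)) ^ 2 * K')]

end Winding

/-! ### Series of steered waves -/

section SquareFunctions

theorem eLpNorm_two_le_iff {α : Type*} [MeasurableSpace α] {ν : Measure α} {μ : α → ℝ≥0∞} {A : ℝ}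
    (hA : 0 ≤ A) :
    eLpNorm μ 2 ν ≤ ENNReal.ofReal A ↔ ∫⁻ u, μ u ^ 2 ∂ν ≤ ENNReal.ofReal (A ^ 2) := by
  have h : eLpNorm μ 2 ν ^ 2 = ∫⁻ u, μ u ^ 2 ∂ν := by
    have := eLpNorm_nnreal_pow_eq_lintegral (μ := ν) (f := μ) (p := 2) two_ne_zero
    simpa only [NNReal.coe_ofNat, ENNReal.rpow_ofNat, ENNReal.coe_ofNat, enorm_eq_self] using this
  rw [← h, ENNReal.ofReal_pow hA]
  exact (ENNReal.pow_le_pow_left_iff two_ne_zero).symm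

/-- Minkowski's inequality for countably many nonnegative functions. -/
theorem eLpNorm_two_tsum_le {α : Type*} [MeasurableSpace α] {ν : Measure α} {μ : ℕ → α → ℝ≥0∞}
    (hμ : ∀ k, Measurable (μ k)) :
    eLpNorm (fun u => ∑' k, μ k u) 2 ν ≤ ∑' k, eLpNorm (μ k) 2 ν := by
  have h : ∀ {g : α → ℝ≥0∞}, eLpNorm g 2 ν = (∫⁻ u, g u ^ (2 : ℝ) ∂ν) ^ (1 / (2 : ℝ)) := by
    intro g
    rw [eLpNorm_eq_lintegral_rpow_enorm_toReal two_ne_zero (by simp)]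
    simp
  have fin : ∀ n : ℕ, eLpNorm (fun u => ∑ k ∈ Finset.range n, μ k u) 2 ν
      ≤ ∑ k ∈ Finset.range n, eLpNorm (μ k) 2 ν := by
    intro n
    induction n with
    | zero => simp
    | succ n ih =>
      simp only [Finset.sum_range_succ]
      refine le_trans ?_ (add_le_add_left ih _)
      have := ENNReal.lintegral_Lp_add_le (μ := ν) (p := 2)
        (f := fun u => ∑ k ∈ Finset.range n, μ k u) (g := μ n)
        (Finset.measurable_fun_sum _ fun k _ => hμ k).aemeasurable (hμ n).aemeasurable (by norm_num)
      simpa only [h, Pi.add_apply] using this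
  have mono : Monotone fun (n : ℕ) (u : α) => (∑ k ∈ Finset.range n, μ k u) ^ (2 : ℝ) := by
    intro m n hmn u
    exact ENNReal.rpow_le_rpow (Finset.sum_le_sum_of_subset (Finset.range_mono hmn)) (by norm_num)
  have e : ∀ u, (∑' k, μ k u) ^ (2 : ℝ) = ⨆ n : ℕ, (∑ k ∈ Finset.range n, μ k u) ^ (2 : ℝ) := by
    intro u
    rw [ENNReal.tsum_eq_iSup_nat]
    exact (ENNReal.orderIsoRpow 2 (by norm_num)).map_iSup _
  rw [h]
  simp only [e]
  rw [lintegral_iSup (fun n => (Finset.measurable_fun_sum _ fun k _ => hμ k).pow_const _) mono]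
  refine ((ENNReal.orderIsoRpow (1 / (2 : ℝ)) (by norm_num)).map_iSup
    fun n : ℕ => ∫⁻ u, (∑ k ∈ Finset.range n, μ k u) ^ (2 : ℝ) ∂ν).trans_le (iSup_le fun n => ?_)
  have := fin n
  rw [h] at this
  exact this.trans (ENNReal.sum_le_tsum _)

end SquareFunctions

section Series

variable {R : ℕ} {B C : Circ → Matrix (Fin R) (Fin R) ℝ}

/-- The weak form is a bounded linear functional of the state, minus the pairing with the forcing.
-/
theorem weakForm_eq_clm (hB : SmoothMat B) (hC : SmoothMat C) (θ : H1 R) : ∃ L : H1 R →L[ℝ] ℝ,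
    ∀ w f, weakForm hB hC w f θ = L w - innerSL ℝ (valH θ) f := by
  refine ⟨-((innerSL ℝ (derH θ)).comp (derL R)) - (innerSL ℝ (valH θ)).comp
    ((mulL2 hB).comp (derL R) + (mulL2 hC).comp (valL R)), fun w f => ?_⟩
  simp only [weakForm_apply, sub_apply, neg_apply, add_apply, ContinuousLinearMap.comp_apply,
    innerSL_apply_apply, valL_apply, derL_apply, inner_add_left, inner_add_right]
  rw [real_inner_comm (derH w), real_inner_comm (valH θ) f, real_inner_comm (valH θ),
    real_inner_comm (valH θ)]
  ring

/-- Normally convergent series of solutions are solutions. -/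
theorem isEnergySolution_tsum (hB : SmoothMat B) (hC : SmoothMat C) {T : ℝ} {A : ℕ → ℝ}
    (hA : Summable A) {f : ℕ → ℝ → L2 R} {w : ℕ → ℝ → H1 R} {p : ℕ → ℝ → L2 R}
    (h : ∀ k, IsEnergySolution B C T (f k) (w k) (p k))
    (hf : ∀ k, ContinuousOn (f k) (Icc 0 T)) (bf : ∀ k, ∀ t ∈ Icc 0 T, ‖f k t‖ ≤ A k)
    (bw : ∀ k, ∀ t ∈ Icc 0 T, ‖w k t‖ ≤ A k) (bp : ∀ k, ∀ t ∈ Icc 0 T, ‖p k t‖ ≤ A k) :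
    IsEnergySolution B C T (fun t => ∑' k, f k t) (fun t => ∑' k, w k t)
      (fun t => ∑' k, p k t) where
  continuousOn_fst := continuousOn_tsum (fun k => (h k).continuousOn_fst) hA bw
  continuousOn_snd := continuousOn_tsum (fun k => (h k).continuousOn_snd) hA bp
  hasDeriv t ht := by
    have sw : ∀ t ∈ Icc 0 T, Summable fun k => w k t := fun t ht =>
      Summable.of_norm_bounded hA fun k => bw k t ht
    refine hasDerivWithinAt_Icc_of_tendsto (f := fun n t => ∑ k ∈ Finset.range n, valH (w k t))
      (g := fun n t => ∑ k ∈ Finset.range n, p k t) (g' := fun t => ∑' k, p k t)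
      (fun n t ht => HasDerivWithinAt.fun_sum fun k _ => (h k).hasDeriv t ht)
      (fun n => continuousOn_finsetSum _ fun k _ => (h k).continuousOn_snd)
      (fun t ht => ((valL R).hasSum (sw t ht).hasSum).tendsto_sum_nat)
      (tendstoUniformlyOn_tsum_nat hA bp) ht
  equation θ t ht := by
    rw [← weakForm_eq hB hC]
    obtain ⟨L, hL⟩ := weakForm_eq_clm hB hC θ
    have sw : ∀ t ∈ Icc 0 T, Summable fun k => w k t := fun t ht =>
      Summable.of_norm_bounded hA fun k => bw k t ht
    have sf : ∀ t ∈ Icc 0 T, Summable fun k => f k t := fun t ht =>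
      Summable.of_norm_bounded hA fun k => bf k t ht
    have sp : ∀ t ∈ Icc 0 T, Summable fun k => p k t := fun t ht =>
      Summable.of_norm_bounded hA fun k => bp k t ht
    have hsum : ∀ t ∈ Icc 0 T, HasSum (fun k => weakForm hB hC (w k t) (f k t) θ)
        (weakForm hB hC (∑' k, w k t) (∑' k, f k t) θ) := fun t ht => by
      simp only [hL]
      exact (L.hasSum (sw t ht).hasSum).sub ((innerSL ℝ (valH θ)).hasSum (sf t ht).hasSum)
    have hbd : ∀ k, ∀ t ∈ Icc 0 T, ‖weakForm hB hC (w k t) (f k t) θ‖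
        ≤ (‖L‖ + ‖innerSL ℝ (valH θ)‖) * A k := fun k t ht => by
      rw [hL, add_mul]
      exact (norm_sub_le _ _).trans (add_le_add (L.le_opNorm_of_le (bw k t ht))
        ((innerSL ℝ (valH θ)).le_opNorm_of_le (bf k t ht)))
    refine hasDerivWithinAt_Icc_of_tendsto (f := fun n t => ∑ k ∈ Finset.range n, ⟪p k t, valH θ⟫_ℝ)
      (g := fun n t => ∑ k ∈ Finset.range n, weakForm hB hC (w k t) (f k t) θ)
      (f' := fun t => ⟪∑' k, p k t, valH θ⟫_ℝ)
      (g' := fun t => weakForm hB hC (∑' k, w k t) (∑' k, f k t) θ)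
      (fun n t ht => HasDerivWithinAt.fun_sum fun k _ => (h k).hasDerivWithinAt hB hC θ ht)
      (fun n => continuousOn_finsetSum _ fun k _ =>
        (continuousOn_weakForm hB hC (h k).continuousOn_fst (hf k)).clm_apply continuousOn_const)
      (fun t ht => ?_) ?_ ht
    · simp only [real_inner_comm (valH θ)]
      exact ((innerSL ℝ (valH θ)).hasSum (sp t ht).hasSum).tendsto_sum_nat
    · exact (tendstoUniformlyOn_tsum_nat (hA.mul_left _) hbd).congr_right
        fun t ht => (hsum t ht).tsum_eq

theorem IsEnergySolution.congr_source {T : ℝ} {f f' : ℝ → L2 R} {w : ℝ → H1 R} {p : ℝ → L2 R}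
    (h : IsEnergySolution B C T f w p) (hf : ∀ t ∈ Icc 0 T, f t = f' t) :
    IsEnergySolution B C T f' w p where
  continuousOn_fst := h.continuousOn_fst
  continuousOn_snd := h.continuousOn_snd
  hasDeriv := h.hasDeriv
  equation θ t ht := by
    rw [← hf t ht]
    exact h.equation θ t ht

theorem summable_enorm_ne_top {X : Type*} [NormedAddCommGroup X] {A : ℕ → ℝ} (hA : Summable A)
    {g : ℕ → X} (h : ∀ k, ‖g k‖ ≤ A k) : ∑' k, ‖g k‖ₑ ≠ ∞ := by
  have h1 : ∑' k, ‖g k‖ₑ ≤ ∑' k, ENNReal.ofReal (A k) :=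
    ENNReal.tsum_le_tsum fun k => by
      rw [← ofReal_norm]
      exact ENNReal.ofReal_le_ofReal (h k)
  rw [← ENNReal.ofReal_tsum_of_nonneg (fun k => (norm_nonneg _).trans (h k)) hA] at h1
  exact ne_top_of_le_ne_top ENNReal.ofReal_ne_top h1

/-- The sum in `L²` of a normally convergent series is represented by the pointwise sum. -/
theorem coeFn_tsum_of_ae_eq {A : ℕ → ℝ} (hA : Summable A) {g : ℕ → L2 R} (h : ∀ k, ‖g k‖ ≤ A k)
    {G : ℕ → Circ → E R} (hG : ∀ k, G k =ᵐ[volume] g k) {g' : L2 R} (hg' : HasSum g g') :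
    (fun x => ∑' k, G k x) =ᵐ[volume] g' := by
  filter_upwards [Lp.hasSum_coeFn_tsum (summable_enorm_ne_top hA h), ae_all_iff.2 hG] with x h1 h2
  simp only [h2]
  rw [h1.tsum_eq, hg'.tsum_eq]

theorem int_tsum_sq_le {A : ℕ → ℝ} (hA : Summable A) (hA0 : ∀ k, 0 ≤ A k) {μ : ℕ → ℝ → ℝ≥0∞}
    (mμ : ∀ k, Measurable (μ k)) (h : ∀ k, ∫⁻ u, μ k u ^ 2 ≤ ENNReal.ofReal (A k ^ 2)) :
    ∫⁻ u, (∑' k, μ k u) ^ 2 ≤ ENNReal.ofReal ((∑' k, A k) ^ 2) := by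
  rw [← eLpNorm_two_le_iff (μ := fun u => ∑' k, μ k u) (tsum_nonneg hA0),
      ENNReal.ofReal_tsum_of_nonneg hA0 hA]
  exact (eLpNorm_two_tsum_le mμ).trans
    (ENNReal.tsum_le_tsum fun k => (eLpNorm_two_le_iff (hA0 k)).2 (h k))

/-- Normally convergent series of controlled waves are controlled waves. -/
theorem SteeredWave.tsum (hB : SmoothMat B) (hC : SmoothMat C) {ω : Set Circ} {hω : IsOpen ω}
    {A : ℕ → ℝ} (hA : Summable A) {w₀ : ℕ → H1 R} {w₁ : ℕ → L2 R} {w₀' : H1 R} {w₁' : L2 R}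
    (h₀ : HasSum w₀ w₀') (h₁ : HasSum w₁ w₁') {α : ℕ → ℝ → L2 R} {w : ℕ → ℝ → H1 R}
    {p : ℕ → ℝ → L2 R} {W Gu Gv : ℕ → ℝ → Circ → E R} {μu μv : ℕ → ℝ → ℝ≥0∞}
    (h : ∀ k, SteeredWave hω B C (A k) (w₀ k) (w₁ k) (α k) (w k) (p k) (W k) (Gu k) (Gv k) (μu k)
      (μv k)) :
    SteeredWave hω B C (∑' k, A k) w₀' w₁' (fun t => ∑' k, α k t) (fun t => ∑' k, w k t)
      (fun t => ∑' k, p k t) (fun t x => ∑' k, W k t x) (fun t x => ∑' k, Gu k t x)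
      (fun t x => ∑' k, Gv k t x) (fun u => ∑' k, μu k u) (fun v => ∑' k, μv k v) := by
  have hpi := Real.pi_pos
  have bα : ∀ k, ∀ t ∈ Icc 0 (32 * Real.pi), ‖α k t‖ ≤ A k := fun k t ht => ((h k).bound t ht).1
  have bw : ∀ k, ∀ t ∈ Icc 0 (32 * Real.pi), ‖w k t‖ ≤ A k := fun k t ht => ((h k).bound t ht).2.1
  have bp : ∀ k, ∀ t ∈ Icc 0 (32 * Real.pi), ‖p k t‖ ≤ A k := fun k t ht => ((h k).bound t ht).2.2
  have hA0 : ∀ k, 0 ≤ A k := fun k =>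
    (norm_nonneg _).trans (bα k 0 ⟨le_rfl, by positivity⟩)
  have sα : ∀ t ∈ Icc 0 (32 * Real.pi), Summable fun k => α k t := fun t ht =>
    Summable.of_norm_bounded hA fun k => bα k t ht
  have sw : ∀ t ∈ Icc 0 (32 * Real.pi), Summable fun k => w k t := fun t ht =>
    Summable.of_norm_bounded hA fun k => bw k t ht
  have sp : ∀ t ∈ Icc 0 (32 * Real.pi), Summable fun k => p k t := fun t ht =>
    Summable.of_norm_bounded hA fun k => bp k t ht
  have chi_sum : ∀ t ∈ Icc 0 (32 * Real.pi), chi hω (∑' k, α k t) = ∑' k, α k t := fun t ht => by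
    rw [← chiL_apply, (chiL R hω).map_tsum (sα t ht)]
    exact tsum_congr fun k => (h k).chi_α t ht
  have sol : IsEnergySolution B C (32 * Real.pi) (fun t => ∑' k, α k t) (fun t => ∑' k, w k t)
      (fun t => ∑' k, p k t) :=
    isEnergySolution_tsum hB hC hA (fun k => (h k).sol.congr_source (h k).chi_α)
      (fun k => (h k).cont_α) bα bw bp
  have half : ∀ (P Q : L2 R) (A : ℝ), ‖P‖ ≤ A → ‖Q‖ ≤ A →
      ‖(1 / 2 : ℝ) • (P + Q)‖ ≤ A ∧ ‖(1 / 2 : ℝ) • (P - Q)‖ ≤ A := by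
    intro P Q A hP hQ
    simp only [norm_smul, Real.norm_eq_abs, abs_of_pos (by norm_num : (0:ℝ) < 1 / 2)]
    constructor <;> linarith [norm_add_le P Q, norm_sub_le P Q]
  have hder : ∀ t ∈ Icc 0 (32 * Real.pi), HasSum (fun k => derH (w k t)) (derH (∑' k, w k t)) :=
    fun t ht => (derL R).hasSum (sw t ht).hasSum
  have bder : ∀ k, ∀ t ∈ Icc 0 (32 * Real.pi), ‖derH (w k t)‖ ≤ A k := fun k t ht =>
    (norm_derH_le _).trans (bw k t ht)
  refine ⟨continuousOn_tsum (fun k => (h k).cont_α) hA bα, chi_sum,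
    sol.congr_source fun t ht => (chi_sum t ht).symm, ?_, ?_, ?_, ?_, fun t ht => ⟨?_, ?_, ?_⟩, ?_,
    fun t ht => ?_, fun t ht x => ?_, ?_, ?_, fun t ht => ?_, fun t ht => ?_, fun t ht x hx => ?_,
    fun t ht x hx => ?_, ?_, ?_, ?_, ?_⟩
  · simp only [(h _).init_w, h₀.tsum_eq]
  · simp only [(h _).init_p, h₁.tsum_eq]
  · simp only [(h _).final_w, tsum_zero]
  · simp only [(h _).final_p, tsum_zero]
  · exact tsum_of_norm_bounded hA.hasSum fun k => bα k t ht
  · exact tsum_of_norm_bounded hA.hasSum fun k => bw k t ht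
  · exact tsum_of_norm_bounded hA.hasSum fun k => bp k t ht
  · exact continuousOn_tsum (f := fun k => Function.uncurry (W k)) (fun k => (h k).cont_W) hA
      fun k q hq => (h k).bound_W q.1 hq.1 q.2
  · exact coeFn_tsum_of_ae_eq hA (fun k => (norm_valH_le _).trans (bw k t ht))
      (fun k => (h k).rep_W t ht) ((valL R).hasSum (sw t ht).hasSum)
  · exact tsum_of_norm_bounded hA.hasSum fun k => (h k).bound_W t ht x
  · exact StronglyMeasurable.tsum fun k => (h k).meas_u
  · exact StronglyMeasurable.tsum fun k => (h k).meas_v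
  · exact coeFn_tsum_of_ae_eq hA (fun k => (half _ _ _ (bp k t ht) (bder k t ht)).1)
      (fun k => (h k).rep_u t ht) (((sp t ht).hasSum.add (hder t ht)).const_smul (1 / 2 : ℝ))
  · exact coeFn_tsum_of_ae_eq hA (fun k => (half _ _ _ (bp k t ht) (bder k t ht)).2)
      (fun k => (h k).rep_v t ht) (((sp t ht).hasSum.sub (hder t ht)).const_smul (1 / 2 : ℝ))
  · exact enorm_tsum_le_tsum_enorm.trans (ENNReal.tsum_le_tsum fun k => (h k).le_u t ht x hx)
  · exact enorm_tsum_le_tsum_enorm.trans (ENNReal.tsum_le_tsum fun k => (h k).le_v t ht x hx)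
  · exact Measurable.tsum fun k => (h k).meas_μu
  · exact Measurable.tsum fun k => (h k).meas_μv
  · exact int_tsum_sq_le hA hA0 (fun k => (h k).meas_μu) fun k => (h k).int_u
  · exact int_tsum_sq_le hA hA0 (fun k => (h k).meas_μv) fun k => (h k).int_v

end Series

/-! ### The norm bounds, and steering of arbitrary data -/

section Norms

variable {R : ℕ}

theorem mixedNorm_two_top_le {h : ℝ → ℝ → E R} {μ : ℝ → ℝ≥0∞} (hle : ∀ a b, ‖h a b‖ₑ ≤ μ a) :
    mixedNorm 2 ∞ h ≤ eLpNorm μ 2 volume := by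
  refine eLpNorm_mono_enorm fun a => ?_
  rw [enorm_eq_self, enorm_eq_self, eLpNorm_exponent_top]
  exact eLpNormEssSup_le_of_ae_enorm_bound (ae_of_all _ (hle a))

theorem mixedNorm_top_two_le {h : ℝ → ℝ → E R} {μ : ℝ → ℝ≥0∞} (hle : ∀ a b, ‖h a b‖ₑ ≤ μ b) :
    mixedNorm ∞ 2 h ≤ eLpNorm μ 2 volume := by
  rw [mixedNorm, eLpNorm_exponent_top]
  refine eLpNormEssSup_le_of_ae_enorm_bound (ae_of_all _ fun a => ?_)
  rw [enorm_eq_self]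
  exact eLpNorm_mono_enorm fun b => by rw [enorm_eq_self]; exact hle a b

/-- A pointwise bound on the cylinder passes to the extension by zero in null coordinates. -/
theorem enorm_nullExt_le {T : ℝ} {G : ℝ → Circ → E R} {u v : ℝ} {z : ℝ≥0∞}
    (h : ∀ t ∈ Icc 0 T, ∀ x ∈ Ico 0 (2 * Real.pi), t + x = u → t - x = v → ‖G t (x : Circ)‖ₑ ≤ z) :
    ‖nullExt T G u v‖ₑ ≤ z := by
  unfold nullExt
  by_cases hm : ((u + v) / 2, (u - v) / 2)
      ∈ {q : ℝ × ℝ | q.1 ∈ Icc 0 T ∧ q.2 ∈ Ico 0 (2 * Real.pi)}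
  · rw [indicator_of_mem hm]
    exact h _ hm.1 _ hm.2 (by ring) (by ring)
  · rw [indicator_of_notMem hm, enorm_zero]
    exact zero_le

variable {B C : Circ → Matrix (Fin R) (Fin R) ℝ} {ω : Set Circ} {hω : IsOpen ω} {A : ℝ} {w₀ : H1 R}
  {w₁ : L2 R} {α : ℝ → L2 R} {w : ℝ → H1 R} {p : ℝ → L2 R} {W Gu Gv : ℝ → Circ → E R}
  {μu μv : ℝ → ℝ≥0∞}

theorem SteeredWave.nonneg (h : SteeredWave hω B C A w₀ w₁ α w p W Gu Gv μu μv) : 0 ≤ A :=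
  (norm_nonneg _).trans (h.bound 0 ⟨le_rfl, by positivity⟩).1

theorem SteeredWave.iSup_enorm_control_le (h : SteeredWave hω B C A w₀ w₁ α w p W Gu Gv μu μv) :
    ⨆ t ∈ Icc 0 (32 * Real.pi), ‖α t‖ₑ ≤ ENNReal.ofReal A :=
  iSup₂_le fun t ht => by
    rw [← ofReal_norm]
    exact ENNReal.ofReal_le_ofReal (h.bound t ht).1

/-- The norm `normW` is the sum of two norms of `w_v`, two of `w_u`, the supremum of `w` and the
norm of `(w_x, w_t)`, the last one being at most `2A`. -/
theorem SteeredWave.normW_le (h : SteeredWave hω B C A w₀ w₁ α w p W Gu Gv μu μv) :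
    normW (32 * Real.pi) w p ≤ ENNReal.ofReal (7 * A) := by
  have hA := h.nonneg
  have hu := (eLpNorm_two_le_iff hA).2 h.int_u
  have hv := (eLpNorm_two_le_iff hA).2 h.int_v
  have h1 : normV (32 * Real.pi) (fun t => (1 / 2 : ℝ) • (p t - derH (w t)))
      ≤ ENNReal.ofReal A + ENNReal.ofReal A := by
    refine iInf₂_le_of_le Gv ⟨h.meas_v, (ae_restrict_iff' measurableSet_Icc).2
      (ae_of_all _ h.rep_v)⟩ (add_le_add ?_ ?_)
    · exact (mixedNorm_two_top_le fun v u => enorm_nullExt_le fun t ht x hx _ e =>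
        e ▸ h.le_v t ht x hx).trans hv
    · exact (mixedNorm_top_two_le fun u v => enorm_nullExt_le fun t ht x hx _ e =>
        e ▸ h.le_v t ht x hx).trans hv
  have h2 : normU (32 * Real.pi) (fun t => (1 / 2 : ℝ) • (p t + derH (w t)))
      ≤ ENNReal.ofReal A + ENNReal.ofReal A := by
    refine iInf₂_le_of_le Gu ⟨h.meas_u, (ae_restrict_iff' measurableSet_Icc).2
      (ae_of_all _ h.rep_u)⟩ (add_le_add ?_ ?_)
    · exact (mixedNorm_two_top_le fun u v => enorm_nullExt_le fun t ht x hx e _ =>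
        e ▸ h.le_u t ht x hx).trans hu
    · exact (mixedNorm_top_two_le fun v u => enorm_nullExt_le fun t ht x hx e _ =>
        e ▸ h.le_u t ht x hx).trans hu
  have h3 : normC (32 * Real.pi) (fun t => valH (w t)) ≤ ENNReal.ofReal A := by
    refine iInf_le_of_le W (iInf₂_le_of_le h.cont_W h.rep_W (iSup₂_le fun t ht =>
      iSup_le fun x => ?_))
    rw [← ofReal_norm]
    exact ENNReal.ofReal_le_ofReal (h.bound_W t ht x)
  have h4 : ⨆ t ∈ Icc 0 (32 * Real.pi), ENNReal.ofReal (Real.sqrt (‖derH (w t)‖ ^ 2 + ‖p t‖ ^ 2))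
      ≤ ENNReal.ofReal (2 * A) := by
    refine iSup₂_le fun t ht => ENNReal.ofReal_le_ofReal (Real.sqrt_le_iff.2 ⟨by positivity, ?_⟩)
    have b1 := pow_le_pow_left₀ (norm_nonneg _) ((norm_derH_le _).trans (h.bound t ht).2.1) 2
    have b2 := pow_le_pow_left₀ (norm_nonneg _) (h.bound t ht).2.2 2
    nlinarith [sq_nonneg A]
  refine (add_le_add (add_le_add (add_le_add h1 h2) h3) h4).trans_eq ?_
  rw [← ENNReal.ofReal_add hA hA, ← ENNReal.ofReal_add (by positivity) (by positivity),
    ← ENNReal.ofReal_add (by positivity) hA, ← ENNReal.ofReal_add (by positivity) (by positivity)]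
  congr 1
  ring

end Norms

section Density

variable {R : ℕ}

theorem exists_continuous_approx_L2 (f : L2 R) {ε : ℝ} (hε : 0 < ε) :
    ∃ (g : Circ → E R) (hg : Continuous g), ‖f - toL2 hg‖ < ε := by
  obtain ⟨g, hg⟩ := Metric.denseRange_iff.1
    (ContinuousMap.toLp_denseRange (E R) (volume : Measure Circ) ℝ (p := 2) (by simp)) f ε hε
  refine ⟨g, g.continuous, ?_⟩
  rw [dist_eq_norm] at hg
  exact hg

/-- A point of the closure of a subgroup is the sum of a series of points of the subgroup with norms
at most `‖d‖ (1 + 1/2)`, `‖d‖ / 4`, `‖d‖ / 8`, … -/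
theorem exists_series_of_mem_closure {X : Type*} [NormedAddCommGroup X] [CompleteSpace X]
    {S : AddSubgroup X} {d : X} (hd : d ∈ closure (S : Set X)) :
    ∃ v : ℕ → X, (∀ k, v k ∈ S) ∧ HasSum v d ∧ Summable (fun k => ‖v k‖) ∧
      ∑' k, ‖v k‖ ≤ 2 * ‖d‖ := by
  rcases eq_or_ne d 0 with h0 | h0
  · refine ⟨fun _ => 0, fun _ => S.zero_mem, ?_, ?_, ?_⟩
    · rw [h0]; exact hasSum_zero
    · simp
    · simp
  · have hp := norm_pos_iff.2 h0
    obtain ⟨v, h1, h2, h3, h4⟩ := controlled_sum_of_mem_closure hd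
      (b := fun n => ‖d‖ / 2 / 2 ^ n) fun n => by positivity
    have hg : HasSum (fun n => (if n = 0 then ‖d‖ else 0) + ‖d‖ / 2 / 2 ^ n) (‖d‖ + ‖d‖) :=
      (hasSum_ite_eq 0 ‖d‖).add (hasSum_geometric_two' ‖d‖)
    have hle : ∀ n, ‖v n‖ ≤ (if n = 0 then ‖d‖ else 0) + ‖d‖ / 2 / 2 ^ n := by
      intro n
      rcases Nat.eq_zero_or_pos n with rfl | hn
      · rw [if_pos rfl]
        have h5 : ‖v 0‖ ≤ ‖d‖ + ‖-v 0 + d‖ := by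
          rw [show v 0 = d - (-v 0 + d) by abel]
          refine (norm_sub_le _ _).trans_eq ?_
          congr 2
          abel
        linarith
      · rw [if_neg hn.ne', zero_add]
        exact (h4 n hn).le
    have hs : Summable fun k => ‖v k‖ :=
      Summable.of_nonneg_of_le (fun _ => norm_nonneg _) hle hg.summable
    refine ⟨v, h2, ?_, hs, ?_⟩
    · have h6 := hs.of_norm.hasSum
      have h7 := (h6.tendsto_sum_nat.comp (Filter.tendsto_add_atTop_nat 1))
      rwa [tendsto_nhds_unique h7 h1] at h6
    · refine (hs.tsum_le_tsum hle hg.summable).trans_eq ?_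
      rw [hg.tsum_eq]
      ring

/-- Any data are the sum of a series of smooth data whose norms are summable. -/
theorem exists_smooth_series (w₀ : H1 R) (w₁ : L2 R) :
    ∃ (f₀ f₁ : ℕ → Circ → E R) (h₀ : ∀ k, Smooth (f₀ k)) (h₁ : ∀ k, Continuous (f₁ k)),
      HasSum (fun k => ofSmooth (f₀ k) (h₀ k)) w₀ ∧ HasSum (fun k => toL2 (h₁ k)) w₁ ∧
      Summable (fun k => √(‖ofSmooth (f₀ k) (h₀ k)‖ ^ 2 + ‖toL2 (h₁ k)‖ ^ 2)) ∧
      ∑' k, √(‖ofSmooth (f₀ k) (h₀ k)‖ ^ 2 + ‖toL2 (h₁ k)‖ ^ 2) ≤ 2 * √(‖w₀‖ ^ 2 + ‖w₁‖ ^ 2) := by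
  let d : WithLp 2 (H1 R × L2 R) := WithLp.toLp 2 (w₀, w₁)
  have hnorm : ∀ (a : H1 R) (b : L2 R), ‖(WithLp.toLp 2 (a, b) : WithLp 2 (H1 R × L2 R))‖
      = √(‖a‖ ^ 2 + ‖b‖ ^ 2) := fun a b => WithLp.prod_norm_eq_of_L2 _
  let S : AddSubgroup (WithLp 2 (H1 R × L2 R)) :=
    { carrier := {q | ∃ (f₀ f₁ : Circ → E R) (h₀ : Smooth f₀) (h₁ : Continuous f₁),
        q = WithLp.toLp 2 (ofSmooth f₀ h₀, toL2 h₁)}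
      add_mem' := by
        rintro _ _ ⟨f, g, hf, hg, rfl⟩ ⟨f', g', hf', hg', rfl⟩
        refine ⟨_, _, hf.add hf', hg.add hg', ?_⟩
        rw [ofSmooth_add hf hf', toL2_add hg hg']
        rfl
      zero_mem' := by
        refine ⟨_, _, (smooth_const (0 : E R)).const_smul 0,
          (continuous_const (y := (0 : E R))).const_smul (0 : ℝ), ?_⟩
        rw [ofSmooth_const_smul (smooth_const (0 : E R)), toL2_const_smul continuous_const,
          zero_smul, zero_smul]
        rfl
      neg_mem' := by
        rintro _ ⟨f, g, hf, hg, rfl⟩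
        refine ⟨_, _, hf.const_smul (-1), hg.const_smul (-1 : ℝ), ?_⟩
        rw [ofSmooth_const_smul hf, toL2_const_smul hg, neg_one_smul, neg_one_smul]
        rfl }
  have hd : d ∈ closure (S : Set (WithLp 2 (H1 R × L2 R))) := by
    rw [Metric.mem_closure_iff]
    intro ε hε
    obtain ⟨f₀, h₀, e₀⟩ := exists_smooth_approx_H1 w₀ (half_pos hε)
    obtain ⟨f₁, h₁, e₁⟩ := exists_continuous_approx_L2 w₁ (half_pos hε)
    refine ⟨_, ⟨f₀, f₁, h₀, h₁, rfl⟩, ?_⟩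
    rw [dist_eq_norm]
    refine (hnorm (w₀ - ofSmooth f₀ h₀) (w₁ - toL2 h₁)).trans_lt ?_
    rw [Real.sqrt_lt' hε]
    nlinarith [norm_nonneg (w₀ - ofSmooth f₀ h₀), norm_nonneg (w₁ - toL2 h₁)]
  obtain ⟨v, hv, hsum, hsm, hle⟩ := exists_series_of_mem_closure hd
  choose f₀ f₁ h₀ h₁ e using hv
  have en : ∀ k, ‖v k‖ = √(‖ofSmooth (f₀ k) (h₀ k)‖ ^ 2 + ‖toL2 (h₁ k)‖ ^ 2) := fun k => by
    rw [← hnorm, ← e]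
  refine ⟨f₀, f₁, h₀, h₁, ?_, ?_, by simpa only [en] using hsm,
      by simpa only [en, d, hnorm] using hle⟩
  · have h := (WithLp.fstL 2 ℝ (H1 R) (L2 R)).hasSum hsum
    simp only [e] at h
    exact h
  · have h := (WithLp.sndL 2 ℝ (H1 R) (L2 R)).hasSum hsum
    simp only [e] at h
    exact h

/-- All data can be steered to rest by a control supported in `ω`. -/
theorem exists_steeredWave_of_data {B C : Circ → Matrix (Fin R) (Fin R) ℝ} (hB : SmoothMat B)
    (hC : SmoothMat C) {ω : Set Circ} (hω : IsOpen ω) (hne : ω.Nonempty) :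
    ∃ K, 0 < K ∧ ∀ (w₀ : H1 R) (w₁ : L2 R), ∃ A α w p W Gu Gv μu μv,
      A ≤ K * √(‖w₀‖ ^ 2 + ‖w₁‖ ^ 2) ∧ SteeredWave hω B C A w₀ w₁ α w p W Gu Gv μu μv := by
  obtain ⟨K, hK, H⟩ := exists_steeredWave (R := R) hB hC hω hne
  refine ⟨K * 2, by positivity, fun w₀ w₁ => ?_⟩
  obtain ⟨f₀, f₁, h₀, h₁, s₀, s₁, hs, hle⟩ := exists_smooth_series w₀ w₁
  choose α w p W Gu Gv μu μv h using fun k => H (f₀ k) (f₁ k) (h₀ k) (h₁ k)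
  refine ⟨_, _, _, _, _, _, _, _, _, ?_, SteeredWave.tsum hB hC (hs.mul_left K) s₀ s₁ h⟩
  rw [tsum_mul_left, mul_assoc]
  exact mul_le_mul_of_nonneg_left hle hK.le

end Density

/-! ### Observability by duality -/

section Observability

variable {R : ℕ}

/-- The Cauchy-Schwarz inequality against the constant function `1`. -/
theorem sq_integral_le_mul_integral_sq {g : ℝ → ℝ} {T : ℝ} (hT : 0 < T)
    (hg : ContinuousOn g (Icc 0 T)) :
    (∫ t in (0)..T, g t) ^ 2 ≤ T * ∫ t in (0)..T, g t ^ 2 := by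
  have hu : uIcc 0 T = Icc 0 T := uIcc_of_le hT.le
  have i1 : IntervalIntegrable g volume 0 T := (hu ▸ hg).intervalIntegrable
  have i2 : IntervalIntegrable (fun t => g t ^ 2) volume 0 T :=
    ContinuousOn.intervalIntegrable (by rw [hu]; exact hg.pow 2)
  set m := (∫ t in (0)..T, g t) / T with hm
  have e : ∫ t in (0)..T, g t = m * T := by rw [hm]; field_simp
  have h : 0 ≤ ∫ t in (0)..T, (g t ^ 2 - (2 * m * g t - m ^ 2)) :=
    intervalIntegral.integral_nonneg hT.le fun t _ => by nlinarith [sq_nonneg (g t - m)]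
  rw [intervalIntegral.integral_sub i2 ((i1.const_mul _).sub intervalIntegrable_const),
    intervalIntegral.integral_sub (i1.const_mul _) intervalIntegrable_const,
    intervalIntegral.integral_const_mul, intervalIntegral.integral_const, smul_eq_mul, e] at h
  rw [e]
  nlinarith

/-- Observability by duality: the state at time `0` is tested against all the data that can be
steered to rest. -/
theorem exists_observability {b c : Circ → Matrix (Fin R) (Fin R) ℝ} (hb : SmoothMat b)
    (hc : SmoothMat c) {ω : Set Circ} (hω : IsOpen ω) (hne : ω.Nonempty) :
    ∃ C₀ : ℝ, 0 < C₀ ∧ ∀ (φ : ℝ → L2 R) (ψ : ℝ → HNeg1 R),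
      IsWeakSolution b c (32 * Real.pi) φ ψ →
      C₀ * (‖φ 0‖ ^ 2 + ‖ψ 0‖ ^ 2) ≤ ∫ t in (0)..(32 * Real.pi), ‖chi hω (φ t)‖ ^ 2 := by
  have hT : 0 < 32 * Real.pi := by positivity
  obtain ⟨S, hS, H⟩ := exists_steeredWave_of_data hb.transpose (hb.transpose.dx.sub hc.transpose)
    hω hne
  refine ⟨1 / (2 * S ^ 2 * (32 * Real.pi)), by positivity, fun φ ψ hφ => ?_⟩
  have hcont : ContinuousOn (fun t => ‖chi hω (φ t)‖) (Icc 0 (32 * Real.pi)) :=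
    ((chiL R hω).continuous.comp_continuousOn hφ.continuousOn_fst).norm
  set J := ∫ t in (0)..(32 * Real.pi), ‖chi hω (φ t)‖ with hJ
  have hJ0 : 0 ≤ J := intervalIntegral.integral_nonneg hT.le fun t _ => norm_nonneg _
  have hCS := sq_integral_le_mul_integral_sq hT hcont
  rw [← hJ] at hCS
  have key : ∀ (w₀ : H1 R) (w₁ : L2 R),
      |ψ 0 w₀ - ⟪φ 0, w₁⟫_ℝ| ≤ S * √(‖w₀‖ ^ 2 + ‖w₁‖ ^ 2) * J := fun w₀ w₁ => by
    obtain ⟨A, α, w, p, W, Gu, Gv, μu, μv, hA, h⟩ := H w₀ w₁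
    have h1 := hφ.abs_pairing_le hb hc hT hω h.cont_α (fun t ht => (h.bound t ht).1) h.sol h.final_w
      h.final_p
    rw [h.init_w, h.init_p] at h1
    exact h1.trans (mul_le_mul_of_nonneg_right hA hJ0)
  -- the data `(0, φ 0)` give the norm of `φ 0`, the data `(θ, 0)` that of `ψ 0`
  have n1 : ‖φ 0‖ ≤ S * J := by
    have h1 := key 0 (φ 0)
    rw [map_zero, zero_sub, abs_neg, real_inner_self_eq_norm_sq, norm_zero, zero_pow two_ne_zero,
      zero_add, Real.sqrt_sq (norm_nonneg _), abs_of_nonneg (sq_nonneg _)] at h1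
    rcases (norm_nonneg (φ 0)).eq_or_lt with h0 | h0
    · rw [← h0]; positivity
    · nlinarith
  have n2 : ‖ψ 0‖ ≤ S * J := by
    refine ContinuousLinearMap.opNorm_le_bound _ (by positivity) fun θ => ?_
    have h1 := key θ 0
    rw [inner_zero_right, sub_zero, norm_zero, zero_pow two_ne_zero, add_zero,
      Real.sqrt_sq (norm_nonneg _)] at h1
    rw [Real.norm_eq_abs]
    linarith
  have n3 := pow_le_pow_left₀ (norm_nonneg _) n1 2
  have n4 := pow_le_pow_left₀ (ContinuousLinearMap.opNorm_nonneg (ψ 0)) n2 2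
  rw [one_div, inv_mul_le_iff₀ (by positivity)]
  nlinarith [mul_le_mul_of_nonneg_left hCS (sq_nonneg S)]

end Observability

end WaveControl

end

theorem lemma5 (R : ℕ) (ω : Set Circ) (hω : IsOpen ω) (hne : ω.Nonempty) :
    (∀ b c : Circ → Matrix (Fin R) (Fin R) ℝ, SmoothMat b → SmoothMat c →
      ∃ C₀ : ℝ, 0 < C₀ ∧
        ∀ (φ : ℝ → L2 R) (φt : ℝ → HNeg1 R), IsWeakSolution b c (32 * Real.pi) φ φt →
          C₀ * (‖φ 0‖ ^ 2 + ‖φt 0‖ ^ 2) ≤ ∫ t in (0)..(32 * Real.pi), ‖chi hω (φ t)‖ ^ 2) ∧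
    (∀ B C : Circ → Matrix (Fin R) (Fin R) ℝ, SmoothMat B → SmoothMat C →
      ∃ S : ℝ, 0 < S ∧
        ∀ (w₀ : H1 R) (w₁ : L2 R),
          ∃ α : ℝ → L2 R, ContinuousOn α (Icc 0 (32 * Real.pi)) ∧
            (∀ t ∈ Icc 0 (32 * Real.pi), chi hω (α t) = α t) ∧
            ∃ (w : ℝ → H1 R) (p : ℝ → L2 R),
              IsEnergySolution B C (32 * Real.pi) (fun t => chi hω (α t)) w p ∧
              w 0 = w₀ ∧ p 0 = w₁ ∧
              (∀ (w' : ℝ → H1 R) (p' : ℝ → L2 R),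
                IsEnergySolution B C (32 * Real.pi) (fun t => chi hω (α t)) w' p' →
                w' 0 = w₀ → p' 0 = w₁ →
                ∀ t ∈ Icc 0 (32 * Real.pi), w' t = w t ∧ p' t = p t) ∧
              w (32 * Real.pi) = 0 ∧ p (32 * Real.pi) = 0 ∧
              (⨆ t ∈ Icc 0 (32 * Real.pi), ‖α t‖ₑ) + normW (32 * Real.pi) w p
                ≤ ENNReal.ofReal (S * Real.sqrt (‖w₀‖ ^ 2 + ‖w₁‖ ^ 2))) := by
  refine ⟨fun b c hb hc => exists_observability hb hc hω hne, fun B C hB hC => ?_⟩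
  obtain ⟨K, hK, H⟩ := exists_steeredWave_of_data hB hC hω hne
  -- one `K` for the control and seven for the norm of the wave
  refine ⟨8 * K, by positivity, fun w₀ w₁ => ?_⟩
  obtain ⟨A, α, w, p, W, Gu, Gv, μu, μv, hA, h⟩ := H w₀ w₁
  have hT : 0 < 32 * Real.pi := by positivity
  refine ⟨α, h.cont_α, h.chi_α, w, p, h.sol, h.init_w, h.init_p, fun w' p' h' hw hp t ht =>
    h.sol.unique hB hC hT h' (hw.trans h.init_w.symm) (hp.trans h.init_p.symm) ht, h.final_w,
    h.final_p, (add_le_add h.iSup_enorm_control_le h.normW_le).trans ?_⟩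
  rw [← ENNReal.ofReal_add h.nonneg (mul_nonneg (by norm_num) h.nonneg)]
  exact ENNReal.ofReal_le_ofReal (by linarith)
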